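/- **Setting.** Let $n\ge 1$ and let $V(x)=\sum_{j\ge1}\frac{t_j}{j}x^j$ be a real polynomial potential, all coupling constants $t_j$ being treated as independent variables (only finitely many are nonzero). Let $\mu_1<\dots<\mu_{2n}$ be real, $D=\bigcup_{i=1}^n[\mu_{2i-1},\mu_{2i}]$, let $\tilde y(p)=\sqrt{\prod_{\alpha}(p-\mu_\alpha)}$ be the branch analytic off $D$ with $\tilde y(p)\sim p^n$ at infinity, and put $$\phi^{(0)}=\frac1{\tilde y},\quad \phi^{(k)}_\alpha(p)=\frac{1}{(p-\mu_\alpha)^k\tilde y(p)},\quad M(p)=\oint_{C_\infty}\frac{d\omega}{2\pi i}\frac{V'(\omega)}{(\omega-p)\tilde y(\omega)},\quad M^{(k)}_\alpha=\oint_{C_D}\frac{d\omega}{2\pi i}V'(\omega)\phi^{(k)}_\alpha(\omega),$$ $y=M\tilde y$, $W_0=\frac12(V'-y)$ and $\hat K f(p)=\oint_{C_D}\frac{d\omega}{2\pi i}\frac{V'(\omega)}{p-\omega}f(\omega)$. Here $C_D$ encircles $D$ but not $p$, while $C_\infty$ encircles both. For $|p|>\max_\alpha|\mu_\alpha|$ the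 loop insertion operator is $\frac{d}{dV}(p)=-\sum_{j\ge1}\frac{j}{p^{j+1}}\frac{\partial}{\partial t_j}$; for other $p\notin D$ the functions $\frac{d}{dV}(p)G$ below are understood by analytic continuation in $p$. Consider an $n$-cut family of planar solutions: a set $U$ of potentials in which each coupling constant can be varied a little, and branch points $\mu_\alpha(V)$, $V\in U$, having partial derivatives in all $t_j$, such that for every $V\in U$ * $\frac12\oint_{C_D}\frac{d\omega}{2\pi i}\frac{\omega^kV'(\omega)}{\tilde y(\omega)}=\delta_{k,n}$ for $k=0,\dots,n$ (that is, $W_0(p)=\frac1p+O(p^{-2})$); * $M^{(1)}_\alpha=M(\mu_\alpha)\ne0$ for all $\alpha$; * the occupation numbers $S_j=\oint_{A_j}\frac{d\omega}{4\pi i}y(\omega)$, $j=1,\dots,n-1$, satisfy $\frac{d}{dV}S_j=0$ (all $\partial S_j/\partial t_i$ vanish). Here $A_j$ is a fixed circle, centred on the real axis, that encloses the $j$-th cut and no other cut for every $V\in U$. A *genus-one loop mean* is a function $W_1(p)=W_1(p;V)$, $V\in U$, $p\notin D$, that is analytic in $p$ off $D$, is $O(p^{-2})$ at infinity, satisfies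 the genus-one loop equation $$(\hat K-2W_0(p))\,W_1(p)=\frac{d}{dV}(p)\,W_0(p)\qquad(|p|>\max_\alpha|\mu_\alpha|),$$ and is a total derivative $W_1(p)=\frac{d}{dV}(p)F_1$, where $F_1$ is a differentiable function of the $\mu_\alpha$ and of finitely many moments $M^{(k)}_\alpha$. **Theorem.** The derivatives $\frac{d}{dV}(p)$ of $\mu_\alpha$, $M^{(k)}_\alpha$ ($k\ge1$), $\log|M^{(1)}_\alpha|$ and $\log|\mu_\alpha-\mu_\beta|$ ($\alpha\neq\beta$) exist on $U$ (their series converge for $|p|>\max_\alpha|\mu_\alpha|$, to functions that continue analytically to $p\notin D$), and for $V\in U$ and $p\notin D$: 1. With $K_{\alpha,j}=\oint_{A_j}\frac{\tilde y(\lambda)}{\lambda-\mu_\alpha}d\lambda$, there are unique polynomials $L_\alpha(p)=\sum_{l=0}^{n-2}L_{\alpha,l}p^l$ satisfying, identically in $p$, $$\sum_\alpha\mu_\alpha^kL_\alpha(p)-\sum_\alpha\sum_{l=0}^{k-1}\mu_\alpha^{k-l-1}p^l+2kp^{k-1}=0\ (0\le k\le n),\qquad \sum_\alpha K_{\alpha,j}L_\alpha(p)=0\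 (1\le j\le n-1),$$ and $M_\alpha^{(1)}\frac{d\mu_\alpha}{dV}(p)=\phi^{(1)}_\alpha(p)+L_\alpha(p)\phi^{(0)}(p)$. 2. For $k=1,2$ and each $\alpha$ there is a unique function $\chi^{(k)}_\alpha$ that is a finite linear combination (coefficients independent of $p$) of the functions $\frac{d\mu_\beta}{dV}(p)$, $\frac{dM^{(r)}_\beta}{dV}(p)$ and satisfies $(\hat K-2W_0(p))\chi^{(k)}_\alpha(p)=(p-\mu_\alpha)^{-k}$ for $|p|>\max_\beta|\mu_\beta|$. It is given by $$\chi_\alpha^{(1)}(p)=\frac{d\mu_\alpha}{dV}(p),\qquad \chi_\alpha^{(2)}(p)=-\frac23\frac{d}{dV}(p)\log|M_\alpha^{(1)}|-\frac13\sum_{\beta\ne\alpha}\frac{d}{dV}(p)\log|\mu_\alpha-\mu_\beta|.$$ 3. There is exactly one genus-one loop mean, namely $$W_1(p)=\frac1{16}\sum_{\alpha=1}^{2n}\chi^{(2)}_\alpha(p)-\frac18\sum_{1\le\alpha<\beta\le2n}\frac{\chi^{(1)}_\alpha(p)-\chi^{(1)}_\beta(p)}{\mu_\alpha-\mu_\beta}+\frac14\sum_{\alpha=1}^{2n}L_\alpha(\mu_\alpha)\chi^{(1)}_\alpha(p)$$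 $$=\frac1{16}\sum_{\alpha}\Big(-\frac23\frac{d}{dV}(p)\log|M_\alpha^{(1)}|-\frac13\sum_{\beta\ne\alpha}\frac{d}{dV}(p)\log|\mu_\alpha-\mu_\beta|\Big)-\frac18\sum_{\alpha<\beta}\frac{\frac{d\mu_\alpha}{dV}(p)-\frac{d\mu_\beta}{dV}(p)}{\mu_\alpha-\mu_\beta}+\frac14\sum_\alpha L_\alpha(\mu_\alpha)\frac{d\mu_\alpha}{dV}(p).$$ -/

import Mathlib

open scoped Polynomial Topology

noncomputable section

namespace MultiCut

/-! Geometry of the cuts. The `2 n` branch points are `μ : Fin (2 * n) → ℝ`, numbered from `0`;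
the sup norm `‖μ‖` is the largest of the `|μ α|`. -/

/-- Index of the left end of the `i`-th cut. -/
def lo {n : ℕ} (i : Fin n) : Fin (2 * n) := ⟨2 * i, by omega⟩

/-- Index of the right end of the `i`-th cut. -/
def hi {n : ℕ} (i : Fin n) : Fin (2 * n) := ⟨2 * i + 1, by omega⟩

/-- The support `D`, the union of the `n` cuts, as a subset of the complex plane. -/
def cuts {n : ℕ} (μ : Fin (2 * n) → ℝ) : Set ℂ :=
  ⋃ i : Fin n, Complex.ofReal '' Set.Icc (μ (lo i)) (μ (hi i))

/-- The branch of `√(∏ (p - μ_α))` which is cut along `D` and behaves as `p ^ n` at infinity.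
The quotient under the principal root is a negative real or undefined only on the cut. -/
def ytilde {n : ℕ} (μ : Fin (2 * n) → ℝ) (p : ℂ) : ℂ :=
  ∏ i : Fin n, (p - μ (hi i)) * ((p - μ (lo i)) / (p - μ (hi i))) ^ (1 / 2 : ℂ)

/-- `φ_α^{(k)}(p) = (p - μ_α)^{-k} / ỹ(p)`. -/
def phi {n : ℕ} (μ : Fin (2 * n) → ℝ) (α : Fin (2 * n)) (k : ℕ) (p : ℂ) : ℂ :=
  1 / ((p - μ α) ^ k * ytilde μ p)

/-- `φ^{(0)}(p) = 1 / ỹ(p)`. -/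
def phiZero {n : ℕ} (μ : Fin (2 * n) → ℝ) (p : ℂ) : ℂ := 1 / ytilde μ p

/-! The planar solution. `V` is the potential; only its derivative enters. -/

/-- `V'(ω)`. -/
def force (V : ℝ[X]) (ω : ℂ) : ℂ := Polynomial.aeval ω (Polynomial.derivative V)

/-- `∮ f(ω) dω / (2 π i)` over the positively oriented circle of radius `R` about `0`. -/
def contour (R : ℝ) (f : ℂ → ℂ) : ℂ := (2 * Real.pi * Complex.I)⁻¹ * ∮ ω in C(0, R), f ω

/-- The polynomial `M(p)`; the contour encircles `D` and `p`. -/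
def bigM {n : ℕ} (μ : Fin (2 * n) → ℝ) (V : ℝ[X]) (p : ℂ) : ℂ :=
  contour (max ‖μ‖ ‖p‖ + 1) fun ω => force V ω / ((ω - p) * ytilde μ ω)

/-- `y(p) = M(p) ỹ(p)`. -/
def bigY {n : ℕ} (μ : Fin (2 * n) → ℝ) (V : ℝ[X]) (p : ℂ) : ℂ := bigM μ V p * ytilde μ p

/-- The planar loop mean `W₀(p) = (V'(p) - y(p)) / 2`. -/
def planarW {n : ℕ} (μ : Fin (2 * n) → ℝ) (V : ℝ[X]) (p : ℂ) : ℂ :=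
  (force V p - bigY μ V p) / 2

/-- The moments `M_α^{(k)} = ∮_{C_D} V'(ω) φ_α^{(k)}(ω) dω / (2 π i)`. -/
def moment {n : ℕ} (μ : Fin (2 * n) → ℝ) (V : ℝ[X]) (α : Fin (2 * n)) (k : ℕ) : ℂ :=
  contour (‖μ‖ + 1) fun ω => force V ω * phi μ α k ω

/-- The operator `K̂ f (p) = ∮_{C_D} V'(ω) f(ω) / (p - ω) dω / (2 π i)` for `‖p‖ > ‖μ‖`;
the contour encircles `D` but not `p`. -/
def opK {n : ℕ} (μ : Fin (2 * n) → ℝ) (V : ℝ[X]) (f : ℂ → ℂ) (p : ℂ) : ℂ :=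
  contour ((‖μ‖ + ‖p‖) / 2) fun ω => force V ω / (p - ω) * f ω

/-- `(K̂ - 2 W₀(p)) f (p)`. -/
def loopOp {n : ℕ} (μ : Fin (2 * n) → ℝ) (V : ℝ[X]) (f : ℂ → ℂ) (p : ℂ) : ℂ :=
  opK μ V f p - 2 * planarW μ V p * f p

/-- The occupation number `∮_A y(ω) dω / (4 π i)`, where the cycle `A` is the circle with
centre `c` and radius `r`. -/
def occupation {n : ℕ} (μ : Fin (2 * n) → ℝ) (V : ℝ[X]) (c r : ℝ) : ℂ :=
  (4 * Real.pi * Complex.I)⁻¹ * ∮ ω in C((c : ℂ), r), bigY μ V ω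

/-- `K_{α,A} = ∮_A ỹ(λ) / (λ - μ_α) dλ`. -/
def periodK {n : ℕ} (μ : Fin (2 * n) → ℝ) (α : Fin (2 * n)) (c r : ℝ) : ℂ :=
  ∮ z in C((c : ℂ), r), ytilde μ z / (z - μ α)

/-! The loop insertion operator. The coupling constants of `V = ∑_{j ≥ 1} t_j x^j / j` are all
kept as independent variables. -/

/-- The potential obtained from `V` by adding `s` to the coupling constant `t_{j+1}`. -/
def shift (V : ℝ[X]) (j : ℕ) (s : ℝ) : ℝ[X] :=
  V + Polynomial.C (s / (j + 1)) * Polynomial.X ^ (j + 1)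

/-- The series `d/dV(p) G = - ∑_{j ≥ 1} j p^{-j-1} ∂G/∂t_j` at the potential `V` makes sense
and has the sum `w`. -/
def HasLoopInsertionAt (G : ℝ[X] → ℂ) (V : ℝ[X]) (p w : ℂ) : Prop :=
  (∀ j : ℕ, DifferentiableAt ℝ (fun s : ℝ => G (shift V j s)) 0) ∧
    HasSum (fun j : ℕ => -((j + 1 : ℂ) / p ^ (j + 2)) * deriv (fun s : ℝ => G (shift V j s)) 0) w

/-- `f` is the function `p ↦ d/dV(p) G`: it is analytic off the cuts, and it is the sum of the
series above wherever `|p|` exceeds all `|μ_α|`. -/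
def IsLoopInsertion {n : ℕ} (μ : ℝ[X] → Fin (2 * n) → ℝ) (G : ℝ[X] → ℂ) (V : ℝ[X])
    (f : ℂ → ℂ) : Prop :=
  AnalyticOnNhd ℂ f (cuts (μ V))ᶜ ∧ ∀ p : ℂ, ‖μ V‖ < ‖p‖ → HasLoopInsertionAt G V p (f p)

open Classical in
/-- `d/dV(p) G` at the potential `V`, for `p` off the cuts. -/
def dV {n : ℕ} (μ : ℝ[X] → Fin (2 * n) → ℝ) (G : ℝ[X] → ℂ) (V : ℝ[X]) (p : ℂ) : ℂ :=
  if h : ∃ f, IsLoopInsertion μ G V f then h.choose p else 0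

/-- The branch points, as functions of the potential. -/
def fMu {n : ℕ} (μ : ℝ[X] → Fin (2 * n) → ℝ) (α : Fin (2 * n)) (V : ℝ[X]) : ℂ := (μ V α : ℂ)

/-- The moments, as functions of the potential. -/
def fMoment {n : ℕ} (μ : ℝ[X] → Fin (2 * n) → ℝ) (α : Fin (2 * n)) (k : ℕ) (V : ℝ[X]) : ℂ :=
  moment (μ V) V α k

/-- `log |M_α^{(1)}|`, as a function of the potential. -/
def fLogM {n : ℕ} (μ : ℝ[X] → Fin (2 * n) → ℝ) (α : Fin (2 * n)) (V : ℝ[X]) : ℂ :=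
  (Real.log ‖moment (μ V) V α 1‖ : ℂ)

/-- `log |μ_α - μ_β|`, as a function of the potential. -/
def fLogDiff {n : ℕ} (μ : ℝ[X] → Fin (2 * n) → ℝ) (α β : Fin (2 * n)) (V : ℝ[X]) : ℂ :=
  (Real.log |μ V α - μ V β| : ℂ)

/-- A family of `n`-cut planar solutions with fixed occupation numbers: for each potential `V`
in the set `U`, the branch points are `μ V`. The `A`-cycle of the `j`-th cut (all cuts but the
last one) is the circle with centre `c j` on the real line and radius `r j`. -/
structure IsCutFamily {n : ℕ} (U : Set ℝ[X]) (μ : ℝ[X] → Fin (2 * n) → ℝ)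
    (c r : Fin (n - 1) → ℝ) : Prop where
  /-- every single coupling constant may be varied a little -/
  isOpen : ∀ V ∈ U, ∀ j : ℕ, ∀ᶠ s in 𝓝 (0 : ℝ), shift V j s ∈ U
  strictMono : ∀ V ∈ U, StrictMono (μ V)
  /-- the branch points have partial derivatives in the coupling constants -/
  differentiable : ∀ V ∈ U, ∀ (j : ℕ) (α : Fin (2 * n)),
    DifferentiableAt ℝ (fun s : ℝ => μ (shift V j s) α) 0
  /-- `W₀(p) = 1 / p + O(1 / p ^ 2)` -/
  asymptotic : ∀ V ∈ U, ∀ k ≤ n,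
    1 / 2 * contour (‖μ V‖ + 1) (fun ω => ω ^ k * force V ω / ytilde (μ V) ω) =
      if k = n then 1 else 0
  nonsingular : ∀ V ∈ U, ∀ α, moment (μ V) V α 1 ≠ 0
  /-- the `j`-th circle encloses the `j`-th cut -/
  encloses : ∀ V ∈ U, ∀ (j : Fin (n - 1)) (α : Fin (2 * n)),
    ((α : ℕ) = 2 * j ∨ (α : ℕ) = 2 * j + 1) → |μ V α - c j| < r j
  /-- the other cuts are outside the `j`-th circle -/
  excludes : ∀ V ∈ U, ∀ (j : Fin (n - 1)) (α : Fin (2 * n)),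
    ¬ ((α : ℕ) = 2 * j ∨ (α : ℕ) = 2 * j + 1) → r j < |μ V α - c j|
  /-- `dS_j/dV(p) = 0` -/
  occupation_fixed : ∀ V ∈ U, ∀ (j : Fin (n - 1)) (i : ℕ),
    HasDerivAt (fun s : ℝ => occupation (μ (shift V i s)) (shift V i s) (c j) (r j)) 0 0

/-- `L_α(p) = ∑_{l=0}^{n-2} L_{α,l} p^l`. -/
def zeroModePoly {n : ℕ} (L : Fin (2 * n) → Fin (n - 1) → ℂ) (α : Fin (2 * n)) (p : ℂ) : ℂ :=
  ∑ l : Fin (n - 1), L α l * p ^ (l : ℕ)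

/-- The linear system that determines the coefficients `L_{α,l}`. -/
def SolvesZeroModeSystem {n : ℕ} (μ : Fin (2 * n) → ℝ) (c r : Fin (n - 1) → ℝ)
    (L : Fin (2 * n) → Fin (n - 1) → ℂ) : Prop :=
  (∀ k ≤ n, ∀ p : ℂ,
    (∑ α, (μ α : ℂ) ^ k * zeroModePoly L α p)
      - (∑ α, ∑ l ∈ Finset.range k, (μ α : ℂ) ^ (k - l - 1) * p ^ l)
      + 2 * k * p ^ (k - 1) = 0) ∧
  ∀ (j : Fin (n - 1)) (p : ℂ), ∑ α, zeroModePoly L α p * periodK μ α (c j) (r j) = 0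

/-- `f` is expressed completely through the `dμ_α/dV(p)` and the `dM_α^{(k)}/dV(p)`, `k ≥ 1`. -/
def IsDerivativeCombination {n : ℕ} (μ : ℝ[X] → Fin (2 * n) → ℝ) (V : ℝ[X]) (f : ℂ → ℂ) : Prop :=
  ∃ (K : ℕ) (a : Fin (2 * n) → ℂ) (b : Fin (2 * n) → Fin K → ℂ), ∀ p ∉ cuts (μ V),
    f p = ∑ α, a α * dV μ (fMu μ α) V p
      + ∑ α, ∑ k : Fin K, b α k * dV μ (fMoment μ α (k + 1)) V p

/-- `f` is the basis function `χ_α^{(k)}`: `(K̂ - 2 W₀(p)) f(p) = (p - μ_α)^{-k}`, and the zero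
modes in `f` are fixed by the demand that `f` be a combination of `d/dV`-derivatives. -/
def IsBasisFunction {n : ℕ} (μ : ℝ[X] → Fin (2 * n) → ℝ) (V : ℝ[X]) (α : Fin (2 * n)) (k : ℕ)
    (f : ℂ → ℂ) : Prop :=
  IsDerivativeCombination μ V f ∧
    ∀ p : ℂ, ‖μ V‖ < ‖p‖ → loopOp (μ V) V f p = 1 / (p - μ V α) ^ k

/-- `W` is the genus-one loop mean, as a function of the potential and of `p`. -/
structure IsGenusOneLoopMean {n : ℕ} (U : Set ℝ[X]) (μ : ℝ[X] → Fin (2 * n) → ℝ)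
    (W : ℝ[X] → ℂ → ℂ) : Prop where
  analytic : ∀ V ∈ U, AnalyticOnNhd ℂ (W V) (cuts (μ V))ᶜ
  decay : ∀ V ∈ U, W V =O[Bornology.cobounded ℂ] fun p => 1 / p ^ 2
  /-- the genus-one loop equation `(K̂ - 2 W₀(p)) W₁(p) = dW₀(p)/dV(p)` -/
  loop : ∀ V ∈ U, ∀ p : ℂ, ‖μ V‖ < ‖p‖ →
    HasLoopInsertionAt (fun V' => planarW (μ V') V' p) V p (loopOp (μ V) V (W V) p)
  /-- `W₁(p) = dF₁/dV(p)` with `F₁` a function of the branch points and of finitely many moments -/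
  total : ∃ (K : ℕ) (F : (Fin (2 * n) → ℝ) × (Fin (2 * n) → Fin K → ℂ) → ℂ), ∀ V ∈ U,
    DifferentiableAt ℝ F (μ V, fun α k => moment (μ V) V α (k + 1)) ∧
    IsLoopInsertion μ (fun V' => F (μ V', fun α k => moment (μ V') V' α (k + 1))) V (W V)

end MultiCut

end

noncomputable section

namespace MultiCut

open Set Filter Metric MeasureTheory Bornology

section

/-! ### Circle integrals depending on a parameter -/

section Parametric

variable {𝕜 H : Type*} [RCLike 𝕜] [NormedAlgebra 𝕜 ℂ] [NormedAddCommGroup H] [NormedSpace 𝕜 H]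

/-! Everything rests on ỹ² = ∏ (z - μ_α): off the cuts, the derivatives of ỹ in z and in the branch
points are read off from this product, so branches never have to be tracked.

Branch points. Differentiating the n + 1 asymptotic conditions and the n - 1 occupation conditions
in one coupling constant gives 2n linear equations for x_α = M_α^{(1)} ∂μ_α, with coefficients μ_α^k
(k ≤ n) and K_{α,i}. This system is nondegenerate (`eq_zero_of_moments_of_periodK`). For a
homogeneous solution, Q(z) = ∑ x_α ∏_{β≠α} (z - μ_β) has degree at most n - 2 and all A-periods of Q
dz/ỹ vanish. Each period collapses to a real integral over its cut against a weight of constant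
sign, so the real and the imaginary part of Q both have a zero on each of n - 1 cuts, and Q = 0. The
same argument makes the matrix of the periods of z^l dz/ỹ invertible, so L_α can be defined by the
vanishing of all A-periods of φ_α^{(1)} + L_α φ^{(0)}. That this L_α solves the stated system
follows from two exact differentials: ∑ μ_α^k φ_α^{(1)} equals -2 (z^k/ỹ)' up to a polynomial over
ỹ, and ∑ K_{α,i} φ_α^{(1)} is twice the derivative of (Cauchy transform of ỹ)/ỹ. Integrating both
against z^{j+1} over a large circle shows that the Laurent coefficients of φ_α^{(1)} + L_α φ^{(0)}
obey the same 2n equations as x_α (`moment_mul_velocity`), which identifies dμ_α/dV.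

The operator T = K̂ - 2W₀. After blowing up the contour, T f = y f - ∮ V' f/(z - p) over a circle
around everything. T kills z^l/ỹ for l ≤ n, and division by z - μ_β commutes with T up to adding a
moment. Hence T(dμ_α/dV) = 1/(p - μ_α), while T(dM_α^{(k)}/dV) = -Tφ_α^{(k)} · (k/(p - μ_α) + ½ ∑_β
1/(p - μ_β)) has a pole of exact order k + 1 at μ_α because M_α^{(1)} ≠ 0. So T is injective on
combinations of these derivatives (`eqOn_of_loopOp_eq`), and every uniqueness claim, as well as the
formula for χ^{(2)}, becomes a comparison of rational functions.

Genus one. A direct computation (`hasLoopInsertionAt_planarW`) gives dW₀/dV as a quadratic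
expression in the 1/(p - μ_α) plus ¼ ∑ L_α(p)/(p - μ_α), in which L_α(p) may be replaced by
L_α(μ_α). This is T of the claimed W₁. It remains to see that W₁ is a total derivative: by Jacobi's
formula the terms with L_α(μ_α) come from the period determinant, d log|det K|/dV = -½ ∑ L_α(μ_α)
dμ_α/dV, so that F₁ = -(1/24) ∑ log|M_α^{(1)}| - (1/6) ∑_{α<β} log|μ_α - μ_β| - ½ log|det K|.
Conversely, the chain rule makes every admissible total derivative a combination of the dμ_α/dV and
dM_α^{(k)}/dV, so injectivity of T gives uniqueness. -/

theorem hasFDerivAt_intervalIntegral_of_continuousAt {F : H → ℝ → ℂ} {F' : H → ℝ → H →L[𝕜] ℂ}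
    {x₀ : H} {a b : ℝ}
    (hF : ∀ t ∈ uIcc a b, ∀ᶠ q in 𝓝 (x₀, t), ContinuousAt (fun q : H × ℝ => F q.1 q.2) q ∧
      HasFDerivAt (fun x => F x q.2) (F' q.1 q.2) q.1)
    (hF' : ∀ t ∈ uIcc a b, ContinuousAt (fun q : H × ℝ => F' q.1 q.2) (x₀, t)) :
    HasFDerivAt (fun x => ∫ t in a..b, F x t) (∫ t in a..b, F' x₀ t) x₀ := by
  -- Compactness bounds `F'` on the slice at `x₀`; the tube lemma in `key` then gives one
  -- neighbourhood of `x₀` on which `C + 1` dominates for all `t`.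
  obtain ⟨C, hC⟩ : ∃ C : ℝ, ∀ t ∈ uIcc a b, ‖F' x₀ t‖ ≤ C :=
    isCompact_uIcc.exists_bound_of_continuousOn fun t ht =>
      ((hF' t ht).comp (f := fun t : ℝ => (x₀, t)) (by fun_prop)).continuousWithinAt
  have key : ∀ᶠ x in 𝓝 x₀, ∀ t ∈ uIcc a b, ContinuousAt (fun q : H × ℝ => F q.1 q.2) (x, t) ∧
      HasFDerivAt (fun x => F x t) (F' x t) x ∧ ‖F' x t‖ ≤ C + 1 := by
    refine isCompact_uIcc.eventually_forall_of_forall_eventually fun t ht => ?_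
    have h1 := hF t ht
    have h2 : ∀ᶠ q in 𝓝 (x₀, t), ‖F' q.1 q.2‖ < C + 1 :=
      (hF' t ht).norm.eventually_lt continuousAt_const (by
        have := hC t ht; simp only; linarith)
    filter_upwards [h1, h2] with q hq1 hq2
    exact ⟨hq1.1, hq1.2, hq2.le⟩
  have hcont : ∀ x, (∀ t ∈ uIcc a b, ContinuousAt (fun q : H × ℝ => F q.1 q.2) (x, t)) →
      ContinuousOn (F x) (uIcc a b) := fun x hx t ht =>
    ((hx t ht).comp (f := fun t : ℝ => (x, t)) (by fun_prop)).continuousWithinAt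
  obtain ⟨s, hs, hsk⟩ := key.exists_mem
  refine intervalIntegral.hasFDerivAt_integral_of_dominated_of_fderiv_le (𝕜 := 𝕜) (s := s)
    (bound := fun _ => C + 1) hs ?_ ?_ ?_ ?_ ?_ ?_
  · filter_upwards [hs] with x hx
    exact ((hcont x fun t ht => (hsk x hx t ht).1).mono uIoc_subset_uIcc).aestronglyMeasurable
      measurableSet_uIoc
  · exact (hcont x₀ fun t ht => (hsk x₀ (mem_of_mem_nhds hs) t ht).1).intervalIntegrable
  · refine ContinuousOn.aestronglyMeasurable (fun t ht => ?_) measurableSet_uIoc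
    exact ((hF' t (uIoc_subset_uIcc ht)).comp (f := fun t : ℝ => (x₀, t))
      (by fun_prop)).continuousWithinAt
  · exact Eventually.of_forall fun t ht x hx => (hsk x hx t (uIoc_subset_uIcc ht)).2.2
  · exact intervalIntegrable_const
  · exact Eventually.of_forall fun t ht x hx => (hsk x hx t (uIoc_subset_uIcc ht)).2.1

theorem hasFDerivAt_circleIntegral {f : H → ℂ → ℂ} {x₀ : H} {c : ℂ} {R : ℝ}
    (h : ∀ z ∈ sphere c |R|, ContDiffAt 𝕜 1 (fun q : H × ℂ => f q.1 q.2) (x₀, z)) :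
    HasFDerivAt (fun x => ∮ z in C(c, R), f x z)
      (∫ θ in (0 : ℝ)..2 * Real.pi, deriv (circleMap c R) θ •
        (fderiv 𝕜 (fun q : H × ℂ => f q.1 q.2) (x₀, circleMap c R θ)).comp
          (ContinuousLinearMap.inl 𝕜 H ℂ)) x₀ := by
  have hcm : ∀ θ, circleMap c R θ ∈ sphere c |R| := fun θ => by
    rw [← range_circleMap]; exact mem_range_self θ
  have hmap : ∀ q : H × ℝ, ContinuousAt (fun q : H × ℝ => (q.1, circleMap c R q.2)) q := fun q => by
    have := continuous_circleMap c R
    fun_prop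
  unfold circleIntegral
  refine hasFDerivAt_intervalIntegral_of_continuousAt (𝕜 := 𝕜)
    (F' := fun x θ => deriv (circleMap c R) θ •
        (fderiv 𝕜 (fun q : H × ℂ => f q.1 q.2) (x, circleMap c R θ)).comp
          (ContinuousLinearMap.inl 𝕜 H ℂ)) (fun θ _ => ?_) (fun θ _ => ?_)
  · have h1 := (h _ (hcm θ)).eventually (by simp)
    have h2 := (hmap (x₀, θ)).eventually h1
    filter_upwards [h2] with q hq
    constructor
    · refine ContinuousAt.fun_smul ?_ (hq.continuousAt.comp
        (f := fun q : H × ℝ => (q.1, circleMap c R q.2)) (hmap q))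
      simp only [deriv_circleMap]
      have := continuous_circleMap 0 R
      fun_prop
    · have := (hq.differentiableAt (by simp)).hasFDerivAt
      have h3 : HasFDerivAt (fun x : H => (x, circleMap c R q.2))
          (ContinuousLinearMap.inl 𝕜 H ℂ) q.1 := by
        exact (hasFDerivAt_id (𝕜 := 𝕜) q.1).prodMk (hasFDerivAt_const (circleMap c R q.2) q.1)
      exact (this.comp q.1 h3).fun_const_smul (deriv (circleMap c R) q.2)
  · have h1 := ((h _ (hcm θ)).fderiv_right (m := 0) (by simp)).continuousAt
    refine ContinuousAt.fun_smul ?_ ?_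
    · simp only [deriv_circleMap]
      have := continuous_circleMap 0 R
      fun_prop
    · exact (h1.comp (f := fun q : H × ℝ => (q.1, circleMap c R q.2)) (hmap (x₀, θ))).clm_comp
        continuousAt_const

/-- The pointwise derivative `D` may be supplied in any convenient form: uniqueness of derivatives
identifies it with the joint derivative in the direction `(v, 0)`. Joint C¹ regularity is needed
only to justify differentiating under the integral. -/
theorem hasDerivAt_circleIntegral_comp {f : H → ℂ → ℂ} {γ : 𝕜 → H} {v : H} {t : 𝕜} {c : ℂ} {R : ℝ}
    (hR : 0 ≤ R) (hγ : HasDerivAt γ v t)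
    (h : ∀ z ∈ sphere c R, ContDiffAt 𝕜 1 (fun q : H × ℂ => f q.1 q.2) (γ t, z)) (D : ℂ → ℂ)
    (hD : ∀ z ∈ sphere c R, HasDerivAt (fun s => f (γ s) z) (D z) t) :
    HasDerivAt (fun s => ∮ z in C(c, R), f (γ s) z) (∮ z in C(c, R), D z) t := by
  rw [← abs_of_nonneg hR] at h hD
  have hcm : ∀ θ, circleMap c R θ ∈ sphere c |R| := fun θ => by
    rw [← range_circleMap]; exact mem_range_self θ
  have hmain := (hasFDerivAt_circleIntegral (𝕜 := 𝕜) h).comp_hasDerivAt t hγ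
  refine hmain.congr_deriv ?_
  rw [ContinuousLinearMap.intervalIntegral_apply]
  · unfold circleIntegral
    refine intervalIntegral.integral_congr fun θ _ => ?_
    have h1 := ((h _ (hcm θ)).differentiableAt (by simp)).hasFDerivAt
    have h3 : HasDerivAt (fun s : 𝕜 => (γ s, circleMap c R θ)) (v, 0) t :=
      hγ.prodMk (hasDerivAt_const t _)
    have h5 := HasFDerivAt.comp_hasDerivAt (f := fun s => (γ s, circleMap c R θ)) t h1 h3
    have h4 : (fderiv 𝕜 (fun q : H × ℂ => f q.1 q.2) (γ t, circleMap c R θ)) (v, 0) =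
        D (circleMap c R θ) := h5.unique (hD _ (hcm θ))
    simp only [smul_apply, ContinuousLinearMap.comp_apply,
      ContinuousLinearMap.inl_apply, h4]
  · refine ContinuousOn.intervalIntegrable fun θ _ => ContinuousAt.continuousWithinAt ?_
    have h1 := ((h _ (hcm θ)).fderiv_right (m := 0) (by simp)).continuousAt
    have h2 : ContinuousAt (fun θ => deriv (circleMap c R) θ) θ := by
      simp only [deriv_circleMap]
      have := continuous_circleMap 0 R
      fun_prop
    have := continuous_circleMap c R
    exact h2.smul ((h1.comp (f := fun θ : ℝ => (γ t, circleMap c R θ)) (by fun_prop)).clm_comp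
        continuousAt_const)

end Parametric

theorem circleIntegral_swap {f : ℂ → ℂ → ℂ} {c c' : ℂ} {R R' : ℝ} (hR : 0 ≤ R) (hR' : 0 ≤ R')
    (hf : ContinuousOn (fun q : ℂ × ℂ => f q.1 q.2) (sphere c R ×ˢ sphere c' R')) :
    (∮ z in C(c, R), ∮ w in C(c', R'), f z w) = ∮ w in C(c', R'), ∮ z in C(c, R), f z w := by
  have hcont : Continuous fun q : ℝ × ℝ => f (circleMap c R q.1) (circleMap c' R' q.2) := by
    refine continuousOn_univ.1 (hf.comp (f := fun q : ℝ × ℝ => (circleMap c R q.1, circleMap c' R' q.2))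
      ?_ ?_)
    · have := continuous_circleMap c R
      have := continuous_circleMap c' R'
      fun_prop
    · exact fun q _ => ⟨circleMap_mem_sphere c hR _, circleMap_mem_sphere c' hR' _⟩
  unfold circleIntegral
  simp only [smul_eq_mul, deriv_circleMap, ← intervalIntegral.integral_const_mul]
  rw [intervalIntegral_intervalIntegral_swap]
  · refine intervalIntegral.integral_congr fun θ _ => intervalIntegral.integral_congr fun τ _ => ?_
    ring
  · have h1 := continuous_circleMap 0 R
    have h2 := continuous_circleMap 0 R'
    refine (ContinuousOn.integrableOn_compact (isCompact_uIcc.prod isCompact_uIcc)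
      (Continuous.continuousOn ?_)).mono_set (Set.prod_mono uIoc_subset_uIcc uIoc_subset_uIcc)
    exact ((h1.comp continuous_fst).mul continuous_const).mul
      (((h2.comp continuous_snd).mul continuous_const).mul hcont)

/-- Conjugation maps a circle centred on the real axis to itself and reverses its orientation; hence
the minus sign. -/
theorem conj_circleIntegral {f : ℂ → ℂ} {c R : ℝ} (hR : 0 ≤ R)
    (hf : ∀ z ∈ sphere (c : ℂ) R, f (star z) = star (f z)) :
    star (∮ z in C((c : ℂ), R), f z) = -∮ z in C((c : ℂ), R), f z := by
  have hper : Function.Periodic (fun θ => deriv (circleMap (c : ℂ) R) θ • f (circleMap c R θ))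
      (2 * Real.pi) := fun θ => by
    simp only [deriv_circleMap, periodic_circleMap (c : ℂ) R θ, periodic_circleMap 0 R θ]
  have hstar : ∀ (a : ℝ) θ, star (circleMap a R θ) = circleMap a R (-θ) := fun a θ => by
    simp [circleMap, ← Complex.exp_conj]
  unfold circleIntegral
  have h1 : star (∫ θ in (0 : ℝ)..2 * Real.pi,
      deriv (circleMap (c : ℂ) R) θ • f (circleMap c R θ)) =
      ∫ θ in (0 : ℝ)..2 * Real.pi, star (deriv (circleMap (c : ℂ) R) θ • f (circleMap c R θ)) := by
    rw [intervalIntegral.integral_of_le (by positivity),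
      intervalIntegral.integral_of_le (by positivity)]
    exact (integral_conj (𝕜 := ℂ)).symm
  have h2 : ∀ θ : ℝ, star (deriv (circleMap (c : ℂ) R) θ • f (circleMap c R θ)) =
      -(deriv (circleMap (c : ℂ) R) (-θ) • f (circleMap c R (-θ))) := fun θ => by
    have := hstar 0 θ
    simp only [Complex.ofReal_zero] at this
    rw [deriv_circleMap, deriv_circleMap, star_smul, ← hf _ (circleMap_mem_sphere _ hR _), star_mul,
      hstar, this]
    simp only [Complex.star_def, Complex.conj_I, smul_eq_mul]
    ring
  rw [h1]
  simp only [h2]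
  rw [intervalIntegral.integral_neg, intervalIntegral.integral_comp_neg
    (fun θ => deriv (circleMap (c : ℂ) R) θ • f (circleMap c R θ))]
  have := hper.intervalIntegral_add_eq (-(2 * Real.pi)) 0
  simp only [neg_add_cancel, zero_add] at this
  rw [neg_zero, this]

/-! ### Contours around the origin -/

theorem contour_congr {R : ℝ} (hR : 0 ≤ R) {f g : ℂ → ℂ} (h : ∀ z, ‖z‖ = R → f z = g z) :
    contour R f = contour R g := by
  unfold contour
  rw [circleIntegral.integral_congr hR fun z hz => h z (by simpa using hz)]

theorem contour_add {R : ℝ} (hR : 0 ≤ R) {f g : ℂ → ℂ} (hf : ContinuousOn f (sphere 0 R))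
    (hg : ContinuousOn g (sphere 0 R)) :
    contour R (fun z => f z + g z) = contour R f + contour R g := by
  unfold contour
  rw [circleIntegral.integral_add (hf.circleIntegrable hR) (hg.circleIntegrable hR), mul_add]

theorem contour_sub {R : ℝ} (hR : 0 ≤ R) {f g : ℂ → ℂ} (hf : ContinuousOn f (sphere 0 R))
    (hg : ContinuousOn g (sphere 0 R)) :
    contour R (fun z => f z - g z) = contour R f - contour R g := by
  unfold contour
  rw [circleIntegral.integral_sub (hf.circleIntegrable hR) (hg.circleIntegrable hR), mul_sub]

theorem contour_const_mul (R : ℝ) (a : ℂ) (f : ℂ → ℂ) :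
    contour R (fun z => a * f z) = a * contour R f := by
  unfold contour
  rw [circleIntegral.integral_const_mul]
  ring

theorem contour_sum {ι : Type*} {R : ℝ} (hR : 0 ≤ R) (s : Finset ι) {f : ι → ℂ → ℂ}
    (hf : ∀ i ∈ s, ContinuousOn (f i) (sphere 0 R)) :
    contour R (fun z => ∑ i ∈ s, f i z) = ∑ i ∈ s, contour R (f i) := by
  unfold contour
  rw [circleIntegral.integral_fun_sum fun i hi => (hf i hi).circleIntegrable hR, Finset.mul_sum]

theorem contour_neg (R : ℝ) (f : ℂ → ℂ) : contour R (fun z => -f z) = -contour R f := by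
  simpa using contour_const_mul R (-1) f

theorem contour_deriv_eq_zero {R : ℝ} (hR : 0 ≤ R) {f f' : ℂ → ℂ}
    (h : ∀ z, ‖z‖ = R → HasDerivAt f (f' z) z) : contour R f' = 0 := by
  unfold contour
  rw [circleIntegral.integral_eq_zero_of_hasDerivWithinAt hR
    fun z hz => (h z (by simpa using hz)).hasDerivWithinAt, mul_zero]

theorem norm_contour_le {R C : ℝ} (hR : 0 ≤ R) {f : ℂ → ℂ} (h : ∀ z, ‖z‖ = R → ‖f z‖ ≤ C) :
    ‖contour R f‖ ≤ R * C :=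
  circleIntegral.norm_two_pi_i_inv_smul_integral_le_of_norm_le_const hR
    fun z hz => h z (by simpa using hz)

theorem contour_radius_eq {ρ R R' : ℝ} (hρ : 0 ≤ ρ) {f : ℂ → ℂ}
    (hf : ∀ z, ρ < ‖z‖ → DifferentiableAt ℂ f z) (hR : ρ < R) (hR' : ρ < R') :
    contour R f = contour R' f := by
  wlog h : R ≤ R' generalizing R R'
  · exact (this hR' hR (le_of_not_ge h)).symm
  unfold contour
  rw [Complex.circleIntegral_eq_of_differentiable_on_annulus_off_countable (hρ.trans_lt hR) h
    (s := ∅) countable_empty]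
  · intro z hz
    refine (hf z ?_).continuousAt.continuousWithinAt
    have := hz.2
    simp only [mem_ball, dist_zero_right, not_lt] at this
    linarith
  · intro z hz
    refine hf z ?_
    have := hz.1.2
    simp only [mem_closedBall, dist_zero_right, not_le] at this
    linarith

/-- The radius r goes to infinity: the length grows like r against a bound C/r². -/
theorem contour_eq_zero_of_isBigO {ρ R : ℝ} (hρ : 0 ≤ ρ) {f : ℂ → ℂ}
    (hf : ∀ z, ρ < ‖z‖ → DifferentiableAt ℂ f z) (hR : ρ < R)
    (hO : f =O[cobounded ℂ] fun z => (z ^ 2)⁻¹) : contour R f = 0 := by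
  obtain ⟨C, hC⟩ := hO.bound
  rw [← comap_norm_atTop, eventually_comap] at hC
  have h1 : ∀ᶠ r : ℝ in atTop, ‖contour R f‖ ≤ C / r := by
    filter_upwards [hC, eventually_gt_atTop R] with r hr hr'
    have h0 : 0 < r := by linarith
    rw [contour_radius_eq hρ hf hR (hR.trans hr')]
    refine (norm_contour_le h0.le (C := C / r ^ 2) fun z hz => ?_).trans_eq (by field_simp)
    have := hr z hz
    rwa [norm_inv, norm_pow, hz, ← div_eq_mul_inv] at this
  have h2 : Tendsto (fun r : ℝ => C / r) atTop (𝓝 0) := tendsto_const_nhds.div_atTop tendsto_id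
  exact norm_le_zero_iff.1 (ge_of_tendsto h2 h1)

/-- Subtracting the value at `p` removes the pole, so `dslope f p` has the same integral over both
circles; the normalized integral of 1/(z - p) is 1 outside and 0 inside. -/
theorem contour_annulus_cauchy {ρ R R' : ℝ} (hρ : 0 ≤ ρ) {f : ℂ → ℂ} {p : ℂ}
    (hf : ∀ z, ρ < ‖z‖ → DifferentiableAt ℂ f z) (hR : ρ < R) (hRp : R < ‖p‖) (hpR : ‖p‖ < R') :
    contour R' (fun z => f z / (z - p)) - contour R (fun z => f z / (z - p)) = f p := by
  have h0 : 0 < R := hρ.trans_lt hR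
  have hcont : ∀ z, ρ < ‖z‖ → ContinuousAt (dslope f p) z := fun z hz => by
    rcases eq_or_ne z p with rfl | hne
    · exact continuousAt_dslope_same.2 (hf z hz)
    · exact (continuousAt_dslope_of_ne hne).2 (hf z hz).continuousAt
  have h1 : contour R' (dslope f p) = contour R (dslope f p) := by
    unfold contour
    rw [Complex.circleIntegral_eq_of_differentiable_on_annulus_off_countable h0 (hRp.trans hpR).le
      (s := {p}) (countable_singleton p)]
    · intro z hz
      refine (hcont z ?_).continuousWithinAt
      have := hz.2
      simp only [mem_ball, dist_zero_right, not_lt] at this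
      linarith
    · intro z hz
      refine (differentiableAt_dslope_of_ne hz.2).2 (hf z ?_)
      have := hz.1.2
      simp only [mem_closedBall, dist_zero_right, not_le] at this
      linarith
  have hne : ∀ {r : ℝ}, r ≠ ‖p‖ → ∀ z, ‖z‖ = r → z - p ≠ 0 := fun hr z hz h => by
    rw [sub_eq_zero] at h
    exact hr (by rw [← hz, h])
  have hcts : ∀ {r : ℝ}, r ≠ ‖p‖ → ContinuousOn (fun z => (z - p)⁻¹) (sphere (0 : ℂ) r) :=
    fun hr => ContinuousOn.inv₀ (by fun_prop) fun z hz => hne hr z (by simpa using hz)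
  have h2 : ∀ r : ℝ, R ≤ r → r ≠ ‖p‖ → contour r (dslope f p) =
      contour r (fun z => f z / (z - p)) - f p * contour r (fun z => (z - p)⁻¹) := by
    intro r hr hr'
    rw [← contour_const_mul, ← contour_sub (h0.le.trans hr)]
    · refine contour_congr (h0.le.trans hr) fun z hz => ?_
      have := hne hr' z hz
      rw [dslope_of_ne _ (sub_ne_zero.1 this), slope_def_field]
      field_simp
    · intro z hz
      have hz' : ‖z‖ = r := by simpa using hz
      exact ((hf z (by linarith)).continuousAt.div (by fun_prop)
        (hne hr' z hz')).continuousWithinAt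
    · exact continuousOn_const.mul (hcts hr')
  have h3 : contour R' (fun z => (z - p)⁻¹) = 1 := by
    unfold contour
    rw [circleIntegral.integral_sub_inv_of_mem_ball (by simpa using hpR)]
    exact inv_mul_cancel₀ (by simp [Real.pi_ne_zero])
  have h4 : contour R (fun z => (z - p)⁻¹) = 0 := by
    unfold contour
    rw [Complex.circleIntegral_eq_zero_of_differentiable_on_off_countable h0.le countable_empty,
      mul_zero]
    · intro z hz
      refine (ContinuousAt.fun_inv₀ (by fun_prop) fun h => ?_).continuousWithinAt
      rw [sub_eq_zero] at h
      subst h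
      simp at hz
      linarith
    · intro z hz
      refine DifferentiableAt.inv (by fun_prop) fun h => ?_
      rw [sub_eq_zero] at h
      subst h
      simp at hz
      linarith
  rw [h2 R le_rfl hRp.ne, h2 R' (hRp.trans hpR).le hpR.ne', h3, h4] at h1
  linear_combination h1

theorem isBigO_inv_sub (p : ℂ) :
    (fun z : ℂ => (z - p)⁻¹) =O[cobounded ℂ] fun z => z⁻¹ := by
  refine Asymptotics.IsBigO.of_bound 2 ?_
  have h : ∀ᶠ z : ℂ in cobounded ℂ, 2 * ‖p‖ + 1 ≤ ‖z‖ :=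
    tendsto_norm_cobounded_atTop.eventually_ge_atTop _
  filter_upwards [h] with z hz
  have h1 : ‖z‖ - ‖p‖ ≤ ‖z - p‖ := norm_sub_norm_le z p
  have h0 := norm_nonneg p
  rw [norm_inv, norm_inv, ← div_eq_mul_inv, inv_le_comm₀ (by linarith) (by
    apply div_pos <;> linarith), inv_div]
  linarith

theorem contour_exterior_cauchy {ρ R : ℝ} (hρ : 0 ≤ ρ) {f : ℂ → ℂ} {p : ℂ}
    (hf : ∀ z, ρ < ‖z‖ → DifferentiableAt ℂ f z) (hR : ρ < R) (hRp : R < ‖p‖)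
    (hO : f =O[cobounded ℂ] fun z => z⁻¹) :
    contour R (fun z => f z / (p - z)) = f p := by
  have h1 := contour_annulus_cauchy hρ hf hR hRp (lt_add_one ‖p‖)
  have h2 : contour (‖p‖ + 1) (fun z => f z / (z - p)) = 0 := by
    refine contour_eq_zero_of_isBigO (ρ := ‖p‖) (norm_nonneg p) (fun z hz => ?_) (lt_add_one _) ?_
    · exact (hf z (by linarith)).div (by fun_prop) fun h => by
        rw [sub_eq_zero] at h
        rw [h] at hz
        exact lt_irrefl _ hz
    · have := hO.mul (isBigO_inv_sub p)
      simpa only [← div_eq_mul_inv, sq, mul_inv] using this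
  rw [h2, zero_sub, ← contour_neg] at h1
  rw [← h1]
  congr 1
  ext z
  rw [← div_neg, neg_sub]

theorem hasSum_contour {R : ℝ} (hR : 0 ≤ R) {g : ℕ → ℂ → ℂ} {G : ℂ → ℂ} {u : ℕ → ℝ}
    (hu : Summable u) (hg : ∀ j, ContinuousOn (g j) (sphere 0 R))
    (hb : ∀ j z, ‖z‖ = R → ‖g j z‖ ≤ u j) (hs : ∀ z, ‖z‖ = R → HasSum (fun j => g j z) (G z)) :
    HasSum (fun j => contour R (g j)) (contour R G) := by
  unfold contour
  refine HasSum.mul_left _ ?_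
  unfold circleIntegral
  have hcm : ∀ θ, ‖circleMap 0 R θ‖ = R := fun θ => by simp [abs_of_nonneg hR]
  refine intervalIntegral.hasSum_integral_of_dominated_convergence (fun j _ => R * u j) ?_ ?_ ?_ ?_ ?_
  · intro j
    have := ((hg j).circleIntegrable hR).out.aestronglyMeasurable
    rwa [uIoc_of_le (by positivity)]
  · refine fun j => Eventually.of_forall fun θ _ => ?_
    rw [norm_smul, deriv_circleMap, norm_mul, Complex.norm_I, mul_one, hcm]
    exact mul_le_mul_of_nonneg_left (hb j _ (hcm θ)) hR
  · exact Eventually.of_forall fun θ _ => hu.mul_left R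
  · exact intervalIntegrable_const
  · exact Eventually.of_forall fun θ _ => (hs _ (hcm θ)).const_smul _

theorem hasSum_contour_pow_div {R : ℝ} (hR : 0 ≤ R) {h : ℂ → ℂ} (hh : ContinuousOn h (sphere 0 R))
    {p : ℂ} (hp : R < ‖p‖) :
    HasSum (fun j : ℕ => contour R (fun z => z ^ j * h z) / p ^ (j + 1))
      (contour R fun z => h z / (p - z)) := by
  have hp0 : 0 < ‖p‖ := hR.trans_lt hp
  have hp1 : p ≠ 0 := norm_pos_iff.1 hp0
  obtain ⟨C, hC⟩ := (isCompact_sphere (0 : ℂ) R).exists_bound_of_continuousOn hh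
  have key := hasSum_contour hR (g := fun j z => (p ^ (j + 1))⁻¹ * (z ^ j * h z))
    (G := fun z => h z / (p - z)) (u := fun j => (R / ‖p‖) ^ j * (C / ‖p‖))
    ((summable_geometric_of_lt_one (by positivity) ((div_lt_one hp0).2 hp)).mul_right _)
    (fun j => by fun_prop) ?_ ?_
  · simpa only [contour_const_mul, div_eq_inv_mul] using key
  · intro j z hz
    have := hC z (by simpa using hz)
    simp only [norm_mul, norm_inv, norm_pow, hz]
    calc (‖p‖ ^ (j + 1))⁻¹ * (R ^ j * ‖h z‖) ≤ (‖p‖ ^ (j + 1))⁻¹ * (R ^ j * C) := by gcongr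
      _ = _ := by rw [div_pow]; field_simp; ring
  · intro z hz
    have h1 : ‖z / p‖ < 1 := by rw [norm_div, hz, div_lt_one hp0]; exact hp
    have hne : p - z ≠ 0 := fun h => by rw [sub_eq_zero] at h; rw [h, hz] at hp; exact lt_irrefl _ hp
    have := (hasSum_geometric_of_norm_lt_one h1).mul_right (h z / p)
    convert! this using 1
    · ext j
      rw [div_pow]
      field_simp
      ring
    · have : 1 - z / p ≠ 0 := fun h => hne (by
        field_simp at h
        simpa using h)
      field_simp

/-- The kernel of the loop insertion operator: with its weights the monomials z^j sum to -1/(p -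
z)². -/
theorem hasSum_contour_insertion {R : ℝ} (hR : 0 ≤ R) {h : ℂ → ℂ}
    (hh : ContinuousOn h (sphere 0 R)) {p : ℂ} (hp : R < ‖p‖) :
    HasSum (fun j : ℕ => -((j + 1 : ℂ) / p ^ (j + 2)) * contour R (fun z => z ^ j * h z))
      (-contour R fun z => h z / (p - z) ^ 2) := by
  have hp0 : 0 < ‖p‖ := hR.trans_lt hp
  have hp1 : p ≠ 0 := norm_pos_iff.1 hp0
  obtain ⟨C, hC⟩ := (isCompact_sphere (0 : ℂ) R).exists_bound_of_continuousOn hh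
  have hlt : ‖R / ‖p‖‖ < 1 := by
    rw [Real.norm_of_nonneg (by positivity)]; exact (div_lt_one hp0).2 hp
  have hsum : Summable fun j : ℕ => ((j : ℝ) + 1) * (R / ‖p‖) ^ j := by
    have := summable_choose_mul_geometric_of_norm_lt_one 1 hlt
    simpa [add_comm] using this
  have key := hasSum_contour hR (g := fun j z => ((j + 1 : ℂ) / p ^ (j + 2)) * (z ^ j * h z))
    (G := fun z => h z / (p - z) ^ 2) (u := fun j => ((j : ℝ) + 1) * (R / ‖p‖) ^ j * (C / ‖p‖ ^ 2))
    (hsum.mul_right _) (fun j => by fun_prop) ?_ ?_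
  · simpa only [contour_const_mul, neg_mul] using key.neg
  · intro j z hz
    have := hC z (by simpa using hz)
    have hj : ‖(j + 1 : ℂ)‖ = (j : ℝ) + 1 := by
      rw [show (j + 1 : ℂ) = ((j + 1 : ℕ) : ℂ) by push_cast; rfl, Complex.norm_natCast]
      push_cast; rfl
    simp only [norm_mul, norm_div, norm_pow, hz, hj]
    calc ((j : ℝ) + 1) / ‖p‖ ^ (j + 2) * (R ^ j * ‖h z‖)
        ≤ ((j : ℝ) + 1) / ‖p‖ ^ (j + 2) * (R ^ j * C) := by gcongr
      _ = _ := by rw [div_pow]; field_simp; ring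
  · intro z hz
    have h1 : ‖z / p‖ < 1 := by rw [norm_div, hz, div_lt_one hp0]; exact hp
    have hne : p - z ≠ 0 := fun h => by rw [sub_eq_zero] at h; rw [h, hz] at hp; exact lt_irrefl _ hp
    have h2 := (hasSum_choose_mul_geometric_of_norm_lt_one 1 h1).mul_right (h z / p ^ 2)
    convert! h2 using 1
    · ext j
      simp only [Nat.choose_one_right, div_pow]
      push_cast
      field_simp
      ring
    · rw [show 1 - z / p = (p - z) / p by field_simp, div_pow]
      field_simp
      ring

/-- The Laurent expansion, with the factor -1/(j + 1) arranged so that it reads as a loop insertion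
series. It turns equality of the coefficients with partial derivatives into a formula for d/dV. -/
theorem hasSum_laurent {ρ R : ℝ} (hρ : 0 ≤ ρ) {f : ℂ → ℂ} {p : ℂ}
    (hf : ∀ z, ρ < ‖z‖ → DifferentiableAt ℂ f z) (hR : ρ < R) (hp : ρ < ‖p‖)
    (hO : f =O[cobounded ℂ] fun z => (z ^ 2)⁻¹) :
    HasSum (fun j : ℕ => -((j + 1 : ℂ) / p ^ (j + 2)) *
      (-(1 / (j + 1)) * contour R (fun z => z ^ (j + 1) * f z))) (f p) := by
  obtain ⟨r, hr, hr'⟩ := exists_between hp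
  have h0 : 0 < r := hρ.trans_lt hr
  have hO1 : f =O[cobounded ℂ] fun z => z⁻¹ := by
    refine hO.trans (Asymptotics.IsBigO.of_bound 1 ?_)
    have h : ∀ᶠ z : ℂ in cobounded ℂ, 1 ≤ ‖z‖ :=
      tendsto_norm_cobounded_atTop.eventually_ge_atTop _
    filter_upwards [h] with z hz
    rw [norm_inv, norm_inv, norm_pow, one_mul]
    exact inv_anti₀ (by linarith) (by nlinarith)
  have h1 := hasSum_contour_pow_div h0.le (h := f) (fun z hz =>
    (hf z (by simp at hz; linarith)).continuousAt.continuousWithinAt) hr'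
  -- The coefficient of 1/p vanishes by the quadratic decay, so the series may start at 1/p².
  rw [contour_exterior_cauchy hρ hf hr hr' hO1, ← hasSum_nat_add_iff' 1] at h1
  simp only [Finset.sum_range_one, pow_zero, one_mul,
    contour_eq_zero_of_isBigO hρ hf hr hO, zero_div, sub_zero] at h1
  convert! h1 using 2 with j
  rw [contour_radius_eq hρ (f := fun z => z ^ (j + 1) * f z)
    (fun z hz => (by fun_prop : DifferentiableAt ℂ (fun z : ℂ => z ^ (j + 1)) z).mul (hf z hz)) hR hr]
  have : (j + 1 : ℂ) ≠ 0 := by exact_mod_cast Nat.succ_ne_zero j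
  field_simp

theorem star_contour {R : ℝ} (hR : 0 ≤ R) {f : ℂ → ℂ}
    (hf : ∀ z, ‖z‖ = R → f (star z) = star (f z)) : star (contour R f) = contour R f := by
  have := conj_circleIntegral (c := 0) hR (f := f) fun z hz => hf z (by simpa using hz)
  unfold contour
  simp only [Complex.ofReal_zero] at this
  rw [star_mul, this]
  simp
  ring

end

section

/-! ### The cuts and the square root -/

variable {n : ℕ}

theorem exists_lo_or_hi (α : Fin (2 * n)) : ∃ i : Fin n, α = lo i ∨ α = hi i := by
  refine ⟨⟨α / 2, by omega⟩, ?_⟩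
  simp only [lo, hi, Fin.ext_iff]
  omega

theorem prod_lo_hi {M : Type*} [CommMonoid M] (g : Fin (2 * n) → M) :
    ∏ α, g α = ∏ i : Fin n, g (lo i) * g (hi i) := by
  have h : ∀ i : Fin n, g (lo i) * g (hi i) =
      ∏ j : Fin 2, g (finProdFinEquiv.trans (finCongr (mul_comm n 2)) (i, j)) := fun i => by
    rw [Fin.prod_univ_two]
    congr 2 <;> simp [lo, hi, Fin.ext_iff, finProdFinEquiv]
    omega
  simp only [h]
  rw [← Fintype.prod_prod_type', Equiv.prod_comp]

theorem lo_lt_hi {μ : Fin (2 * n) → ℝ} (hμ : StrictMono μ) (i : Fin n) : μ (lo i) < μ (hi i) :=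
  hμ (by simp [lo, hi])

theorem mem_cuts {μ : Fin (2 * n) → ℝ} {z : ℂ} :
    z ∈ cuts μ ↔ ∃ i : Fin n, ∃ x : ℝ, μ (lo i) ≤ x ∧ x ≤ μ (hi i) ∧ (x : ℂ) = z := by
  simp [cuts, and_assoc]

theorem mem_cuts_branch {μ : Fin (2 * n) → ℝ} (hμ : StrictMono μ) (α : Fin (2 * n)) :
    (μ α : ℂ) ∈ cuts μ := by
  obtain ⟨i, rfl | rfl⟩ := exists_lo_or_hi α
  · exact mem_cuts.2 ⟨i, _, le_rfl, (lo_lt_hi hμ i).le, rfl⟩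
  · exact mem_cuts.2 ⟨i, _, (lo_lt_hi hμ i).le, le_rfl, rfl⟩

theorem sub_branch_ne_zero {μ : Fin (2 * n) → ℝ} (hμ : StrictMono μ) {z : ℂ} (hz : z ∉ cuts μ)
    (α : Fin (2 * n)) : z - μ α ≠ 0 := fun h =>
  hz (by rw [sub_eq_zero.1 h]; exact mem_cuts_branch hμ α)

theorem abs_le_of_mem_cut {μ : Fin (2 * n) → ℝ} {i : Fin n} {x : ℝ} (h1 : μ (lo i) ≤ x)
    (h2 : x ≤ μ (hi i)) : |x| ≤ ‖μ‖ := by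
  have h3 := norm_le_pi_norm μ (lo i)
  have h4 := norm_le_pi_norm μ (hi i)
  rw [Real.norm_eq_abs] at h3 h4
  exact abs_le.2 ⟨by linarith [neg_abs_le (μ (lo i))], by linarith [le_abs_self (μ (hi i))]⟩

theorem notMem_cuts_of_lt {μ : Fin (2 * n) → ℝ} {z : ℂ} (hz : ‖μ‖ < ‖z‖) : z ∉ cuts μ := by
  rintro h
  obtain ⟨i, x, h1, h2, rfl⟩ := mem_cuts.1 h
  rw [Complex.norm_real] at hz
  exact absurd (abs_le_of_mem_cut h1 h2) (not_le.2 hz)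

theorem isClosed_cuts (μ : Fin (2 * n) → ℝ) : IsClosed (cuts μ) :=
  isClosed_iUnion_of_finite fun _ => (isCompact_Icc.image Complex.continuous_ofReal).isClosed

theorem isOpen_compl_cuts (μ : Fin (2 * n) → ℝ) : IsOpen (cuts μ)ᶜ := (isClosed_cuts μ).isOpen_compl

/-- The cuts lie on the real line. Each closed half-plane without them lies between an open
half-plane and its closure, hence is connected, and the two meet at ‖μ‖ + 1. -/
theorem isPreconnected_compl_cuts (μ : Fin (2 * n) → ℝ) : IsPreconnected (cuts μ)ᶜ := by
  suffices IsConnected (((cuts μ)ᶜ ∩ {z | 0 ≤ z.im}) ∪ ((cuts μ)ᶜ ∩ {z | z.im ≤ 0})) by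
    rw [← Set.inter_union_distrib_left] at this
    convert this.isPreconnected
    symm
    rw [inter_eq_left]
    exact fun z _ => le_total 0 z.im
  have himg : ∀ z ∈ cuts μ, z.im = 0 := fun z hz => by
    obtain ⟨i, x, -, -, rfl⟩ := mem_cuts.1 hz
    exact Complex.ofReal_im x
  refine IsConnected.union ?_ ?_ ?_
  · refine ⟨((‖μ‖ + 1 : ℝ) : ℂ), ⟨?_, ?_⟩, ?_, ?_⟩
    · refine notMem_cuts_of_lt ?_
      rw [Complex.norm_real, Real.norm_of_nonneg (by positivity)]
      linarith
    · simp
    · refine notMem_cuts_of_lt ?_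
      rw [Complex.norm_real, Real.norm_of_nonneg (by positivity)]
      linarith
    · simp
  · refine Complex.isConnected_of_upperHalfPlane (fun z hz => ⟨fun h => ?_, ?_⟩) inter_subset_right
    · simp [himg z h] at hz
    · exact (show 0 < z.im from hz).le
  · refine Complex.isConnected_of_lowerHalfPlane (fun z hz => ⟨fun h => ?_, ?_⟩) inter_subset_right
    · simp [himg z h] at hz
    · exact (show z.im < 0 from hz).le

/-- If the quotient were t ≤ 0, then z = (a - t b)/(1 - t) would be a convex combination of a and b.
-/
theorem div_mem_slitPlane {a b : ℝ} (hab : a ≤ b) {z : ℂ}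
    (hz : ∀ x : ℝ, a ≤ x → x ≤ b → (x : ℂ) ≠ z) : (z - a) / (z - b) ∈ Complex.slitPlane := by
  rw [Complex.mem_slitPlane_iff_not_le_zero]
  intro h
  have hb : z - b ≠ 0 := sub_ne_zero.2 (hz b hab le_rfl).symm
  obtain ⟨t, ht0, ht⟩ : ∃ t : ℝ, t ≤ 0 ∧ (z - a) / (z - b) = t := by
    rw [Complex.le_def] at h
    exact ⟨((z - a) / (z - b)).re, h.1, Complex.ext rfl h.2⟩
  rw [div_eq_iff hb] at ht
  have h1 : (1 - t) ≠ 0 := by linarith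
  have h2 : (1 - t : ℂ) ≠ 0 := by exact_mod_cast h1
  refine hz ((a - t * b) / (1 - t)) ?_ ?_ ?_
  · rw [le_div_iff₀ (by linarith)]; nlinarith
  · rw [div_le_iff₀ (by linarith)]; nlinarith
  · push_cast
    rw [div_eq_iff h2]
    linear_combination -ht

theorem ratio_mem_slitPlane {μ : Fin (2 * n) → ℝ} (hμ : StrictMono μ) {z : ℂ} (hz : z ∉ cuts μ)
    (i : Fin n) : (z - μ (lo i)) / (z - μ (hi i)) ∈ Complex.slitPlane :=
  div_mem_slitPlane (lo_lt_hi hμ i).le fun x h1 h2 h =>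
    hz (mem_cuts.2 ⟨i, x, h1, h2, h⟩)

theorem cpow_half_sq {w : ℂ} : (w ^ (1 / 2 : ℂ)) ^ 2 = w := by
  rw [one_div]
  exact_mod_cast Complex.cpow_nat_inv_pow w two_ne_zero

theorem ytilde_sq {μ : Fin (2 * n) → ℝ} (hμ : StrictMono μ) {z : ℂ} (hz : z ∉ cuts μ) :
    ytilde μ z ^ 2 = ∏ α, (z - μ α) := by
  rw [prod_lo_hi, ytilde, ← Finset.prod_pow]
  refine Finset.prod_congr rfl fun i _ => ?_
  have := sub_branch_ne_zero hμ hz (hi i)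
  rw [mul_pow, cpow_half_sq]
  field_simp

theorem ytilde_ne_zero {μ : Fin (2 * n) → ℝ} (hμ : StrictMono μ) {z : ℂ} (hz : z ∉ cuts μ) :
    ytilde μ z ≠ 0 := by
  have h : ytilde μ z ^ 2 ≠ 0 := by
    rw [ytilde_sq hμ hz]
    exact Finset.prod_ne_zero_iff.2 fun α _ => sub_branch_ne_zero hμ hz α
  exact fun h0 => h (by rw [h0]; ring)

theorem contDiffAt_cpow_half {w : ℂ} (hw : w ∈ Complex.slitPlane) :
    ContDiffAt ℂ 1 (fun w : ℂ => w ^ (1 / 2 : ℂ)) w :=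
  (analyticAt_id.cpow analyticAt_const hw).contDiffAt

theorem contDiffAt_ytilde {μ : Fin (2 * n) → ℝ} (hμ : StrictMono μ) {z : ℂ} (hz : z ∉ cuts μ) :
    ContDiffAt ℝ 1 (fun q : (Fin (2 * n) → ℝ) × ℂ => ytilde q.1 q.2) (μ, z) := by
  unfold ytilde
  have hsub : ∀ α, ContDiff ℝ 1 fun q : (Fin (2 * n) → ℝ) × ℂ => q.2 - (q.1 α : ℂ) := fun α =>
    contDiff_snd.sub (Complex.ofRealCLM.contDiff.comp
      ((contDiff_apply ℝ ℝ α).comp contDiff_fst))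
  refine contDiffAt_prod fun i _ => (hsub (hi i)).contDiffAt.mul ?_
  have h0 : z - (μ (hi i) : ℂ) ≠ 0 := sub_branch_ne_zero hμ hz (hi i)
  have hr : ContDiffAt ℝ 1 (fun q : (Fin (2 * n) → ℝ) × ℂ =>
      (q.2 - (q.1 (lo i) : ℂ)) / (q.2 - (q.1 (hi i) : ℂ))) (μ, z) := by
    simp only [div_eq_mul_inv]
    exact (hsub (lo i)).contDiffAt.mul ((hsub (hi i)).contDiffAt.fun_inv h0)
  exact ((contDiffAt_cpow_half (ratio_mem_slitPlane hμ hz i)).restrict_scalars ℝ).comp (μ, z) hr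

theorem analyticAt_ytilde {μ : Fin (2 * n) → ℝ} (hμ : StrictMono μ) {z : ℂ} (hz : z ∉ cuts μ) :
    AnalyticAt ℂ (ytilde μ) z := by
  unfold ytilde
  refine Finset.analyticAt_fun_prod _ fun i _ => ?_
  refine AnalyticAt.mul (by fun_prop) (AnalyticAt.cpow ?_ analyticAt_const
    (ratio_mem_slitPlane hμ hz i))
  exact AnalyticAt.div (by fun_prop) (by fun_prop) (sub_branch_ne_zero hμ hz _)

/-- Differentiating the square determines the derivative without choosing a branch. The field is
left general because this serves both for d/dz and for real variations of the branch points. -/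
theorem logDeriv_of_sq_eq_prod {𝕜 : Type*} [NontriviallyNormedField 𝕜] [NormedAlgebra 𝕜 ℂ]
    {ι : Type*} [Fintype ι] {y : 𝕜 → ℂ} {u : ι → 𝕜 → ℂ} {u' : ι → ℂ} {t : 𝕜}
    (hy : DifferentiableAt 𝕜 y t) (hu : ∀ α, HasDerivAt (u α) (u' α) t)
    (hsq : ∀ᶠ s in 𝓝 t, y s ^ 2 = ∏ α, u α s) (h0 : ∀ α, u α t ≠ 0) :
    HasDerivAt y (1 / 2 * (∑ α, u' α / u α t) * y t) t := by
  classical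
  have hy0 : y t ≠ 0 := fun h => by
    have := hsq.self_of_nhds
    rw [h] at this
    exact Finset.prod_ne_zero_iff.2 (fun α _ => h0 α) (this.symm.trans (by ring))
  have h1 : HasDerivAt (fun s => y s ^ 2) (2 * y t * deriv y t) t := by
    have := hy.hasDerivAt.fun_pow 2
    simpa using this
  have h2 : HasDerivAt (fun s => ∏ α, u α s) ((∏ α, u α t) * ∑ α, u' α / u α t) t := by
    have := HasDerivAt.fun_finsetProd (u := Finset.univ) fun α _ => hu α
    refine this.congr_deriv ?_
    rw [Finset.mul_sum]
    refine Finset.sum_congr rfl fun α _ => ?_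
    rw [← Finset.mul_prod_erase Finset.univ (fun β => u β t) (Finset.mem_univ α), smul_eq_mul]
    have := h0 α
    field_simp
  have h3 := h1.unique (h2.congr_of_eventuallyEq hsq)
  rw [← hsq.self_of_nhds] at h3
  refine hy.hasDerivAt.congr_deriv ?_
  have : (2 * y t) * (deriv y t - 1 / 2 * (∑ α, u' α / u α t) * y t) = 0 := by
    linear_combination h3
  rcases mul_eq_zero.1 this with h | h
  · simp [hy0] at h
  · exact sub_eq_zero.1 h

theorem hasDerivAt_ytilde {μ : Fin (2 * n) → ℝ} (hμ : StrictMono μ) {z : ℂ} (hz : z ∉ cuts μ) :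
    HasDerivAt (ytilde μ) (1 / 2 * (∑ α, 1 / (z - μ α)) * ytilde μ z) z := by
  refine logDeriv_of_sq_eq_prod (u := fun α z => z - μ α) (u' := fun _ => 1)
    (analyticAt_ytilde hμ hz).differentiableAt
    (fun α => (hasDerivAt_id z).sub_const _) ?_ (sub_branch_ne_zero hμ hz)
  filter_upwards [(isOpen_compl_cuts μ).mem_nhds hz] with w hw
  exact ytilde_sq hμ hw

/-- Being off the cuts is expressed by the ratios lying in the open slit plane, a condition stable
under small changes. A real point on a cut of m would make its ratio nonpositive. -/
theorem eventually_notMem_cuts {μ : Fin (2 * n) → ℝ} (hμ : StrictMono μ) {z : ℂ}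
    (hz : z ∉ cuts μ) :
    ∀ᶠ m in 𝓝 μ, StrictMono m → z ∉ cuts m := by
  have hslit : ∀ i : Fin n, ∀ᶠ m in 𝓝 μ, m (hi i) ≠ (μ (lo i) + μ (hi i)) / 2 ∧
      z - (m (hi i) : ℂ) ≠ 0 ∧ (z - (m (lo i) : ℂ)) / (z - (m (hi i) : ℂ)) ∈ Complex.slitPlane := by
    intro i
    have hc : ∀ α, Continuous fun m : Fin (2 * n) → ℝ => z - (m α : ℂ) := fun α => by fun_prop
    have h1 := (hc (hi i)).continuousAt (x := μ) |>.eventually_ne (sub_branch_ne_zero hμ hz _)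
    have h2 : ContinuousAt (fun m : Fin (2 * n) → ℝ => (z - (m (lo i) : ℂ)) / (z - (m (hi i) : ℂ))) μ :=
      (hc _).continuousAt.div (hc _).continuousAt (sub_branch_ne_zero hμ hz _)
    have h3 := h2.eventually (Complex.isOpen_slitPlane.mem_nhds (ratio_mem_slitPlane hμ hz i))
    have h4 : ∀ᶠ m in 𝓝 μ, m (hi i) ≠ (μ (lo i) + μ (hi i)) / 2 :=
      (continuous_apply (hi i)).continuousAt.eventually_ne (by
        have := lo_lt_hi hμ i
        intro h; linarith)
    exact h4.and (h1.and h3)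
  filter_upwards [eventually_all.2 hslit] with m hm hmono hmem
  obtain ⟨i, x, h1, h2, rfl⟩ := mem_cuts.1 hmem
  obtain ⟨-, h3, h4⟩ := hm i
  have h3' : x - m (hi i) ≠ 0 := by exact_mod_cast h3
  rw [← Complex.ofReal_sub, ← Complex.ofReal_sub, ← Complex.ofReal_div,
    Complex.ofReal_mem_slitPlane] at h4
  have h5 : x - m (hi i) < 0 := lt_of_le_of_ne (by linarith) h3'
  exact absurd (div_nonpos_of_nonneg_of_nonpos (by linarith : 0 ≤ x - m (lo i)) h5.le) (not_le.2 h4)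

theorem hasDerivAt_ytilde_comp {γ : ℝ → Fin (2 * n) → ℝ} {v : Fin (2 * n) → ℝ} {t : ℝ}
    (hγ : HasDerivAt γ v t) (hm : ∀ᶠ s in 𝓝 t, StrictMono (γ s)) {z : ℂ} (hz : z ∉ cuts (γ t)) :
    HasDerivAt (fun s => ytilde (γ s) z)
      (-(1 / 2) * (∑ α, v α / (z - γ t α)) * ytilde (γ t) z) t := by
  have h1 : DifferentiableAt ℝ (fun s => ytilde (γ s) z) t := by
    have h2 := (contDiffAt_ytilde hm.self_of_nhds hz).differentiableAt (by simp)
    exact h2.comp (f := fun s : ℝ => (γ s, z)) t (hγ.differentiableAt.prodMk (by fun_prop))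
  have h3 := logDeriv_of_sq_eq_prod (𝕜 := ℝ) (y := fun s => ytilde (γ s) z)
    (u := fun α s => z - γ s α) (u' := fun α => -(v α : ℂ)) h1
    (fun α => ?_) ?_ (sub_branch_ne_zero hm.self_of_nhds hz)
  · refine h3.congr_deriv ?_
    simp only [neg_div, Finset.sum_neg_distrib]
    ring
  · exact ((hasDerivAt_pi.1 hγ α).ofReal_comp).const_sub z
  · filter_upwards [hm, hγ.continuousAt.eventually (eventually_notMem_cuts hm.self_of_nhds hz)]
      with s hs hs'
    exact ytilde_sq hs (hs' hs)

theorem ytilde_star {μ : Fin (2 * n) → ℝ} (hμ : StrictMono μ) {z : ℂ} (hz : z ∉ cuts μ) :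
    ytilde μ (star z) = star (ytilde μ z) := by
  unfold ytilde
  rw [star_prod]
  refine Finset.prod_congr rfl fun i _ => ?_
  have h := Complex.cpow_conj ((z - μ (lo i)) / (z - μ (hi i))) (1 / 2)
    (Complex.mem_slitPlane_iff_arg.1 (ratio_mem_slitPlane hμ hz i)).1
  simp only [Complex.star_def, map_mul, map_sub, Complex.conj_ofReal]
  have h2 : (starRingEnd ℂ) (1 / 2 : ℂ) = 1 / 2 := by
    rw [map_div₀, map_one, map_ofNat]
  rw [h2] at h
  rw [h]
  simp only [map_div₀, map_sub, Complex.conj_ofReal, Complex.conj_conj]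

/-- Once |z| ≥ 2‖μ‖ + 1, each of the 2n factors of ỹ² has modulus at least |z|/2. -/
theorem isBigO_inv_ytilde {μ : Fin (2 * n) → ℝ} (hμ : StrictMono μ) :
    (fun z => (ytilde μ z)⁻¹) =O[cobounded ℂ] fun z => (z ^ n)⁻¹ := by
  refine Asymptotics.IsBigO.of_bound (2 ^ n) ?_
  have h : ∀ᶠ z : ℂ in cobounded ℂ, 2 * ‖μ‖ + 1 ≤ ‖z‖ :=
    tendsto_norm_cobounded_atTop.eventually_ge_atTop _
  filter_upwards [h] with z hz
  have h0 := norm_nonneg μ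
  have hz0 : 0 < ‖z‖ := by linarith
  have hzc : z ∉ cuts μ := notMem_cuts_of_lt (by linarith)
  have h1 : (‖z‖ / 2) ^ n ≤ ‖ytilde μ z‖ := by
    refine (pow_le_pow_iff_left₀ (by positivity) (norm_nonneg _) two_ne_zero).1 ?_
    rw [← norm_pow, ytilde_sq hμ hzc, norm_prod, ← pow_mul, mul_comm n 2]
    calc (‖z‖ / 2) ^ (2 * n) = ∏ _α : Fin (2 * n), (‖z‖ / 2) := (by
          rw [Finset.prod_const, Finset.card_univ, Fintype.card_fin])
      _ ≤ _ := Finset.prod_le_prod (fun _ _ => by positivity) fun α _ => ?_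
    have h2 := norm_le_pi_norm μ α
    have h3 := norm_sub_norm_le z (μ α : ℂ)
    rw [Complex.norm_real] at h3
    linarith
  have h4 : 0 < (‖z‖ / 2) ^ n := by positivity
  rw [norm_inv, norm_inv, norm_pow]
  calc ‖ytilde μ z‖⁻¹ ≤ ((‖z‖ / 2) ^ n)⁻¹ := inv_anti₀ h4 h1
    _ = _ := by rw [div_pow]; field_simp

/-! ### The loop insertion operator -/

theorem HasLoopInsertionAt.unique {G : ℝ[X] → ℂ} {V : ℝ[X]} {p w w' : ℂ}
    (h : HasLoopInsertionAt G V p w) (h' : HasLoopInsertionAt G V p w') : w = w' :=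
  h.2.unique h'.2

/-- The identity theorem on the connected complement of the cuts; this is what makes the
continuation defining `dV` unique. -/
theorem eqOn_of_eq_far {μ : Fin (2 * n) → ℝ} {f g : ℂ → ℂ} (hf : AnalyticOnNhd ℂ f (cuts μ)ᶜ)
    (hg : AnalyticOnNhd ℂ g (cuts μ)ᶜ) (h : ∀ p, ‖μ‖ < ‖p‖ → f p = g p) :
    EqOn f g (cuts μ)ᶜ := by
  have hz : ‖μ‖ < ‖((‖μ‖ + 1 : ℝ) : ℂ)‖ := by
    rw [Complex.norm_real, Real.norm_of_nonneg (by positivity)]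
    linarith
  refine hf.eqOn_of_preconnected_of_eventuallyEq hg (isPreconnected_compl_cuts μ)
    (notMem_cuts_of_lt hz) ?_
  filter_upwards [(isOpen_lt continuous_const continuous_norm).mem_nhds hz] with p hp
  exact h p hp

theorem IsLoopInsertion.eqOn {μ : ℝ[X] → Fin (2 * n) → ℝ} {G : ℝ[X] → ℂ} {V : ℝ[X]} {f g : ℂ → ℂ}
    (hf : IsLoopInsertion μ G V f) (hg : IsLoopInsertion μ G V g) : EqOn f g (cuts (μ V))ᶜ :=
  eqOn_of_eq_far hf.1 hg.1 fun p hp => (hf.2 p hp).unique (hg.2 p hp)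

theorem IsLoopInsertion.isLoopInsertion_dV {μ : ℝ[X] → Fin (2 * n) → ℝ} {G : ℝ[X] → ℂ} {V : ℝ[X]}
    {f : ℂ → ℂ} (hf : IsLoopInsertion μ G V f) : IsLoopInsertion μ G V (dV μ G V) := by
  have h : ∃ f, IsLoopInsertion μ G V f := ⟨f, hf⟩
  have : dV μ G V = h.choose := by
    ext p
    rw [dV, dif_pos h]
  rw [this]
  exact h.choose_spec

theorem IsLoopInsertion.dV_eq {μ : ℝ[X] → Fin (2 * n) → ℝ} {G : ℝ[X] → ℂ} {V : ℝ[X]}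
    {f : ℂ → ℂ} (hf : IsLoopInsertion μ G V f) {p : ℂ} (hp : p ∉ cuts (μ V)) :
    dV μ G V p = f p :=
  hf.isLoopInsertion_dV.eqOn hf hp

theorem IsLoopInsertion.congr {μ : ℝ[X] → Fin (2 * n) → ℝ} {G : ℝ[X] → ℂ} {V : ℝ[X]}
    {f g : ℂ → ℂ} (hf : IsLoopInsertion μ G V f) (hfg : EqOn f g (cuts (μ V))ᶜ) :
    IsLoopInsertion μ G V g := by
  refine ⟨fun p hp => (hf.1 p hp).congr ?_, fun p hp => ?_⟩
  · filter_upwards [(isOpen_compl_cuts (μ V)).mem_nhds hp] with q hq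
    exact hfg hq
  · rw [← hfg (notMem_cuts_of_lt hp)]
    exact hf.2 p hp

/-- The series starts at 1/p². It is compared, term by term in modulus, with its absolutely
convergent value at the single point ‖μ V‖ + 1. -/
theorem IsLoopInsertion.isBigO {μ : ℝ[X] → Fin (2 * n) → ℝ} {G : ℝ[X] → ℂ} {V : ℝ[X]}
    {f : ℂ → ℂ} (hf : IsLoopInsertion μ G V f) :
    f =O[cobounded ℂ] fun p => 1 / p ^ 2 := by
  set r : ℝ := ‖μ V‖ + 1
  have hr0 : 0 < r := by positivity
  have hr : ‖μ V‖ < ‖(r : ℂ)‖ := by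
    rw [Complex.norm_real, Real.norm_of_nonneg hr0.le]
    exact lt_add_one _
  have hs := (hf.2 _ hr).2.summable.norm
  set S := ∑' j : ℕ, ‖-((j + 1 : ℂ) / (r : ℂ) ^ (j + 2)) *
    deriv (fun s : ℝ => G (shift V j s)) 0‖
  refine Asymptotics.IsBigO.of_bound (r ^ 2 * S) ?_
  have h : ∀ᶠ z : ℂ in cobounded ℂ, r ≤ ‖z‖ :=
    tendsto_norm_cobounded_atTop.eventually_ge_atTop _
  filter_upwards [h] with p hp
  have hp' : ‖μ V‖ < ‖p‖ := (lt_add_one _).trans_le hp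
  have hp0 : 0 < ‖p‖ := hr0.trans_le hp
  have h1 : ∀ j : ℕ, ‖-((j + 1 : ℂ) / p ^ (j + 2)) * deriv (fun s : ℝ => G (shift V j s)) 0‖ ≤
      (r ^ 2 / ‖p‖ ^ 2) * ‖-((j + 1 : ℂ) / (r : ℂ) ^ (j + 2)) *
        deriv (fun s : ℝ => G (shift V j s)) 0‖ := fun j => by
    simp only [norm_mul, norm_neg, norm_div, norm_pow, Complex.norm_real,
      Real.norm_of_nonneg hr0.le]
    rw [← mul_assoc]
    refine mul_le_mul_of_nonneg_right ?_ (norm_nonneg _)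
    rw [div_mul_div_comm, div_le_div_iff₀ (by positivity) (by positivity), pow_add, pow_add]
    have : r ^ j ≤ ‖p‖ ^ j := pow_le_pow_left₀ hr0.le hp j
    have h2 := mul_le_mul_of_nonneg_left this
      (by positivity : 0 ≤ ‖(j + 1 : ℂ)‖ * r ^ 2 * ‖p‖ ^ 2)
    linarith
  have h3 := tsum_of_norm_bounded (hs.hasSum.mul_left (r ^ 2 / ‖p‖ ^ 2)) h1
  rw [(hf.2 p hp').2.tsum_eq] at h3
  refine h3.trans_eq ?_
  rw [norm_div, norm_pow, norm_one]
  ring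

theorem hasLoopInsertionAt_sum {ι : Type*} {s : Finset ι} {G : ℝ[X] → ℂ} {g : ι → ℝ[X] → ℂ}
    {V : ℝ[X]} {a w : ι → ℂ} {p : ℂ} (h : ∀ i ∈ s, HasLoopInsertionAt (g i) V p (w i))
    (hG : ∀ j : ℕ, HasDerivAt (fun t : ℝ => G (shift V j t))
      (∑ i ∈ s, a i * deriv (fun t : ℝ => g i (shift V j t)) 0) 0) :
    HasLoopInsertionAt G V p (∑ i ∈ s, a i * w i) := by
  refine ⟨fun j => (hG j).differentiableAt, ?_⟩
  have := hasSum_sum fun i hi => (h i hi).2.mul_left (a i)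
  refine this.congr_fun ?_
  intro j
  rw [(hG j).deriv, Finset.mul_sum]
  refine Finset.sum_congr rfl fun i _ => ?_
  ring

end

section

variable {n : ℕ}

/-! ### One cut: the arcsine law -/

/-- The root `√((z - a) (z - b))` with the cut `[a, b]`. -/
def cutRoot (a b : ℝ) (z : ℂ) : ℂ := (z - b) * ((z - a) / (z - b)) ^ (1 / 2 : ℂ)

/-- The parametrization of `[a, b]` by an angle. -/
def cutPoint (a b θ : ℝ) : ℝ := (a + b) / 2 + (b - a) / 2 * Real.cos θ

theorem cutPoint_mem {a b : ℝ} (hab : a ≤ b) (θ : ℝ) :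
    a ≤ cutPoint a b θ ∧ cutPoint a b θ ≤ b := by
  have h1 := Real.neg_one_le_cos θ
  have h2 := Real.cos_le_one θ
  unfold cutPoint
  constructor <;> nlinarith

@[fun_prop]
theorem continuous_cutPoint (a b : ℝ) : Continuous (cutPoint a b) := by
  unfold cutPoint
  fun_prop

/-- The interval `[a, b]` in the complex plane. -/
def cut (a b : ℝ) : Set ℂ := Complex.ofReal '' Icc a b

/-- One cut is the case n = 1 of the general setting, so the facts on `ytilde` transfer to
`cutRoot`. -/
theorem cut_eq_cuts (a b : ℝ) : cut a b = cuts (n := 1) ![a, b] := by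
  simp [cut, cuts, lo, hi, iUnion_const]

theorem cutRoot_eq_ytilde (a b : ℝ) : cutRoot a b = ytilde (n := 1) ![a, b] := by
  ext z
  simp [cutRoot, ytilde, lo, hi]

theorem strictMono_pair {a b : ℝ} (hab : a < b) : StrictMono (![a, b] : Fin (2 * 1) → ℝ) := by
  intro i j hij
  fin_cases i <;> fin_cases j <;> simp_all

theorem sub_ne_zero_of_notMem_cut {a b : ℝ} {z : ℂ} (hz : z ∉ cut a b) {x : ℝ} (h1 : a ≤ x)
    (h2 : x ≤ b) : z - x ≠ 0 := fun h => hz ⟨x, ⟨h1, h2⟩, (sub_eq_zero.1 h).symm⟩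

theorem hasDerivAt_cutRoot {a b : ℝ} (hab : a < b) {z : ℂ} (hz : z ∉ cut a b) :
    HasDerivAt (cutRoot a b) (1 / 2 * (1 / (z - a) + 1 / (z - b)) * cutRoot a b z) z := by
  rw [cutRoot_eq_ytilde]
  rw [cut_eq_cuts] at hz
  refine (hasDerivAt_ytilde (strictMono_pair hab) hz).congr_deriv ?_
  congr 2
  exact Fin.sum_univ_two fun α : Fin 2 => 1 / (z - ((![a, b] : Fin 2 → ℝ) α : ℂ))

theorem cutRoot_ne_zero {a b : ℝ} (hab : a < b) {z : ℂ} (hz : z ∉ cut a b) :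
    cutRoot a b z ≠ 0 := by
  rw [cutRoot_eq_ytilde]
  rw [cut_eq_cuts] at hz
  exact ytilde_ne_zero (strictMono_pair hab) hz

theorem cutRoot_star {a b : ℝ} (hab : a < b) {z : ℂ} (hz : z ∉ cut a b) :
    cutRoot a b (star z) = star (cutRoot a b z) := by
  rw [cutRoot_eq_ytilde]
  rw [cut_eq_cuts] at hz
  exact ytilde_star (strictMono_pair hab) hz

/-- The resolvent of the arcsine law satisfies the same first-order linear differential equation as
the reciprocal of `cutRoot`. -/
theorem hasDerivAt_integral_inv_sub_cutPoint {a b : ℝ} (hab : a < b) {z : ℂ} (hz : z ∉ cut a b) :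
    HasDerivAt (fun z : ℂ => ∫ θ in (0 : ℝ)..Real.pi, (z - cutPoint a b θ)⁻¹)
      (-(1 / 2 * (1 / (z - a) + 1 / (z - b))) *
        ∫ θ in (0 : ℝ)..Real.pi, (z - cutPoint a b θ)⁻¹) z := by
  have hne : ∀ θ, z - cutPoint a b θ ≠ 0 := fun θ =>
    sub_ne_zero_of_notMem_cut hz (cutPoint_mem hab.le θ).1 (cutPoint_mem hab.le θ).2
  have hcp := continuous_cutPoint a b
  have hjoint : ∀ q : ℂ × ℝ, ContinuousAt (fun q : ℂ × ℝ => q.1 - (cutPoint a b q.2 : ℂ)) q :=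
    fun q => by fun_prop
  have hev : ∀ θ, ∀ᶠ q in 𝓝 (z, θ), q.1 - (cutPoint a b q.2 : ℂ) ≠ 0 := fun θ =>
    (hjoint (z, θ)).eventually_ne (hne θ)
  have h1 := hasFDerivAt_intervalIntegral_of_continuousAt (𝕜 := ℂ) (x₀ := z) (a := 0) (b := Real.pi)
    (F := fun z θ => (z - cutPoint a b θ)⁻¹)
    (F' := fun z θ => (-((z - cutPoint a b θ) ^ 2)⁻¹) • (1 : ℂ →L[ℂ] ℂ))
    (fun θ _ => by
      filter_upwards [hev θ] with q hq
      refine ⟨(hjoint q).fun_inv₀ hq, ?_⟩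
      have := ((hasDerivAt_id q.1).sub_const (cutPoint a b q.2 : ℂ)).fun_inv hq
      have h2 := this.hasFDerivAt
      refine h2.congr_fderiv ?_
      ext
      simp [div_eq_mul_inv])
    (fun θ _ => by
      refine ContinuousAt.smul (ContinuousAt.neg (ContinuousAt.inv₀ ((hjoint _).pow 2) ?_))
        continuousAt_const
      exact pow_ne_zero 2 (hne θ))
  have hci : Continuous fun θ => (z - (cutPoint a b θ : ℂ))⁻¹ :=
    Continuous.inv₀ (by fun_prop) hne
  have hi1 : IntervalIntegrable (fun θ => (z - (cutPoint a b θ : ℂ))⁻¹) volume 0 Real.pi :=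
    hci.intervalIntegrable _ _
  have hi2 : IntervalIntegrable (fun θ => ((z - (cutPoint a b θ : ℂ)) ^ 2)⁻¹) volume 0 Real.pi := by
    refine Continuous.intervalIntegrable (Continuous.inv₀ (by fun_prop) fun θ => ?_) _ _
    exact pow_ne_zero 2 (hne θ)
  have h2 := h1.hasDerivAt
  refine h2.congr_deriv ?_
  rw [ContinuousLinearMap.intervalIntegral_apply]
  swap
  · refine Continuous.intervalIntegrable ?_ _ _
    simp only [← inv_pow]
    exact ((hci.pow 2).neg).smul continuous_const
  simp only [smul_apply, one_apply_eq_self, smul_eq_mul, mul_one,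
    intervalIntegral.integral_neg]
  -- This primitive vanishes at 0 and π because of the sine, so the integrals of (z - x)⁻² and (z -
  -- x)⁻¹ are proportional.
  have hd : ∀ θ : ℝ, HasDerivAt (fun θ : ℝ => ((b - a) / 2 : ℂ) * (Real.sin θ * (z - cutPoint a b θ)⁻¹))
      (((z - a) * (z - b)) * ((z - cutPoint a b θ) ^ 2)⁻¹ -
        (z - (a + b) / 2) * (z - cutPoint a b θ)⁻¹) θ := fun θ => by
    have hs := (Real.hasDerivAt_sin θ).ofReal_comp
    have hx : HasDerivAt (fun θ => z - (cutPoint a b θ : ℂ))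
        (-(((b - a) / 2 * (-Real.sin θ) : ℝ) : ℂ)) θ :=
      ((((Real.hasDerivAt_cos θ).const_mul ((b - a) / 2)).const_add
        ((a + b) / 2)).ofReal_comp).const_sub z
    have := (hs.mul (hx.fun_inv (hne θ))).const_mul ((b - a) / 2 : ℂ)
    refine this.congr_deriv ?_
    have h0 := hne θ
    have hcp : (cutPoint a b θ : ℂ) = (a + b) / 2 + (b - a) / 2 * Real.cos θ := by
      simp [cutPoint]
    field_simp
    rw [hcp]
    push_cast
    linear_combination -(b - a : ℂ) ^ 2 / 2 * Complex.sin_sq_add_cos_sq (θ : ℂ)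
  have h3 := intervalIntegral.integral_eq_sub_of_hasDerivAt (a := 0) (b := Real.pi)
    (fun θ _ => hd θ) ((hi2.const_mul _).sub (hi1.const_mul _))
  rw [intervalIntegral.integral_sub (hi2.const_mul _) (hi1.const_mul _),
    intervalIntegral.integral_const_mul, intervalIntegral.integral_const_mul] at h3
  simp only [Real.sin_pi, Real.sin_zero, Complex.ofReal_zero, zero_mul, mul_zero, sub_self] at h3
  have ha : z - a ≠ 0 := sub_ne_zero_of_notMem_cut hz le_rfl hab.le
  have hb : z - b ≠ 0 := sub_ne_zero_of_notMem_cut hz hab.le le_rfl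
  generalize (∫ θ in (0 : ℝ)..Real.pi, ((z - (cutPoint a b θ : ℂ)) ^ 2)⁻¹) = I2 at h3 ⊢
  generalize (∫ θ in (0 : ℝ)..Real.pi, (z - (cutPoint a b θ : ℂ))⁻¹) = I1 at h3 ⊢
  field_simp
  linear_combination (-2 : ℂ) * h3

/-- By the differential equation the product with `cutRoot` is constant off the cut. As t → +∞ the
integral behaves like π/t and the root like t, so the constant is π. -/
theorem integral_inv_sub_cutPoint {a b : ℝ} (hab : a < b) {z : ℂ} (hz : z ∉ cut a b) :
    ∫ θ in (0 : ℝ)..Real.pi, (z - cutPoint a b θ)⁻¹ = Real.pi / cutRoot a b z := by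
  set S : ℂ → ℂ := fun z => ∫ θ in (0 : ℝ)..Real.pi, (z - cutPoint a b θ)⁻¹ with hS
  set f : ℂ → ℂ := fun z => S z * cutRoot a b z with hf
  have hd : ∀ w ∈ (cut a b)ᶜ, HasDerivAt f 0 w := fun w hw => by
    refine ((hasDerivAt_integral_inv_sub_cutPoint hab hw).mul (hasDerivAt_cutRoot hab hw)).congr_deriv ?_
    ring
  have hopen : IsOpen (cut a b)ᶜ := by rw [cut_eq_cuts]; exact isOpen_compl_cuts _
  have hpre : IsPreconnected (cut a b)ᶜ := by rw [cut_eq_cuts]; exact isPreconnected_compl_cuts _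
  have hconst : ∀ w ∈ (cut a b)ᶜ, f w = f z := fun w hw =>
    hopen.is_const_of_deriv_eq_zero hpre (fun w hw => (hd w hw).differentiableAt.differentiableWithinAt)
      (fun w hw => (hd w hw).deriv) hw hz
  have hfar : ∀ t : ℝ, b < t → (t : ℂ) ∈ (cut a b)ᶜ := fun t ht => by
    rintro ⟨x, hx, hxt⟩
    have := Complex.ofReal_injective hxt
    linarith [hx.2]
  have hx : ∀ θ, |cutPoint a b θ| ≤ |a| + |b| := fun θ => by
    have := cutPoint_mem hab.le θ
    refine abs_le.2 ⟨?_, ?_⟩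
    · linarith [neg_abs_le a, abs_nonneg b]
    · linarith [le_abs_self b, abs_nonneg a]
  have hlim1 : Tendsto (fun t : ℝ => (t : ℂ) * S t) atTop (𝓝 Real.pi) := by
    rw [tendsto_iff_norm_sub_tendsto_zero]
    have hb : Tendsto (fun t : ℝ => (|a| + |b|) / (t - (|a| + |b|)) * |Real.pi - 0|) atTop (𝓝 0) := by
      have h1 : Tendsto (fun t : ℝ => t - (|a| + |b|)) atTop atTop :=
        tendsto_atTop_add_const_right _ _ tendsto_id
      simpa using (h1.const_div_atTop (|a| + |b|)).mul_const |Real.pi - 0|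
    refine squeeze_zero' (Eventually.of_forall fun _ => norm_nonneg _) ?_ hb
    filter_upwards [eventually_gt_atTop (|a| + |b|)] with t ht
    have hne : ∀ θ, (t : ℂ) - cutPoint a b θ ≠ 0 := fun θ h => by
      have h2 : t - cutPoint a b θ = 0 := by exact_mod_cast h
      linarith [le_abs_self (cutPoint a b θ), hx θ]
    have hci : Continuous fun θ => ((t : ℂ) - (cutPoint a b θ : ℂ))⁻¹ :=
      Continuous.inv₀ (by fun_prop) hne
    have : (t : ℂ) * S t - Real.pi =
        ∫ θ in (0 : ℝ)..Real.pi, ((t : ℂ) * ((t : ℂ) - cutPoint a b θ)⁻¹ - 1) := by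
      have hi : IntervalIntegrable (fun θ => (t : ℂ) * ((t : ℂ) - (cutPoint a b θ : ℂ))⁻¹)
        volume 0 Real.pi := (continuous_const.mul hci).intervalIntegrable _ _
      rw [intervalIntegral.integral_sub hi intervalIntegrable_const, intervalIntegral.integral_const_mul]
      simp [hS]
    rw [this]
    refine intervalIntegral.norm_integral_le_of_norm_le_const fun θ _ => ?_
    have h0 := hne θ
    rw [show (t : ℂ) * ((t : ℂ) - cutPoint a b θ)⁻¹ - 1 = ((cutPoint a b θ / (t - cutPoint a b θ) : ℝ) : ℂ) by
      push_cast; field_simp; ring, Complex.norm_real, norm_div, Real.norm_eq_abs, Real.norm_eq_abs]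
    have h3 : t - (|a| + |b|) ≤ |t - cutPoint a b θ| := by
      linarith [le_abs_self (t - cutPoint a b θ), le_abs_self (cutPoint a b θ), hx θ]
    have h4 : 0 < t - (|a| + |b|) := by linarith
    exact div_le_div₀ (by positivity) (hx θ) h4 h3
  have hlim2 : Tendsto (fun t : ℝ => cutRoot a b t / (t : ℂ)) atTop (𝓝 1) := by
    have h1 : ∀ d : ℝ, Tendsto (fun t : ℝ => ((t - d : ℝ) : ℂ) / (t : ℂ)) atTop (𝓝 1) := fun d => by
      have h2 : Tendsto (fun t : ℝ => 1 - d / t) atTop (𝓝 1) := by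
        simpa using (tendsto_id.const_div_atTop d).const_sub 1
      have h3 := (Complex.continuous_ofReal.tendsto 1).comp h2
      rw [Complex.ofReal_one] at h3
      refine h3.congr' ?_
      filter_upwards [eventually_ne_atTop 0] with t ht
      have ht' : (t : ℂ) ≠ 0 := by exact_mod_cast ht
      simp only [Function.comp]
      push_cast
      field_simp
    have h2 : Tendsto (fun t : ℝ => ((t : ℂ) - a) / ((t : ℂ) - b)) atTop (𝓝 1) := by
      have := (h1 a).div (h1 b) one_ne_zero
      rw [div_one] at this
      refine this.congr' ?_
      filter_upwards [eventually_ne_atTop 0] with t ht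
      have ht' : (t : ℂ) ≠ 0 := by exact_mod_cast ht
      simp only [Pi.div_apply]
      push_cast
      field_simp
    have h3 : Tendsto (fun t : ℝ => (((t : ℂ) - a) / ((t : ℂ) - b)) ^ (1 / 2 : ℂ)) atTop (𝓝 1) := by
      have := ((contDiffAt_cpow_half Complex.one_mem_slitPlane).continuousAt.tendsto).comp h2
      rwa [Complex.one_cpow] at this
    have h4 := (h1 b).mul h3
    rw [mul_one] at h4
    refine h4.congr fun t => ?_
    simp only [cutRoot]
    push_cast
    ring
  have hlim : Tendsto (fun t : ℝ => f t) atTop (𝓝 (Real.pi * 1)) := by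
    refine (hlim1.mul hlim2).congr' ?_
    filter_upwards [eventually_ne_atTop 0] with t ht
    have ht' : (t : ℂ) ≠ 0 := by exact_mod_cast ht
    simp only [hf]
    field_simp
  have hlim' : Tendsto (fun t : ℝ => f t) atTop (𝓝 (f z)) := by
    refine tendsto_const_nhds.congr' ?_
    filter_upwards [eventually_gt_atTop b] with t ht
    exact (hconst _ (hfar t ht)).symm
  have := tendsto_nhds_unique hlim' hlim
  rw [mul_one] at this
  rw [eq_div_iff (cutRoot_ne_zero hab hz), ← this]

/-- Writing the reciprocal root as an average of 1/(z - x) over the cut and applying Cauchy's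
formula for each x collapses the contour onto the cut without boundary values of the root. -/
theorem circleIntegral_div_cutRoot {a b c r : ℝ} (hab : a < b) (ha : |a - c| < r) (hb : |b - c| < r)
    {g : ℂ → ℂ} (hg : DiffContOnCl ℂ g (ball (c : ℂ) r)) :
    ∮ z in C((c : ℂ), r), g z / cutRoot a b z =
      2 * Complex.I * ∫ θ in (0 : ℝ)..Real.pi, g (cutPoint a b θ) := by
  have hr : 0 < r := (abs_nonneg _).trans_lt ha
  have hin : ∀ x : ℝ, a ≤ x → x ≤ b → (x : ℂ) ∈ ball (c : ℂ) r := fun x h1 h2 => by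
    rw [mem_ball, Complex.dist_eq, ← Complex.ofReal_sub, Complex.norm_real, Real.norm_eq_abs]
    rw [abs_lt] at ha hb ⊢
    constructor <;> linarith [ha.1, hb.2]
  have hout : ∀ z ∈ sphere (c : ℂ) r, z ∉ cut a b := by
    rintro z hz ⟨x, hx, rfl⟩
    have := hin x hx.1 hx.2
    rw [mem_ball] at this
    rw [mem_sphere] at hz
    exact this.ne hz
  have hne : ∀ z ∈ sphere (c : ℂ) r, ∀ θ, z - cutPoint a b θ ≠ 0 := fun z hz θ =>
    sub_ne_zero_of_notMem_cut (hout z hz) (cutPoint_mem hab.le θ).1 (cutPoint_mem hab.le θ).2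
  have hpi : (Real.pi : ℂ) ≠ 0 := by exact_mod_cast Real.pi_ne_zero
  have hgc : ContinuousOn g (sphere (c : ℂ) r) :=
    hg.continuousOn_ball.mono sphere_subset_closedBall
  have h1 : (∮ z in C((c : ℂ), r), g z / cutRoot a b z) =
      (Real.pi : ℂ)⁻¹ * ∮ z in C((c : ℂ), r), ∫ θ in (0 : ℝ)..Real.pi, g z / (z - cutPoint a b θ) := by
    rw [← circleIntegral.integral_const_mul]
    refine circleIntegral.integral_congr hr.le fun z hz => ?_
    simp only [div_eq_mul_inv]
    rw [intervalIntegral.integral_const_mul, integral_inv_sub_cutPoint hab (hout z hz)]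
    have := cutRoot_ne_zero hab (hout z hz)
    field_simp
  have h2 : (∮ z in C((c : ℂ), r), ∫ θ in (0 : ℝ)..Real.pi, g z / (z - cutPoint a b θ)) =
      ∫ θ in (0 : ℝ)..Real.pi, ∮ z in C((c : ℂ), r), g z / (z - cutPoint a b θ) := by
    unfold circleIntegral
    simp only [smul_eq_mul, ← intervalIntegral.integral_const_mul]
    refine intervalIntegral_intervalIntegral_swap ?_
    refine (ContinuousOn.integrableOn_compact (isCompact_uIcc.prod isCompact_uIcc)
      (Continuous.continuousOn ?_)).mono_set (Set.prod_mono uIoc_subset_uIcc uIoc_subset_uIcc)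
    have hc0 := continuous_circleMap 0 r
    have hcc := continuous_circleMap (c : ℂ) r
    have hgm : Continuous fun τ => g (circleMap c r τ) :=
      hgc.comp_continuous hcc fun τ => circleMap_mem_sphere _ hr.le τ
    simp only [deriv_circleMap, Function.uncurry_def]
    refine ((hc0.comp continuous_fst).mul continuous_const).mul
      ((hgm.comp continuous_fst).div ?_ fun q => hne _ (circleMap_mem_sphere _ hr.le _) _)
    fun_prop
  rw [h1, h2]
  have h3 : ∀ θ : ℝ, (∮ z in C((c : ℂ), r), g z / (z - cutPoint a b θ)) =
      2 * Real.pi * Complex.I * g (cutPoint a b θ) := fun θ => by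
    have := hg.circleIntegral_sub_inv_smul
      (hin _ (cutPoint_mem hab.le θ).1 (cutPoint_mem hab.le θ).2)
    simpa [div_eq_inv_mul] using this
  simp only [h3]
  rw [intervalIntegral.integral_const_mul]
  field_simp

end

section

variable {n : ℕ}

/-! ### Periods and their nondegeneracy -/

/-- The circle with centre `c` and radius `r` encloses the `i`-th cut and no other cut. -/
structure Encircles (μ : Fin (2 * n) → ℝ) (i : Fin n) (c r : ℝ) : Prop where
  left_mem : |μ (lo i) - c| < r
  right_mem : |μ (hi i) - c| < r
  outside : ∀ α, α ≠ lo i → α ≠ hi i → r < |μ α - c|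

/-- The cut which belongs to the `j`-th cycle. -/
def cycleCut (j : Fin (n - 1)) : Fin n := ⟨j, by omega⟩

theorem IsCutFamily.encircles {U : Set ℝ[X]} {μ : ℝ[X] → Fin (2 * n) → ℝ} {c r : Fin (n - 1) → ℝ}
    (hU : IsCutFamily U μ c r) {V : ℝ[X]} (hV : V ∈ U) (j : Fin (n - 1)) :
    Encircles (μ V) (cycleCut j) (c j) (r j) where
  left_mem := hU.encloses V hV j _ (Or.inl rfl)
  right_mem := hU.encloses V hV j _ (Or.inr rfl)
  outside α h1 h2 := hU.excludes V hV j α (by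
    rintro (h | h)
    · exact h1 (Fin.ext h)
    · exact h2 (Fin.ext h))

/-- The product of the roots belonging to the cuts other than the `i`-th one. -/
def restRoot (μ : Fin (2 * n) → ℝ) (i : Fin n) (z : ℂ) : ℂ :=
  ∏ k ∈ Finset.univ.erase i, cutRoot (μ (lo k)) (μ (hi k)) z

theorem ytilde_eq_mul_restRoot (μ : Fin (2 * n) → ℝ) (i : Fin n) (z : ℂ) :
    ytilde μ z = cutRoot (μ (lo i)) (μ (hi i)) z * restRoot μ i z :=
  (Finset.mul_prod_erase Finset.univ (fun k => cutRoot (μ (lo k)) (μ (hi k)) z)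
    (Finset.mem_univ i)).symm

theorem lo_ne_lo {i k : Fin n} (h : k ≠ i) : lo k ≠ lo i := by
  simp only [lo, ne_eq, Fin.ext_iff] at *; omega

theorem hi_ne_hi {i k : Fin n} (h : k ≠ i) : hi k ≠ hi i := by
  simp only [hi, ne_eq, Fin.ext_iff] at *; omega

theorem lo_ne_hi (i k : Fin n) : lo k ≠ hi i := by
  simp only [lo, hi, ne_eq, Fin.ext_iff] at *; omega

/-! ### Circles around a single cut, and collapsing them onto the cut -/

section Encircles

variable {μ : Fin (2 * n) → ℝ} {i : Fin n} {c r : ℝ}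

theorem Encircles.pos (h : Encircles μ i c r) : 0 < r := (abs_nonneg _).trans_lt h.left_mem

theorem Encircles.side (hμ : StrictMono μ) (h : Encircles μ i c r) {k : Fin n} (hk : k ≠ i) :
    c + r < μ (lo k) ∨ μ (hi k) < c - r := by
  have hl := abs_lt.1 h.left_mem
  have hr := abs_lt.1 h.right_mem
  rcases lt_or_gt_of_ne hk with hlt | hlt
  · right
    have h3 : μ (hi k) < μ (lo i) := hμ (by
      rw [Fin.lt_def] at *; simp only [lo, hi]; omega)
    have h4 := h.outside (hi k) (lo_ne_hi k i).symm (hi_ne_hi hk)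
    rcases lt_abs.1 h4 with h5 | h5 <;> linarith
  · left
    have h3 : μ (hi i) < μ (lo k) := hμ (by
      rw [Fin.lt_def] at *; simp only [lo, hi]; omega)
    have h4 := h.outside (lo k) (lo_ne_lo hk) (lo_ne_hi i k)
    rcases lt_abs.1 h4 with h5 | h5 <;> linarith

theorem Encircles.lt_abs_sub (hμ : StrictMono μ) (h : Encircles μ i c r) {k : Fin n}
    (hk : k ≠ i) {x : ℝ} (h1 : μ (lo k) ≤ x) (h2 : x ≤ μ (hi k)) : r < |x - c| := by
  rcases h.side hμ hk with h3 | h3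
  · exact lt_abs.2 (Or.inl (by linarith))
  · exact lt_abs.2 (Or.inr (by linarith))

theorem Encircles.notMem_cut (hμ : StrictMono μ) (h : Encircles μ i c r) {k : Fin n}
    (hk : k ≠ i) {z : ℂ} (hz : z ∈ closedBall (c : ℂ) r) : z ∉ cut (μ (lo k)) (μ (hi k)) := by
  rintro ⟨x, hx, rfl⟩
  rw [mem_closedBall, Complex.dist_eq, ← Complex.ofReal_sub, Complex.norm_real,
    Real.norm_eq_abs] at hz
  exact absurd (h.lt_abs_sub hμ hk hx.1 hx.2) (not_lt.2 hz)

theorem Encircles.abs_sub_lt (h : Encircles μ i c r) {x : ℝ} (h1 : μ (lo i) ≤ x)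
    (h2 : x ≤ μ (hi i)) : |x - c| < r := by
  have hl := abs_lt.1 h.left_mem
  have hr := abs_lt.1 h.right_mem
  exact abs_lt.2 ⟨by linarith, by linarith⟩

theorem Encircles.ofReal_mem_ball (h : Encircles μ i c r) {x : ℝ} (h1 : μ (lo i) ≤ x)
    (h2 : x ≤ μ (hi i)) : (x : ℂ) ∈ ball (c : ℂ) r := by
  rw [mem_ball, Complex.dist_eq, ← Complex.ofReal_sub, Complex.norm_real, Real.norm_eq_abs]
  exact h.abs_sub_lt h1 h2

theorem Encircles.sphere_notMem_cuts (hμ : StrictMono μ) (h : Encircles μ i c r) {z : ℂ}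
    (hz : z ∈ sphere (c : ℂ) r) : z ∉ cuts μ := by
  intro hmem
  obtain ⟨k, x, h1, h2, rfl⟩ := mem_cuts.1 hmem
  by_cases hk : k = i
  · subst hk
    exact (h.ofReal_mem_ball h1 h2).ne (mem_sphere.1 hz)
  · exact h.notMem_cut hμ hk (sphere_subset_closedBall hz) ⟨x, ⟨h1, h2⟩, rfl⟩

theorem restRoot_ne_zero (hμ : StrictMono μ) {z : ℂ}
    (hz : ∀ k ≠ i, z ∉ cut (μ (lo k)) (μ (hi k))) : restRoot μ i z ≠ 0 :=
  Finset.prod_ne_zero_iff.2 fun k hk =>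
    cutRoot_ne_zero (lo_lt_hi hμ k) (hz k (Finset.ne_of_mem_erase hk))

theorem differentiableAt_restRoot (hμ : StrictMono μ) {z : ℂ}
    (hz : ∀ k ≠ i, z ∉ cut (μ (lo k)) (μ (hi k))) : DifferentiableAt ℂ (restRoot μ i) z := by
  unfold restRoot
  refine DifferentiableAt.fun_finsetProd fun k hk => ?_
  exact (hasDerivAt_cutRoot (lo_lt_hi hμ k) (hz k (Finset.ne_of_mem_erase hk))).differentiableAt

theorem restRoot_star (hμ : StrictMono μ) {z : ℂ}
    (hz : ∀ k ≠ i, z ∉ cut (μ (lo k)) (μ (hi k))) :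
    restRoot μ i (star z) = star (restRoot μ i z) := by
  unfold restRoot
  rw [star_prod]
  exact Finset.prod_congr rfl fun k hk =>
    cutRoot_star (lo_lt_hi hμ k) (hz k (Finset.ne_of_mem_erase hk))

/-- Inside the disc only one cut is present, so the other roots form a holomorphic factor without
zeros and the one-cut formula applies. -/
theorem Encircles.circleIntegral_div_ytilde (hμ : StrictMono μ) (h : Encircles μ i c r)
    {Q : ℂ → ℂ} (hQ : Differentiable ℂ Q) :
    ∮ z in C((c : ℂ), r), Q z / ytilde μ z =
      2 * Complex.I * ∫ θ in (0 : ℝ)..Real.pi, Q (cutPoint (μ (lo i)) (μ (hi i)) θ) /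
        restRoot μ i (cutPoint (μ (lo i)) (μ (hi i)) θ) := by
  have hg : DiffContOnCl ℂ (fun z => Q z / restRoot μ i z) (ball (c : ℂ) r) := by
    refine DifferentiableOn.diffContOnCl_ball (U := closedBall (c : ℂ) r) (fun z hz => ?_) subset_rfl
    have hz' : ∀ k ≠ i, z ∉ cut (μ (lo k)) (μ (hi k)) := fun k hk => h.notMem_cut hμ hk hz
    exact ((hQ z).fun_div (differentiableAt_restRoot hμ hz')
      (restRoot_ne_zero hμ hz')).differentiableWithinAt
  rw [← circleIntegral_div_cutRoot (lo_lt_hi hμ i) h.left_mem h.right_mem hg]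
  congr 1
  ext z
  rw [ytilde_eq_mul_restRoot μ i, div_div, mul_comm]

/-- On the cut the remaining root is real and has no zero. Rolle's theorem for the primitive of the
integrand, which vanishes at 0 and π, yields a zero of the integrand and hence of q. -/
theorem Encircles.exists_root (hμ : StrictMono μ) (h : Encircles μ i c r) {q : ℝ → ℝ}
    (hq : Continuous q)
    (hint : ∫ θ in (0 : ℝ)..Real.pi, (q (cutPoint (μ (lo i)) (μ (hi i)) θ) : ℂ) /
        restRoot μ i (cutPoint (μ (lo i)) (μ (hi i)) θ) = 0) :
    ∃ x, μ (lo i) ≤ x ∧ x ≤ μ (hi i) ∧ q x = 0 := by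
  set X := cutPoint (μ (lo i)) (μ (hi i)) with hX
  have hmem : ∀ θ, μ (lo i) ≤ X θ ∧ X θ ≤ μ (hi i) := cutPoint_mem (lo_lt_hi hμ i).le
  have hXc : Continuous X := continuous_cutPoint _ _
  have hoff : ∀ θ, ∀ k ≠ i, (X θ : ℂ) ∉ cut (μ (lo k)) (μ (hi k)) := fun θ k hk =>
    h.notMem_cut hμ hk (ball_subset_closedBall (h.ofReal_mem_ball (hmem θ).1 (hmem θ).2))
  set w : ℝ → ℝ := fun θ => (restRoot μ i (X θ)).re with hw
  have hreal : ∀ θ, restRoot μ i (X θ) = (w θ : ℂ) := fun θ => by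
    have := restRoot_star hμ (hoff θ)
    rw [Complex.star_def, Complex.conj_ofReal] at this
    exact (Complex.conj_eq_iff_re.1 this.symm).symm
  have hw0 : ∀ θ, w θ ≠ 0 := fun θ h0 => restRoot_ne_zero hμ (hoff θ) (by rw [hreal, h0]; simp)
  have hwc : Continuous w := by
    refine continuous_iff_continuousAt.2 fun θ => ?_
    refine Complex.continuous_re.continuousAt.comp ?_
    exact ((differentiableAt_restRoot hμ (hoff θ)).continuousAt).comp
      (f := fun θ => (X θ : ℂ)) (by fun_prop)
  have hc : Continuous fun θ => q (X θ) / w θ := by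
    exact (hq.comp hXc).div hwc hw0
  have h1 : ∫ θ in (0 : ℝ)..Real.pi, q (X θ) / w θ = 0 := by
    simp only [hreal, ← Complex.ofReal_div] at hint
    rw [intervalIntegral.integral_ofReal] at hint
    exact_mod_cast hint
  obtain ⟨θ, -, hθ⟩ := exists_deriv_eq_zero (f := fun t => ∫ θ in (0 : ℝ)..t, q (X θ) / w θ)
    Real.pi_pos (fun t _ => (hc.integral_hasStrictDerivAt 0 t).hasDerivAt.continuousAt.continuousWithinAt)
    (by rw [h1, intervalIntegral.integral_same])
  rw [hc.deriv_integral] at hθ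
  exact ⟨X θ, (hmem θ).1, (hmem θ).2, (div_eq_zero_iff.1 hθ).resolve_right (hw0 θ)⟩

end Encircles

/-- The periods of the differentials `z ^ l dz / ỹ(z)`. -/
def period (μ : Fin (2 * n) → ℝ) (c r : Fin (n - 1) → ℝ) (l j : Fin (n - 1)) : ℂ :=
  ∮ z in C((c j : ℂ), r j), z ^ (l : ℕ) / ytilde μ z

/-- The matrix of the periods. -/
def periodMatrix (μ : Fin (2 * n) → ℝ) (c r : Fin (n - 1) → ℝ) :
    Matrix (Fin (n - 1)) (Fin (n - 1)) ℂ :=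
  Matrix.of (period μ c r)

/-! ### Nondegeneracy of the periods and of the 2n linear equations -/

section Nondegenerate

variable {μ : Fin (2 * n) → ℝ} {c r : Fin (n - 1) → ℝ}

theorem continuousOn_ytilde (hμ : StrictMono μ) {s : Set ℂ} (hs : ∀ z ∈ s, z ∉ cuts μ) :
    ContinuousOn (ytilde μ) s := fun z hz =>
  (analyticAt_ytilde hμ (hs z hz)).continuousAt.continuousWithinAt

theorem continuousOn_inv_ytilde (hμ : StrictMono μ) {s : Set ℂ} (hs : ∀ z ∈ s, z ∉ cuts μ) :
    ContinuousOn (fun z => (ytilde μ z)⁻¹) s :=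
  (continuousOn_ytilde hμ hs).inv₀ fun z hz => ytilde_ne_zero hμ (hs z hz)

theorem continuousOn_inv_sub_branch (hμ : StrictMono μ) {s : Set ℂ} (hs : ∀ z ∈ s, z ∉ cuts μ)
    (α : Fin (2 * n)) : ContinuousOn (fun z => (z - (μ α : ℂ))⁻¹) s :=
  ContinuousOn.inv₀ (by fun_prop) fun z hz => sub_branch_ne_zero hμ (hs z hz) α

/-- A holomorphic differential with vanishing A-periods is zero. Any real-linear functional of the
coefficients (real or imaginary part) gives a real polynomial with n - 1 coefficients and a zero on
each of n - 1 cuts. -/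
theorem coeff_eq_zero_of_periods_eq_zero (hμ : StrictMono μ)
    (hE : ∀ j, Encircles μ (cycleCut j) (c j) (r j)) {v : Fin (n - 1) → ℂ}
    (hv : ∀ j, ∮ z in C((c j : ℂ), r j), (∑ l, v l * z ^ (l : ℕ)) / ytilde μ z = 0) : v = 0 := by
  have key : ∀ L : ℂ →L[ℝ] ℝ, ∀ l, L (v l) = 0 := by
    intro L
    have hroot : ∀ j : Fin (n - 1), ∃ x, μ (lo (cycleCut j)) ≤ x ∧ x ≤ μ (hi (cycleCut j)) ∧
        ∑ l : Fin (n - 1), x ^ (l : ℕ) * L (v l) = 0 := by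
      intro j
      refine (hE j).exists_root hμ (by fun_prop) ?_
      have h1 := hv j
      rw [(hE j).circleIntegral_div_ytilde hμ (by fun_prop)] at h1
      have h2 := (mul_eq_zero.1 h1).resolve_left (by simp)
      set X := cutPoint (μ (lo (cycleCut j))) (μ (hi (cycleCut j))) with hX
      have hmem : ∀ θ, μ (lo (cycleCut j)) ≤ X θ ∧ X θ ≤ μ (hi (cycleCut j)) :=
        cutPoint_mem (lo_lt_hi hμ _).le
      have hXc : Continuous X := continuous_cutPoint _ _
      have hoff : ∀ θ, ∀ k ≠ cycleCut j, (X θ : ℂ) ∉ cut (μ (lo k)) (μ (hi k)) := fun θ k hk =>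
        (hE j).notMem_cut hμ hk
          (ball_subset_closedBall ((hE j).ofReal_mem_ball (hmem θ).1 (hmem θ).2))
      have hreal : ∀ θ, restRoot μ (cycleCut j) (X θ) =
          ((restRoot μ (cycleCut j) (X θ)).re : ℂ) := fun θ => by
        have := restRoot_star hμ (hoff θ)
        rw [Complex.star_def, Complex.conj_ofReal] at this
        exact (Complex.conj_eq_iff_re.1 this.symm).symm
      have hrc : Continuous fun θ => restRoot μ (cycleCut j) (X θ) :=
        continuous_iff_continuousAt.2 fun θ =>
          ((differentiableAt_restRoot hμ (hoff θ)).continuousAt).comp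
            (f := fun θ => (X θ : ℂ)) (by fun_prop)
      have hci : Continuous fun θ : ℝ => (∑ l, v l * (X θ : ℂ) ^ (l : ℕ)) /
          restRoot μ (cycleCut j) (X θ) :=
        Continuous.div (by fun_prop) hrc fun θ => restRoot_ne_zero hμ (hoff θ)
      have h3 : ∫ θ in (0 : ℝ)..Real.pi, L ((∑ l, v l * (X θ : ℂ) ^ (l : ℕ)) /
          restRoot μ (cycleCut j) (X θ)) = 0 := by
        rw [L.intervalIntegral_comp_comm (hci.intervalIntegrable (μ := volume) 0 Real.pi), h2,
          map_zero]
      refine Eq.trans ?_ ((congrArg Complex.ofReal h3).trans Complex.ofReal_zero)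
      refine Eq.trans ?_ intervalIntegral.integral_ofReal
      refine intervalIntegral.integral_congr fun θ _ => ?_
      rw [hreal θ, ← Complex.ofReal_div]
      congr 1
      rw [div_eq_inv_mul, div_eq_inv_mul, ← Complex.ofReal_inv, ← Complex.real_smul, map_smul,
        map_sum, smul_eq_mul]
      congr 1
      refine Finset.sum_congr rfl fun l _ => ?_
      rw [mul_comm (v l), ← Complex.ofReal_pow, ← Complex.real_smul, map_smul, smul_eq_mul]
    choose x h1 h2 h3 using hroot
    -- The zeros lie on different cuts, so they are distinct and the Vandermonde argument applies.
    have hx : StrictMono x := fun j k hjk => by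
      have : μ (hi (cycleCut j)) < μ (lo (cycleCut k)) := hμ (by
        rw [Fin.lt_def] at *; simp only [lo, hi, cycleCut]; omega)
      linarith [h2 j, h1 k]
    have := Matrix.eq_zero_of_forall_index_sum_pow_mul_eq_zero hx.injective h3
    exact fun l => congrFun this l
  ext l
  exact Complex.ext (key Complex.reCLM l) (key Complex.imCLM l)

theorem circleIntegral_sum_div_ytilde (hμ : StrictMono μ)
    (hE : ∀ j, Encircles μ (cycleCut j) (c j) (r j)) (v : Fin (n - 1) → ℂ) (j : Fin (n - 1)) :
    ∮ z in C((c j : ℂ), r j), (∑ l, v l * z ^ (l : ℕ)) / ytilde μ z =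
      ∑ l, v l * period μ c r l j := by
  have hs := fun z hz => (hE j).sphere_notMem_cuts hμ (z := z) hz
  simp only [div_eq_mul_inv, Finset.sum_mul]
  rw [circleIntegral.integral_fun_sum]
  · refine Finset.sum_congr rfl fun l _ => ?_
    simp only [mul_assoc]
    rw [circleIntegral.integral_const_mul]
    simp only [period, div_eq_mul_inv]
  · exact fun l _ => (ContinuousOn.mul (by fun_prop)
      (continuousOn_inv_ytilde hμ hs)).circleIntegrable (hE j).pos.le

theorem det_periodMatrix_ne_zero (hμ : StrictMono μ)
    (hE : ∀ j, Encircles μ (cycleCut j) (c j) (r j)) : (periodMatrix μ c r).det ≠ 0 := by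
  intro h
  obtain ⟨v, hv0, hv⟩ := Matrix.exists_vecMul_eq_zero_iff.2 h
  refine hv0 (coeff_eq_zero_of_periods_eq_zero hμ hE fun j => ?_)
  rw [circleIntegral_sum_div_ytilde hμ hE]
  exact congrFun hv j

theorem ytilde_div_sub_branch (hμ : StrictMono μ) {z : ℂ} (hz : z ∉ cuts μ) (α : Fin (2 * n)) :
    ytilde μ z / (z - μ α) = (∏ β ∈ Finset.univ.erase α, (z - μ β)) / ytilde μ z := by
  rw [div_eq_div_iff (sub_branch_ne_zero hμ hz α) (ytilde_ne_zero hμ hz), ← sq, ytilde_sq hμ hz,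
    Finset.prod_erase_mul _ _ (Finset.mem_univ α)]

/-- The coefficients of ∑ x_α P/(z - μ_α), with P = ∏ (z - μ_β), are combinations of the power sums
∑ μ_α^k x_α. From z^{n-1} upwards only k ≤ 2n - 1 - (n - 1) = n occurs. -/
theorem exists_coeff_of_moments_eq_zero {x : Fin (2 * n) → ℂ}
    (hx : ∀ k ≤ n, ∑ α, (μ α : ℂ) ^ k * x α = 0) :
    ∃ v : Fin (n - 1) → ℂ, ∀ z : ℂ, ∑ α, x α * ∏ β ∈ Finset.univ.erase α, (z - μ β) =
      ∑ l, v l * z ^ (l : ℕ) := by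
  set P : ℂ[X] := ∏ α : Fin (2 * n), (Polynomial.X - Polynomial.C (μ α : ℂ)) with hP
  have hdeg : P.natDegree = 2 * n := by
    rw [hP, Polynomial.natDegree_finsetProd_X_sub_C_eq_card]
    simp
  set q : Fin (2 * n) → ℂ[X] := fun α =>
    ∏ β ∈ Finset.univ.erase α, (Polynomial.X - Polynomial.C (μ β : ℂ)) with hq
  have hq' : ∀ α, q α = P /ₘ (Polynomial.X - Polynomial.C (μ α : ℂ)) := fun α => by
    rw [hP, ← Finset.mul_prod_erase _ _ (Finset.mem_univ α),
      Polynomial.mul_divByMonic_cancel_left _ (Polynomial.monic_X_sub_C _)]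
  set Q : ℂ[X] := ∑ α, Polynomial.C (x α) * q α with hQ
  have hcoeff : ∀ i, n - 1 ≤ i → Q.coeff i = 0 := by
    intro i hi
    simp only [hQ, Polynomial.finsetSum_coeff, Polynomial.coeff_C_mul, hq',
      Polynomial.coeff_divByMonic_X_sub_C, hdeg, Finset.mul_sum]
    rw [Finset.sum_comm]
    refine Finset.sum_eq_zero fun k hk => ?_
    have := hx (k - (i + 1)) (by rw [Finset.mem_Icc] at hk; omega)
    calc _ = (∑ α, (μ α : ℂ) ^ (k - (i + 1)) * x α) * P.coeff k := by
          rw [Finset.sum_mul]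
          exact Finset.sum_congr rfl fun α _ => by ring
      _ = 0 := by rw [this, zero_mul]
  refine ⟨fun l => Q.coeff l, fun z => ?_⟩
  have h1 : Q.eval z = ∑ α, x α * ∏ β ∈ Finset.univ.erase α, (z - μ β) := by
    simp [hQ, hq, Polynomial.eval_finsetSum, Polynomial.eval_prod]
  have h2 : Q.eval z = ∑ i ∈ Finset.range (n - 1), Q.coeff i * z ^ i := by
    by_cases h0 : Q = 0
    · simp [h0]
    · refine Polynomial.eval_eq_sum_range' ?_ z
      by_contra hlt
      exact h0 (Polynomial.leadingCoeff_eq_zero.1 (hcoeff _ (not_lt.1 hlt)))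
  rw [← h1, h2, ← Fin.sum_univ_eq_sum_range]

theorem circleIntegral_eq_sum_periodK (hμ : StrictMono μ)
    (hE : ∀ j, Encircles μ (cycleCut j) (c j) (r j)) (x : Fin (2 * n) → ℂ) (j : Fin (n - 1)) :
    ∮ z in C((c j : ℂ), r j), (∑ α, x α * ∏ β ∈ Finset.univ.erase α, (z - μ β)) / ytilde μ z =
      ∑ α, x α * periodK μ α (c j) (r j) := by
  have hs := fun z hz => (hE j).sphere_notMem_cuts hμ (z := z) hz
  have h1 : ∀ z ∈ sphere (c j : ℂ) (r j),
      (∑ α, x α * ∏ β ∈ Finset.univ.erase α, (z - μ β)) / ytilde μ z =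
        ∑ α, x α * (ytilde μ z / (z - μ α)) := fun z hz => by
    rw [Finset.sum_div]
    refine Finset.sum_congr rfl fun α _ => ?_
    rw [ytilde_div_sub_branch hμ (hs z hz), mul_div_assoc]
  rw [circleIntegral.integral_congr (hE j).pos.le h1, circleIntegral.integral_fun_sum]
  · simp only [circleIntegral.integral_const_mul, periodK]
  · intro α _
    refine ContinuousOn.circleIntegrable (hE j).pos.le (continuousOn_const.mul ?_)
    simp only [div_eq_mul_inv]
    exact (continuousOn_ytilde hμ hs).mul (continuousOn_inv_sub_branch hμ hs α)

/-- The n + 1 moments bound the degree of Q = ∑ x_α ∏_{β≠α} (z - μ_β) by n - 2, and the n - 1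
periods then force Q = 0. At z = μ_α only the term with x_α survives. -/
theorem eq_zero_of_moments_of_periodK (hμ : StrictMono μ)
    (hE : ∀ j, Encircles μ (cycleCut j) (c j) (r j)) {x : Fin (2 * n) → ℂ}
    (hx : ∀ k ≤ n, ∑ α, (μ α : ℂ) ^ k * x α = 0)
    (hx' : ∀ j, ∑ α, x α * periodK μ α (c j) (r j) = 0) : x = 0 := by
  obtain ⟨v, hv⟩ := exists_coeff_of_moments_eq_zero (μ := μ) hx
  have hv0 : v = 0 := coeff_eq_zero_of_periods_eq_zero hμ hE fun j => by
    simp only [← hv]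
    rw [circleIntegral_eq_sum_periodK hμ hE, hx' j]
  ext α
  have h1 := hv (μ α)
  rw [hv0, Finset.sum_eq_single α] at h1
  · simp only [Pi.zero_apply, zero_mul, Finset.sum_const_zero] at h1
    refine (mul_eq_zero.1 h1).resolve_right (Finset.prod_ne_zero_iff.2 fun β hβ => ?_)
    rw [sub_ne_zero]
    exact fun h => (Finset.ne_of_mem_erase hβ) (hμ.injective (Complex.ofReal_injective h)).symm
  · intro β _ hβ
    rw [Finset.prod_eq_zero (Finset.mem_erase.2 ⟨hβ.symm, Finset.mem_univ α⟩) (sub_self _), mul_zero]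
  · simp

end Nondegenerate

end

section

variable {n : ℕ} {μ : Fin (2 * n) → ℝ} {c r : Fin (n - 1) → ℝ}

/-! ### The coefficients of the zero modes -/

/-- Both circles collapse to the same integral over the cut. This allows an A-cycle to be exchanged
for a circle disjoint from another given one. -/
theorem Encircles.periodK_eq (hμ : StrictMono μ) {i : Fin n} {c r c' r' : ℝ}
    (h : Encircles μ i c r) (h' : Encircles μ i c' r') (α : Fin (2 * n)) :
    periodK μ α c r = periodK μ α c' r' := by
  have key : ∀ {c r : ℝ}, Encircles μ i c r → periodK μ α c r =
      2 * Complex.I * ∫ θ in (0 : ℝ)..Real.pi,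
        (∏ β ∈ Finset.univ.erase α, ((cutPoint (μ (lo i)) (μ (hi i)) θ : ℂ) - μ β)) /
        restRoot μ i (cutPoint (μ (lo i)) (μ (hi i)) θ) := fun h => by
    rw [← h.circleIntegral_div_ytilde hμ
      (Q := fun z => ∏ β ∈ Finset.univ.erase α, (z - (μ β : ℂ))) (by fun_prop)]
    exact circleIntegral.integral_congr h.pos.le fun z hz =>
      ytilde_div_sub_branch hμ (h.sphere_notMem_cuts hμ hz) α
  rw [key h, key h']

/-- The Cauchy transform of `ỹ` along a circle. -/
def cauchyY (μ : Fin (2 * n) → ℝ) (c r : ℝ) (z : ℂ) : ℂ :=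
  ∮ w in C((c : ℂ), r), ytilde μ w / (z - w)

theorem hasDerivAt_inv_ytilde (hμ : StrictMono μ) {z : ℂ} (hz : z ∉ cuts μ) :
    HasDerivAt (fun z => (ytilde μ z)⁻¹) (-(1 / 2) * (∑ α, 1 / (z - μ α)) * (ytilde μ z)⁻¹) z := by
  refine ((hasDerivAt_ytilde hμ hz).fun_inv (ytilde_ne_zero hμ hz)).congr_deriv ?_
  have := ytilde_ne_zero hμ hz
  field_simp

/-- The combination of the φ_α^{(1)} with the coefficients K_α is exact. Integration by parts moves
the derivative from the Cauchy kernel onto ỹ, whose logarithmic derivative ½ ∑ 1/(w - μ_α) matches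
that of 1/ỹ(z) up to partial fractions. -/
theorem Encircles.hasDerivAt_cauchyY_div (hμ : StrictMono μ) {i : Fin n} {c r : ℝ}
    (h : Encircles μ i c r) {z : ℂ} (hz : z ∉ cuts μ) (hzs : z ∉ sphere (c : ℂ) r) :
    HasDerivAt (fun z => cauchyY μ c r z * (ytilde μ z)⁻¹)
      (1 / 2 * ∑ α, periodK μ α c r * phi μ α 1 z) z := by
  have hs := fun w hw => h.sphere_notMem_cuts hμ (z := w) hw
  have hne : ∀ w ∈ sphere (c : ℂ) r, z - w ≠ 0 := fun w hw h0 =>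
    hzs (by rwa [sub_eq_zero.1 h0])
  have h1 : HasDerivAt (cauchyY μ c r) (∮ w in C((c : ℂ), r), -(ytilde μ w / (z - w) ^ 2)) z := by
    refine hasDerivAt_circleIntegral_comp (𝕜 := ℂ) (f := fun z w => ytilde μ w / (z - w))
      (γ := id) h.pos.le (hasDerivAt_id z) (fun w hw => ?_) _ (fun w hw => ?_)
    · simp only [div_eq_mul_inv]
      refine ContDiffAt.mul ?_ ?_
      · exact ((analyticAt_ytilde hμ (hs w hw)).contDiffAt).comp (f := Prod.snd) (z, w)
          contDiffAt_snd
      · exact ContDiffAt.fun_inv (contDiffAt_fst.sub contDiffAt_snd) (hne w hw)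
    · have := (((hasDerivAt_id z).sub_const w).fun_inv (hne w hw)).const_mul (ytilde μ w)
      simp only [div_eq_mul_inv]
      refine this.congr_deriv ?_
      simp [div_eq_mul_inv]
  refine (h1.mul (hasDerivAt_inv_ytilde hμ hz)).congr_deriv ?_
  have hcy := continuousOn_ytilde hμ hs
  have hcz : ContinuousOn (fun w => (z - w)⁻¹) (sphere (c : ℂ) r) :=
    ContinuousOn.inv₀ (by fun_prop) hne
  have hcb := fun α => continuousOn_inv_sub_branch hμ hs α
  have hpos := h.pos.le
  -- A total w-derivative: integrating it trades the double pole of the kernel for the logarithmic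
  -- derivative of ỹ.
  have e0 : ∮ w in C((c : ℂ), r), (1 / 2 * (∑ α, 1 / (w - μ α)) * ytilde μ w * (z - w)⁻¹ +
      ytilde μ w * (z - w)⁻¹ ^ 2) = 0 := by
    refine circleIntegral.integral_eq_zero_of_hasDerivWithinAt
      (f := fun w => ytilde μ w * (z - w)⁻¹) hpos fun w hw => HasDerivAt.hasDerivWithinAt ?_
    refine ((hasDerivAt_ytilde hμ (hs w hw)).mul
      (((hasDerivAt_id w).const_sub z).fun_inv (hne w hw))).congr_deriv ?_
    simp [div_eq_mul_inv]
  have e1 : (∮ w in C((c : ℂ), r), -(ytilde μ w / (z - w) ^ 2)) =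
      ∮ w in C((c : ℂ), r), 1 / 2 * (∑ α, 1 / (w - μ α)) * ytilde μ w * (z - w)⁻¹ := by
    have hsum : ContinuousOn (fun w => 1 / 2 * (∑ α, 1 / (w - (μ α : ℂ))) * ytilde μ w * (z - w)⁻¹)
        (sphere (c : ℂ) r) := by
      simp only [one_div]
      exact ((continuousOn_const.mul (continuousOn_finsetSum _ fun α _ => hcb α)).mul hcy).mul hcz
    rw [circleIntegral.integral_add (hsum.circleIntegrable hpos)
      ((hcy.fun_mul (hcz.fun_pow 2)).circleIntegrable hpos)] at e0
    rw [eq_neg_of_add_eq_zero_left e0, ← neg_one_mul, ← circleIntegral.integral_const_mul]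
    congr 1
    ext w
    simp [div_eq_mul_inv]
  have e2 : (∮ w in C((c : ℂ), r), 1 / 2 * (∑ α, 1 / (w - μ α)) * ytilde μ w * (z - w)⁻¹) +
      cauchyY μ c r z * (-(1 / 2) * ∑ α, 1 / (z - μ α)) =
      1 / 2 * ∑ α, periodK μ α c r * (z - μ α)⁻¹ := by
    -- Partial fractions: 1/((w - μ)(z - w)) - 1/((z - w)(z - μ)) = 1/((w - μ)(z - μ)).
    have hterm : ∀ α, (∮ w in C((c : ℂ), r), (w - μ α)⁻¹ * ytilde μ w * (z - w)⁻¹) -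
        cauchyY μ c r z * (z - μ α)⁻¹ = periodK μ α c r * (z - μ α)⁻¹ := fun α => by
      unfold cauchyY periodK
      rw [mul_comm (∮ w in C((c : ℂ), r), ytilde μ w / (z - w)),
        mul_comm (∮ w in C((c : ℂ), r), ytilde μ w / (w - μ α)),
        ← circleIntegral.integral_const_mul, ← circleIntegral.integral_const_mul,
        ← circleIntegral.integral_sub ((((hcb α).fun_mul hcy).fun_mul hcz).circleIntegrable hpos)]
      · refine circleIntegral.integral_congr hpos fun w hw => ?_
        have a1 := hne w hw
        have a2 := sub_branch_ne_zero hμ hz α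
        have a3 := sub_branch_ne_zero hμ (hs w hw) α
        field_simp
        ring
      · simp only [div_eq_mul_inv]
        exact (continuousOn_const.fun_mul (hcy.fun_mul hcz)).circleIntegrable hpos
    have hsplit : (∮ w in C((c : ℂ), r), 1 / 2 * (∑ α, 1 / (w - μ α)) * ytilde μ w * (z - w)⁻¹) =
        1 / 2 * ∑ α, ∮ w in C((c : ℂ), r), (w - μ α)⁻¹ * ytilde μ w * (z - w)⁻¹ := by
      rw [← circleIntegral.integral_fun_sum fun α _ =>
        (((hcb α).fun_mul hcy).fun_mul hcz).circleIntegrable hpos, ← circleIntegral.integral_const_mul]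
      congr 1
      ext w
      simp only [Finset.sum_mul, Finset.mul_sum, one_div]
      exact Finset.sum_congr rfl fun α _ => by ring
    rw [hsplit, ← Finset.sum_congr rfl fun α _ => hterm α, Finset.sum_sub_distrib, ← Finset.mul_sum]
    simp only [one_div]
    ring
  rw [e1]
  have e3 : ∑ α, periodK μ α c r * phi μ α 1 z =
      (∑ α, periodK μ α c r * (z - μ α)⁻¹) * (ytilde μ z)⁻¹ := by
    rw [Finset.sum_mul]
    refine Finset.sum_congr rfl fun α _ => ?_
    rw [phi, pow_one, one_div, mul_inv, mul_assoc]
  rw [e3]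
  linear_combination (ytilde μ z)⁻¹ * e2

/-- A circle about the midpoint of the cut with radius slightly above half its length lies strictly
inside the given circle if k = i and strictly outside otherwise. Disjointness keeps the kernel 1/(z
- w) regular when z and w run over the two circles. -/
theorem exists_small_circle (hμ : StrictMono μ) {i k : Fin n} {c r : ℝ} (h : Encircles μ i c r) :
    ∃ c' r', Encircles μ k c' r' ∧ ∀ z ∈ sphere (c : ℂ) r, z ∉ sphere (c' : ℂ) r' := by
  set a := μ (lo k)
  set b := μ (hi k)
  have hab : a < b := lo_lt_hi hμ k
  have hev : ∀ {d : ℝ}, (b - a) / 2 < d → ∀ᶠ e in 𝓝[>] (0 : ℝ), (b - a) / 2 + e < d := fun hd => by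
    refine eventually_nhdsWithin_of_eventually_nhds ?_
    exact (continuous_const.add continuous_id).continuousAt.eventually_lt continuousAt_const
      (by simpa using hd)
  have hbr : ∀ α, α ≠ lo k → α ≠ hi k → (b - a) / 2 < |μ α - (a + b) / 2| := fun α h1 h2 => by
    rw [lt_abs]
    rcases lt_or_gt_of_ne h1 with h3 | h3
    · right
      have := hμ h3
      simp only [a, b] at *
      linarith
    · left
      have h4 : hi k < α := by
        rw [Fin.lt_def] at h3
        rw [Fin.lt_def]
        simp only [lo, hi, ne_eq, Fin.ext_iff] at *
        omega
      have := hμ h4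
      simp only [a, b] at *
      linarith
  have hev1 : ∀ᶠ e in 𝓝[>] (0 : ℝ), ∀ α, α ≠ lo k → α ≠ hi k →
      (b - a) / 2 + e < |μ α - (a + b) / 2| := by
    rw [eventually_all]
    intro α
    by_cases h1 : α = lo k
    · exact Eventually.of_forall fun e h => absurd h1 h
    by_cases h2 : α = hi k
    · exact Eventually.of_forall fun e _ h => absurd h2 h
    filter_upwards [hev (hbr α h1 h2)] with e he _ _
    exact he
  have hdisj : ∀ᶠ e in 𝓝[>] (0 : ℝ),
      |(a + b) / 2 - c| + ((b - a) / 2 + e) < r ∨ (b - a) / 2 + e + r < |(a + b) / 2 - c| := by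
    by_cases hk : k = i
    · subst hk
      have hl := abs_lt.1 h.left_mem
      have hr := abs_lt.1 h.right_mem
      have : (b - a) / 2 < r - |(a + b) / 2 - c| := by
        rw [lt_sub_comm, abs_lt]
        constructor <;> simp only [a, b] <;> linarith
      filter_upwards [hev this] with e he
      left; linarith
    · have : (b - a) / 2 < |(a + b) / 2 - c| - r := by
        rw [lt_sub_iff_add_lt, lt_abs]
        rcases h.side hμ hk with h3 | h3
        · left; simp only [a, b]; linarith
        · right; simp only [a, b]; linarith
      filter_upwards [hev this] with e he
      right; linarith
  obtain ⟨e, he1, he2, he0⟩ := (hev1.and (hdisj.and self_mem_nhdsWithin)).exists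
  have he0 : 0 < e := he0
  refine ⟨(a + b) / 2, (b - a) / 2 + e, ⟨?_, ?_, he1⟩, fun z hz hz' => ?_⟩
  · rw [abs_lt]; constructor <;> simp only [a, b] at * <;> linarith
  · rw [abs_lt]; constructor <;> simp only [a, b] at * <;> linarith
  · rw [mem_sphere] at hz hz'
    have h1 := dist_triangle z (((a + b) / 2 : ℝ) : ℂ) c
    have h2 := dist_triangle_left (((a + b) / 2 : ℝ) : ℂ) (c : ℂ) z
    have h3 : dist (((a + b) / 2 : ℝ) : ℂ) (c : ℂ) = |(a + b) / 2 - c| := by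
      rw [Complex.dist_eq, ← Complex.ofReal_sub, Complex.norm_real, Real.norm_eq_abs]
    rcases he2 with h4 | h4 <;> linarith

/-- The periods of `φ_α^{(1)}`. -/
def phiPeriod (μ : Fin (2 * n) → ℝ) (c r : Fin (n - 1) → ℝ) (α : Fin (2 * n)) (j : Fin (n - 1)) : ℂ :=
  ∮ z in C((c j : ℂ), r j), phi μ α 1 z

/-- The coefficients of the zero modes: all periods of `φ_α^{(1)} + L_α φ^{(0)}` vanish. -/
def zeroModeCoeff (μ : Fin (2 * n) → ℝ) (c r : Fin (n - 1) → ℝ) (α : Fin (2 * n)) :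
    Fin (n - 1) → ℂ :=
  Matrix.vecMul (-phiPeriod μ c r α) (periodMatrix μ c r)⁻¹

/-! ### Existence and uniqueness for the linear system that determines L_α -/

section System

variable (hμ : StrictMono μ) (hE : ∀ j, Encircles μ (cycleCut j) (c j) (r j))
include hμ hE

theorem sum_zeroModeCoeff_mul_period (α : Fin (2 * n)) (j : Fin (n - 1)) :
    ∑ l, zeroModeCoeff μ c r α l * period μ c r l j = -phiPeriod μ c r α j := by
  have h : Matrix.vecMul (zeroModeCoeff μ c r α) (periodMatrix μ c r) = -phiPeriod μ c r α := by
    rw [zeroModeCoeff, Matrix.vecMul_vecMul, Matrix.nonsing_inv_mul _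
      (isUnit_iff_ne_zero.2 (det_periodMatrix_ne_zero hμ hE)), Matrix.vecMul_one]
  exact congrFun h j

omit hE in
theorem continuousOn_phi {s : Set ℂ} (hs : ∀ z ∈ s, z ∉ cuts μ) (α : Fin (2 * n)) (k : ℕ) :
    ContinuousOn (phi μ α k) s := by
  unfold phi
  simp only [one_div, mul_inv, ← inv_pow]
  exact ((continuousOn_inv_sub_branch hμ hs α).pow k).mul (continuousOn_inv_ytilde hμ hs)

theorem coeff_eq_zero_of_sum_mul_period {v : Fin (n - 1) → ℂ}
    (hv : ∀ j, ∑ l, v l * period μ c r l j = 0) : v = 0 :=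
  coeff_eq_zero_of_periods_eq_zero hμ hE fun j => by
    rw [circleIntegral_sum_div_ytilde hμ hE, hv j]

/-- The differential with coefficients K_{α,j} is exact, so its i-th period vanishes. The j-th
circle is first shrunk so that the primitive is regular on the i-th one, also when i = j. -/
theorem sum_periodK_mul_phiPeriod (i j : Fin (n - 1)) :
    ∑ α, periodK μ α (c j) (r j) * phiPeriod μ c r α i = 0 := by
  obtain ⟨c', r', hE', hdisj⟩ := exists_small_circle hμ (k := cycleCut j) (hE i)
  have hs := fun w hw => (hE i).sphere_notMem_cuts hμ (z := w) hw
  have h1 : ∮ z in C((c i : ℂ), r i), (1 / 2 * ∑ α, periodK μ α c' r' * phi μ α 1 z) = 0 :=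
    circleIntegral.integral_eq_zero_of_hasDerivWithinAt (hE i).pos.le fun z hz =>
      (hE'.hasDerivAt_cauchyY_div hμ (hs z hz) (hdisj z hz)).hasDerivWithinAt
  rw [circleIntegral.integral_const_mul, circleIntegral.integral_fun_sum fun α _ =>
    (continuousOn_const.fun_mul (continuousOn_phi hμ hs α 1)).circleIntegrable (hE i).pos.le] at h1
  simp only [circleIntegral.integral_const_mul] at h1
  rw [← (mul_eq_zero.1 h1).resolve_left (by norm_num)]
  refine Finset.sum_congr rfl fun α _ => ?_
  rw [(hE j).periodK_eq hμ hE', phiPeriod]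

-- The inhomogeneous term fits in degree at most n - 2: for k = n the coefficient of p^{n-1} is the
-- number 2n of branch points minus 2n.
omit hμ hE in
theorem exists_zeroMode_rhs (hn : 1 ≤ n) {k : ℕ} (hk : k ≤ n) :
    ∃ s : Fin (n - 1) → ℂ, ∀ p : ℂ,
      (∑ α, ∑ l ∈ Finset.range k, (μ α : ℂ) ^ (k - l - 1) * p ^ l) - 2 * k * p ^ (k - 1) =
        ∑ l, s l * p ^ (l : ℕ) := by
  rcases k with _ | m
  · exact ⟨0, fun p => by simp⟩
  set e : ℕ → ℂ := fun l => (if l ≤ m then ∑ α, (μ α : ℂ) ^ (m - l) else 0) -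
    if l = m then 2 * (m + 1) else 0 with he
  have hp : ∀ p : ℂ, (∑ α, ∑ l ∈ Finset.range (m + 1), (μ α : ℂ) ^ (m + 1 - l - 1) * p ^ l) -
      2 * (m + 1 : ℕ) * p ^ (m + 1 - 1) = ∑ l ∈ Finset.range (m + 1), e l * p ^ l := by
    intro p
    rw [Finset.sum_comm]
    simp only [he, sub_mul, Finset.sum_sub_distrib, ite_mul, zero_mul]
    congr 1
    · refine Finset.sum_congr rfl fun l hl => ?_
      rw [if_pos (by simpa [Nat.lt_succ_iff] using hl), Finset.sum_mul]
      exact Finset.sum_congr rfl fun α _ => by congr 2; omega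
    · push_cast
      simp
  refine ⟨fun l => e l, fun p => ?_⟩
  rw [hp, Fin.sum_univ_eq_sum_range (fun l => e l * p ^ l)]
  rcases hk.eq_or_lt with h | h
  · rw [Finset.sum_range_succ, show n - 1 = m by omega]
    have : e m = 0 := by
      simp only [he, le_refl, if_true, Nat.sub_self, pow_zero, Finset.sum_const, Finset.card_univ,
        Fintype.card_fin, nsmul_eq_mul, mul_one]
      rw [← h]
      push_cast
      ring
    rw [this, zero_mul, add_zero]
  · refine Finset.sum_subset (by simpa using by omega) fun l _ hl => ?_
    have : m < l := by simpa using hl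
    simp [he, not_le.2 this, this.ne']

-- Dividing z^k - μ_α^k by z - μ_α replaces μ_α^k by z^k at the cost of a polynomial over ỹ. The
-- right side is -2 times the derivative of z^k/ỹ.
omit hE in
theorem pow_div_sub_branch_identity {k : ℕ} {z : ℂ} (hz : z ∉ cuts μ) :
    (∑ α, (μ α : ℂ) ^ k * phi μ α 1 z) +
      ((∑ α, ∑ l ∈ Finset.range k, (μ α : ℂ) ^ (k - l - 1) * z ^ l) - 2 * k * z ^ (k - 1)) *
        (ytilde μ z)⁻¹ =
      -2 * (k * z ^ (k - 1) * (ytilde μ z)⁻¹ +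
        z ^ k * (-(1 / 2) * (∑ α, 1 / (z - μ α)) * (ytilde μ z)⁻¹)) := by
  have h : ∀ α, (μ α : ℂ) ^ k * phi μ α 1 z +
      (∑ l ∈ Finset.range k, (μ α : ℂ) ^ (k - l - 1) * z ^ l) * (ytilde μ z)⁻¹ =
      z ^ k * (1 / (z - μ α)) * (ytilde μ z)⁻¹ := fun α => by
    have h1 := sub_branch_ne_zero hμ hz α
    have h2 := (Commute.all z (μ α : ℂ)).geom_sum₂_mul k
    have h3 : ∑ l ∈ Finset.range k, (μ α : ℂ) ^ (k - l - 1) * z ^ l =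
        ∑ l ∈ Finset.range k, z ^ l * (μ α : ℂ) ^ (k - 1 - l) :=
      Finset.sum_congr rfl fun l _ => by rw [mul_comm]; congr 2; omega
    rw [h3, phi, pow_one, one_div, mul_inv, ← mul_assoc, ← add_mul]
    congr 1
    rw [← div_eq_mul_inv, ← div_eq_mul_one_div, div_add' _ _ _ h1, h2]
    ring
  have hsum := Finset.sum_congr rfl fun α (_ : α ∈ Finset.univ) => h α
  rw [Finset.sum_add_distrib, ← Finset.sum_mul, ← Finset.sum_mul, ← Finset.mul_sum] at hsum
  linear_combination hsum

omit hE in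
theorem hasDerivAt_pow_div_ytilde (k : ℕ) {z : ℂ} (hz : z ∉ cuts μ) :
    HasDerivAt (fun z => z ^ k * (ytilde μ z)⁻¹) (k * z ^ (k - 1) * (ytilde μ z)⁻¹ +
        z ^ k * (-(1 / 2) * (∑ α, 1 / (z - μ α)) * (ytilde μ z)⁻¹)) z :=
  (hasDerivAt_pow k z).mul (hasDerivAt_inv_ytilde hμ hz)

/-- A polynomial of degree at most n - 2 over ỹ is determined by its A-periods. Here both candidates
have those of -∑ μ_α^k φ_α^{(1)}, one by the definition of the coefficients and the other because
(z^k/ỹ)' has no periods. -/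
theorem sum_pow_mul_zeroModeCoeff (hn : 1 ≤ n) {k : ℕ} (hk : k ≤ n) (p : ℂ) :
    (∑ α, (μ α : ℂ) ^ k * zeroModePoly (zeroModeCoeff μ c r) α p)
      - (∑ α, ∑ l ∈ Finset.range k, (μ α : ℂ) ^ (k - l - 1) * p ^ l)
      + 2 * k * p ^ (k - 1) = 0 := by
  obtain ⟨s, hs⟩ := exists_zeroMode_rhs (μ := μ) hn hk
  have h0 : (fun l => ∑ α, (μ α : ℂ) ^ k * zeroModeCoeff μ c r α l - s l) = 0 := by
    refine coeff_eq_zero_of_sum_mul_period hμ hE fun j => ?_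
    have hoff := fun w hw => (hE j).sphere_notMem_cuts hμ (z := w) hw
    have hpos := (hE j).pos.le
    have h1 : ∑ l, (∑ α, (μ α : ℂ) ^ k * zeroModeCoeff μ c r α l) * period μ c r l j =
        -∑ α, (μ α : ℂ) ^ k * phiPeriod μ c r α j := by
      simp only [Finset.sum_mul]
      rw [Finset.sum_comm, ← Finset.sum_neg_distrib]
      refine Finset.sum_congr rfl fun α _ => ?_
      rw [← mul_neg, ← sum_zeroModeCoeff_mul_period hμ hE, Finset.mul_sum]
      exact Finset.sum_congr rfl fun l _ => by ring
    simp only [sub_mul, Finset.sum_sub_distrib]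
    rw [h1, ← circleIntegral_sum_div_ytilde hμ hE]
    have h2 : ∮ z in C((c j : ℂ), r j), ((∑ α, (μ α : ℂ) ^ k * phi μ α 1 z) +
        (∑ l, s l * z ^ (l : ℕ)) * (ytilde μ z)⁻¹) = 0 := by
      have h3 : ∮ z in C((c j : ℂ), r j), (k * z ^ (k - 1) * (ytilde μ z)⁻¹ +
        z ^ k * (-(1 / 2) * (∑ α, 1 / (z - μ α)) * (ytilde μ z)⁻¹)) = 0 :=
        circleIntegral.integral_eq_zero_of_hasDerivWithinAt hpos fun z hz =>
          (hasDerivAt_pow_div_ytilde hμ k (hoff z hz)).hasDerivWithinAt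
      rw [← mul_zero (-2 : ℂ), ← h3, ← circleIntegral.integral_const_mul]
      refine circleIntegral.integral_congr hpos fun z hz => ?_
      rw [← hs, pow_div_sub_branch_identity hμ (hoff z hz)]
    have hphi : ∀ α, ContinuousOn (fun z => (μ α : ℂ) ^ k * phi μ α 1 z) (sphere (c j : ℂ) (r j)) :=
      fun α => continuousOn_const.mul (continuousOn_phi hμ hoff α 1)
    have hsl : ContinuousOn (fun z => (∑ l, s l * z ^ (l : ℕ)) * (ytilde μ z)⁻¹)
        (sphere (c j : ℂ) (r j)) :=
      ContinuousOn.mul (by fun_prop) (continuousOn_inv_ytilde hμ hoff)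
    rw [circleIntegral.integral_add ((continuousOn_finsetSum _ fun α _ => hphi α).circleIntegrable hpos)
      (hsl.circleIntegrable hpos),
      circleIntegral.integral_fun_sum fun α _ => (hphi α).circleIntegrable hpos] at h2
    simp only [circleIntegral.integral_const_mul, ← div_eq_mul_inv] at h2
    unfold phiPeriod
    linear_combination -h2
  have h1 : ∑ α, (μ α : ℂ) ^ k * zeroModePoly (zeroModeCoeff μ c r) α p = ∑ l, s l * p ^ (l : ℕ) := by
    unfold zeroModePoly
    simp only [Finset.mul_sum]
    rw [Finset.sum_comm]
    refine Finset.sum_congr rfl fun l _ => ?_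
    have := congrFun h0 l
    simp only [Pi.zero_apply] at this
    rw [← sub_eq_zero.1 this, Finset.sum_mul]
    exact Finset.sum_congr rfl fun α _ => by ring
  rw [h1, ← hs]
  ring

theorem sum_zeroModeCoeff_mul_periodK (j : Fin (n - 1)) (p : ℂ) :
    ∑ α, zeroModePoly (zeroModeCoeff μ c r) α p * periodK μ α (c j) (r j) = 0 := by
  have h0 : (fun l => ∑ α, zeroModeCoeff μ c r α l * periodK μ α (c j) (r j)) = 0 := by
    refine coeff_eq_zero_of_sum_mul_period hμ hE fun i => ?_
    simp only [Finset.sum_mul]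
    rw [Finset.sum_comm, ← neg_eq_zero, ← sum_periodK_mul_phiPeriod hμ hE i j,
      ← Finset.sum_neg_distrib]
    refine Finset.sum_congr rfl fun α _ => ?_
    rw [← neg_neg (phiPeriod μ c r α i), ← sum_zeroModeCoeff_mul_period hμ hE, mul_neg,
      Finset.mul_sum]
    congr 1
    exact Finset.sum_congr rfl fun l _ => by ring
  simp only [zeroModePoly, Finset.sum_mul]
  rw [Finset.sum_comm]
  refine Finset.sum_eq_zero fun l _ => ?_
  have := congrFun h0 l
  simp only [Pi.zero_apply] at this
  rw [← zero_mul (p ^ (l : ℕ)), ← this, Finset.sum_mul]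
  exact Finset.sum_congr rfl fun α _ => by ring

theorem solvesZeroModeSystem_iff (hn : 1 ≤ n) (L : Fin (2 * n) → Fin (n - 1) → ℂ) :
    SolvesZeroModeSystem μ c r L ↔ L = zeroModeCoeff μ c r := by
  constructor
  · rintro ⟨h1, h2⟩
    have hsub : ∀ p α, zeroModePoly L α p - zeroModePoly (zeroModeCoeff μ c r) α p = 0 := by
      intro p
      have := eq_zero_of_moments_of_periodK hμ hE
        (x := fun α => zeroModePoly L α p - zeroModePoly (zeroModeCoeff μ c r) α p) ?_ ?_
      · exact fun α => congrFun this α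
      · intro k hk
        simp only [mul_sub, Finset.sum_sub_distrib]
        linear_combination h1 k hk p - sum_pow_mul_zeroModeCoeff hμ hE hn hk p
      · intro j
        simp only [sub_mul, Finset.sum_sub_distrib]
        rw [h2 j p, sum_zeroModeCoeff_mul_periodK hμ hE, sub_zero]
    ext α
    -- The polynomials agree as functions; evaluating at p = 0, …, n - 2 recovers the coefficients
    -- by a Vandermonde determinant.
    have hv := Matrix.eq_zero_of_forall_index_sum_pow_mul_eq_zero
      (f := fun i : Fin (n - 1) => ((i : ℕ) : ℂ)) (v := L α - zeroModeCoeff μ c r α)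
      (fun i j hij => Fin.ext (Nat.cast_injective (R := ℂ) hij)) fun i => by
        rw [← hsub i α, zeroModePoly, zeroModePoly, ← Finset.sum_sub_distrib]
        refine Finset.sum_congr rfl fun l _ => ?_
        simp only [Pi.sub_apply]
        ring
    exact congrFun (sub_eq_zero.1 hv) _
  · rintro rfl
    exact ⟨fun k hk p => sum_pow_mul_zeroModeCoeff hμ hE hn hk p,
      fun j p => sum_zeroModeCoeff_mul_periodK hμ hE j p⟩

omit hE in
theorem phi_star {z : ℂ} (hz : z ∉ cuts μ) (α : Fin (2 * n)) (k : ℕ) :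
    phi μ α k (star z) = star (phi μ α k z) := by
  unfold phi
  rw [ytilde_star hμ hz]
  simp

end System

end

section

variable {n : ℕ}

/-! ### Variation of the coupling constants -/

theorem shift_zero (V : ℝ[X]) (j : ℕ) : shift V j 0 = V := by simp [shift]

theorem force_shift (V : ℝ[X]) (j : ℕ) (s : ℝ) (z : ℂ) :
    force (shift V j s) z = force V z + s * z ^ j := by
  have h : (j + 1 : ℂ) ≠ 0 := by exact_mod_cast Nat.succ_ne_zero j
  simp only [force, shift, Polynomial.derivative_C_mul_X_pow, map_add,
    map_mul, map_pow, Polynomial.aeval_X, Polynomial.aeval_C, Complex.coe_algebraMap]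
  push_cast
  field_simp

theorem differentiable_force (V : ℝ[X]) : Differentiable ℂ (force V) :=
  Polynomial.differentiable_aeval _

theorem continuous_force (V : ℝ[X]) : Continuous (force V) := (differentiable_force V).continuous

theorem contDiff_force (V : ℝ[X]) : ContDiff ℂ 1 (force V) := (differentiable_force V).contDiff

theorem isBigO_pow_pow {i N : ℕ} (h : i ≤ N) :
    (fun z : ℂ => z ^ i) =O[cobounded ℂ] fun z => z ^ N := by
  refine Asymptotics.IsBigO.of_bound 1 ?_
  have h : ∀ᶠ z : ℂ in cobounded ℂ, 1 ≤ ‖z‖ :=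
    tendsto_norm_cobounded_atTop.eventually_ge_atTop _
  filter_upwards [h] with z hz
  rw [norm_pow, norm_pow, one_mul]
  exact pow_le_pow_right₀ hz ‹_›

theorem isBigO_inv_pow_inv_pow {i N : ℕ} (h : i ≤ N) :
    (fun z : ℂ => (z ^ N)⁻¹) =O[cobounded ℂ] fun z => (z ^ i)⁻¹ := by
  refine Asymptotics.IsBigO.of_bound 1 ?_
  have h : ∀ᶠ z : ℂ in cobounded ℂ, 1 ≤ ‖z‖ :=
    tendsto_norm_cobounded_atTop.eventually_ge_atTop _
  filter_upwards [h] with z hz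
  rw [norm_inv, norm_inv, norm_pow, norm_pow, one_mul]
  exact inv_anti₀ (by positivity) (pow_le_pow_right₀ hz ‹_›)

theorem isBigO_force (V : ℝ[X]) {N : ℕ} (hN : (Polynomial.derivative V).natDegree ≤ N) :
    force V =O[cobounded ℂ] fun z => z ^ N := by
  have : force V = fun z => ∑ i ∈ Finset.range ((Polynomial.derivative V).natDegree + 1),
      (Polynomial.derivative V).coeff i • z ^ i := by
    ext z
    rw [force, Polynomial.aeval_eq_sum_range]
  rw [this]
  refine Asymptotics.IsBigO.fun_sum fun i hi => ?_
  have hiN : i ≤ N := by rw [Finset.mem_range] at hi; omega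
  exact (isBigO_pow_pow hiN).const_smul_left ((Polynomial.derivative V).coeff i)

/-- The exponent does not depend on s, so along the whole variation M(p) expands over one fixed
range of powers. -/
theorem isBigO_force_shift (V : ℝ[X]) (j : ℕ) (s : ℝ) :
    force (shift V j s) =O[cobounded ℂ]
      fun z => z ^ ((Polynomial.derivative V).natDegree + j) := by
  have h1 := isBigO_force V (Nat.le_add_right (Polynomial.derivative V).natDegree j)
  have h2 := (isBigO_pow_pow (Nat.le_add_left j (Polynomial.derivative V).natDegree)).const_mul_left
    (s : ℂ)
  refine (h1.add h2).congr_left fun z => ?_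
  rw [force_shift]

theorem differentiableAt_inv_ytilde {μ : Fin (2 * n) → ℝ} (hμ : StrictMono μ) {z : ℂ}
    (hz : z ∉ cuts μ) : DifferentiableAt ℂ (fun z => (ytilde μ z)⁻¹) z :=
  (hasDerivAt_inv_ytilde hμ hz).differentiableAt

theorem analyticAt_phi {μ : Fin (2 * n) → ℝ} (hμ : StrictMono μ) {z : ℂ} (hz : z ∉ cuts μ)
    (α : Fin (2 * n)) (k : ℕ) : AnalyticAt ℂ (phi μ α k) z := by
  unfold phi
  refine AnalyticAt.div analyticAt_const (AnalyticAt.mul (by fun_prop) (analyticAt_ytilde hμ hz)) ?_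
  exact mul_ne_zero (pow_ne_zero _ (sub_branch_ne_zero hμ hz α)) (ytilde_ne_zero hμ hz)

theorem phi_zero (μ : Fin (2 * n) → ℝ) (α : Fin (2 * n)) (z : ℂ) :
    phi μ α 0 z = (ytilde μ z)⁻¹ := by simp [phi]

theorem phi_succ (μ : Fin (2 * n) → ℝ) (α : Fin (2 * n)) (k : ℕ) (z : ℂ) :
    phi μ α (k + 1) z = phi μ α k z / (z - μ α) := by
  simp only [phi, pow_succ, mul_inv, div_eq_mul_inv]
  ring

theorem sphere_off_cuts {μ : Fin (2 * n) → ℝ} {R : ℝ} (hR : ‖μ‖ < R) :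
    ∀ z ∈ sphere (0 : ℂ) R, z ∉ cuts μ := fun z hz =>
  notMem_cuts_of_lt (by rw [mem_sphere_zero_iff_norm] at hz; rwa [hz])

/-! ### Variation of contour integrals along a curve of branch points -/

section Curve

variable {γ : ℝ → Fin (2 * n) → ℝ} {v : Fin (2 * n) → ℝ}

theorem contDiffAt_inv_ytilde {μ : Fin (2 * n) → ℝ} (hμ : StrictMono μ) {z : ℂ}
    (hz : z ∉ cuts μ) :
    ContDiffAt ℝ 1 (fun q : (Fin (2 * n) → ℝ) × ℂ => (ytilde q.1 q.2)⁻¹) (μ, z) :=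
  (contDiffAt_ytilde hμ hz).fun_inv (ytilde_ne_zero hμ hz)

theorem contDiffAt_phi {μ : Fin (2 * n) → ℝ} (hμ : StrictMono μ) {z : ℂ} (hz : z ∉ cuts μ)
    (α : Fin (2 * n)) (k : ℕ) :
    ContDiffAt ℝ 1 (fun q : (Fin (2 * n) → ℝ) × ℂ => phi q.1 α k q.2) (μ, z) := by
  have hsub : ContDiff ℝ 1 fun q : (Fin (2 * n) → ℝ) × ℂ => (q.2 - (q.1 α : ℂ)) ^ k :=
    (contDiff_snd.sub (Complex.ofRealCLM.contDiff.comp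
      ((contDiff_apply ℝ ℝ α).comp contDiff_fst))).pow k
  unfold phi
  simp only [one_div]
  refine ContDiffAt.fun_inv (hsub.contDiffAt.mul (contDiffAt_ytilde hμ hz)) ?_
  exact mul_ne_zero (pow_ne_zero _ (sub_branch_ne_zero hμ hz α)) (ytilde_ne_zero hμ hz)

theorem hasDerivAt_phi_comp (hγ : HasDerivAt γ v 0) (hm : ∀ᶠ s in 𝓝 0, StrictMono (γ s)) {z : ℂ}
    (hz : z ∉ cuts (γ 0)) (α : Fin (2 * n)) (k : ℕ) :
    HasDerivAt (fun s => phi (γ s) α k z)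
      (1 / 2 * (∑ β, v β * (phi (γ 0) α k z / (z - γ 0 β))) + k * v α * phi (γ 0) α (k + 1) z) 0 := by
  have hm0 := hm.self_of_nhds
  have h1 := sub_branch_ne_zero hm0 hz α
  have hy := ytilde_ne_zero hm0 hz
  have h2 : HasDerivAt (fun s => (z - (γ s α : ℂ)) ^ k) (k * (z - γ 0 α) ^ (k - 1) * -(v α : ℂ)) 0 :=
    (((hasDerivAt_pi.1 hγ α).ofReal_comp).const_sub z).fun_pow k
  have h3 := (h2.fun_mul (hasDerivAt_ytilde_comp hγ hm hz)).fun_inv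
    (mul_ne_zero (pow_ne_zero k h1) hy)
  unfold phi
  simp only [one_div]
  refine h3.congr_deriv ?_
  have h4 : ∑ β, (v β : ℂ) * (((z - γ 0 α) ^ k * ytilde (γ 0) z)⁻¹ / (z - γ 0 β)) =
      (∑ β, (v β : ℂ) / (z - γ 0 β)) * ((z - γ 0 α) ^ k * ytilde (γ 0) z)⁻¹ := by
    rw [Finset.sum_mul]
    exact Finset.sum_congr rfl fun β _ => by ring
  rw [h4]
  rcases k with _ | k
  · simp
    field_simp
  · simp only [Nat.add_sub_cancel, pow_succ]
    field_simp
    ring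

/-- The common source of all variations below. The weight q is later a power of z, an inverse power,
1/(z - p) or 1, which covers the asymptotic conditions, M(p) and the moments. -/
theorem hasDerivAt_contour_phi (hγ : HasDerivAt γ v 0) (hm : ∀ᶠ s in 𝓝 0, StrictMono (γ s))
    {R : ℝ} (hR : ‖γ 0‖ < R) {q : ℂ → ℂ} (hq : ∀ z, ‖z‖ = R → ContDiffAt ℂ 1 q z) (V : ℝ[X]) (j : ℕ)
    (α : Fin (2 * n)) (k : ℕ) :
    HasDerivAt (fun s => contour R fun z => q z * force (shift V j s) z * phi (γ s) α k z)
      (contour R (fun z => q z * z ^ j * phi (γ 0) α k z) +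
        1 / 2 * (∑ β, v β * contour R fun z => q z * force V z * (phi (γ 0) α k z / (z - γ 0 β))) +
        k * v α * contour R fun z => q z * force V z * phi (γ 0) α (k + 1) z) 0 := by
  have hR0 : 0 ≤ R := (norm_nonneg _).trans hR.le
  have hm0 := hm.self_of_nhds
  have hs := sphere_off_cuts hR
  have hqc : ContinuousOn q (sphere (0 : ℂ) R) := fun z hz =>
    (hq z (by simpa using hz)).continuousAt.continuousWithinAt
  have hfc := (continuous_force V).continuousOn (s := sphere (0 : ℂ) R)
  have hphi := fun k => continuousOn_phi hm0 hs α k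
  have hb := fun β => continuousOn_inv_sub_branch hm0 hs β
  have h1 : HasDerivAt (fun s => ∮ z in C(0, R), q z * (force V z + s * z ^ j) * phi (γ s) α k z)
      (∮ z in C(0, R), (q z * z ^ j * phi (γ 0) α k z + (1 / 2 * (∑ β, v β * (q z * force V z *
        (phi (γ 0) α k z / (z - γ 0 β)))) + k * v α * (q z * force V z * phi (γ 0) α (k + 1) z)))) 0 := by
    refine hasDerivAt_circleIntegral_comp (𝕜 := ℝ) (γ := fun s => (γ s, s))
      (f := fun (p : (Fin (2 * n) → ℝ) × ℝ) z => q z * (force V z + p.2 * z ^ j) * phi p.1 α k z)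
      hR0 (hγ.prodMk (hasDerivAt_id 0)) (fun z hz => ?_) _ (fun z hz => ?_)
    · refine ContDiffAt.mul (ContDiffAt.mul ?_ (ContDiffAt.add ?_ (ContDiffAt.mul ?_ ?_))) ?_
      · exact ((hq z (by simpa using hz)).restrict_scalars ℝ).comp (f := Prod.snd) _ contDiffAt_snd
      · exact ((contDiff_force V).restrict_scalars ℝ).contDiffAt.comp (f := Prod.snd) _ contDiffAt_snd
      · exact (Complex.ofRealCLM.contDiff.comp (contDiff_snd.comp contDiff_fst)).contDiffAt
      · exact (contDiff_snd.pow j).contDiffAt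
      · exact (contDiffAt_phi hm0 (hs z hz) α k).comp (f := fun p : ((Fin (2 * n) → ℝ) × ℝ) × ℂ =>
          (p.1.1, p.2)) ((γ 0, 0), z)
          ((contDiff_fst.comp contDiff_fst).prodMk contDiff_snd).contDiffAt
    · have h2 : HasDerivAt (fun s : ℝ => q z * (force V z + s * z ^ j)) (q z * z ^ j) 0 := by
        have := (((hasDerivAt_id (0 : ℝ)).ofReal_comp).mul_const (z ^ j)).const_add (force V z)
        simpa using this.const_mul (q z)
      refine (h2.fun_mul (hasDerivAt_phi_comp hγ hm (hs z hz) α k)).congr_deriv ?_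
      have h3 : ∑ β, (v β : ℂ) * (q z * force V z * (phi (γ 0) α k z / (z - γ 0 β))) =
          q z * force V z * ∑ β, (v β : ℂ) * (phi (γ 0) α k z / (z - γ 0 β)) := by
        rw [Finset.mul_sum]
        exact Finset.sum_congr rfl fun β _ => by ring
      rw [h3]
      push_cast
      ring
  unfold contour
  simp only [force_shift]
  refine (h1.const_mul _).congr_deriv ?_
  have c1 : ContinuousOn (fun z => q z * z ^ j * phi (γ 0) α k z) (sphere (0 : ℂ) R) :=
    (hqc.mul (by fun_prop)).mul (hphi k)
  have c2 : ∀ β, ContinuousOn (fun z => (v β : ℂ) * (q z * force V z *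
      (phi (γ 0) α k z / (z - γ 0 β)))) (sphere (0 : ℂ) R) := fun β => by
    simp only [div_eq_mul_inv]
    exact continuousOn_const.mul ((hqc.mul hfc).mul ((hphi k).mul (hb β)))
  have c3 : ContinuousOn (fun z => k * v α * (q z * force V z * phi (γ 0) α (k + 1) z))
      (sphere (0 : ℂ) R) := continuousOn_const.mul ((hqc.mul hfc).mul (hphi (k + 1)))
  have c2' : ContinuousOn (fun z => 1 / 2 * ∑ β, (v β : ℂ) * (q z * force V z *
      (phi (γ 0) α k z / (z - γ 0 β)))) (sphere (0 : ℂ) R) :=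
    continuousOn_const.mul (continuousOn_finsetSum _ fun β _ => c2 β)
  rw [circleIntegral.integral_add (c1.circleIntegrable hR0) ((c2'.fun_add c3).circleIntegrable hR0),
    circleIntegral.integral_add (c2'.circleIntegrable hR0) (c3.circleIntegrable hR0),
    circleIntegral.integral_const_mul, circleIntegral.integral_const_mul,
    circleIntegral.integral_fun_sum fun β _ => (c2 β).circleIntegrable hR0]
  simp only [circleIntegral.integral_const_mul]
  have h5 : ∀ g : Fin (2 * n) → ℂ, ∑ β, (v β : ℂ) * ((2 * Real.pi * Complex.I)⁻¹ * g β) =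
      (2 * Real.pi * Complex.I)⁻¹ * ∑ β, (v β : ℂ) * g β := fun g => by
    rw [Finset.mul_sum]
    exact Finset.sum_congr rfl fun β _ => by ring
  rw [h5]
  ring

end Curve

/-! ### Radius independence for the planar quantities -/

section Radius

variable {μ : Fin (2 * n) → ℝ} (hμ : StrictMono μ)
include hμ

theorem differentiableAt_phi {z : ℂ} (hz : ‖μ‖ < ‖z‖) (α : Fin (2 * n)) (k : ℕ) :
    DifferentiableAt ℂ (phi μ α k) z := (analyticAt_phi hμ (notMem_cuts_of_lt hz) α k).differentiableAt

theorem moment_eq_contour {V : ℝ[X]} {α : Fin (2 * n)} {k : ℕ} {R : ℝ} (hR : ‖μ‖ < R) :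
    moment μ V α k = contour R fun z => force V z * phi μ α k z :=
  contour_radius_eq (norm_nonneg μ)
    (fun _ hz => (differentiable_force V _).mul (differentiableAt_phi hμ hz α k))
    (lt_add_one _) hR

theorem bigM_eq_contour {V : ℝ[X]} {p : ℂ} {R : ℝ} (hR : ‖μ‖ < R) (hp : ‖p‖ < R) :
    bigM μ V p = contour R fun z => (z - p)⁻¹ * force V z * (ytilde μ z)⁻¹ := by
  have h : bigM μ V p = contour (max ‖μ‖ ‖p‖ + 1)
      fun z => (z - p)⁻¹ * force V z * (ytilde μ z)⁻¹ := by
    unfold bigM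
    congr 1
    ext z
    rw [div_eq_mul_inv, mul_inv]
    ring
  rw [h]
  refine contour_radius_eq (ρ := max ‖μ‖ ‖p‖) (le_max_of_le_left (norm_nonneg μ)) (fun z hz => ?_)
    (lt_add_one _) (max_lt hR hp)
  refine DifferentiableAt.fun_mul (DifferentiableAt.fun_mul (DifferentiableAt.fun_inv (by fun_prop) ?_)
    (differentiable_force V z)) (differentiableAt_inv_ytilde hμ
      (notMem_cuts_of_lt ((le_max_left _ _).trans_lt hz)))
  intro h0
  rw [sub_eq_zero.1 h0] at hz
  exact absurd hz (not_lt.2 (le_max_right _ _))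

/-- `M(p)` is a polynomial in `p`. -/
theorem bigM_eq_sum {V : ℝ[X]} {N : ℕ} (hN : force V =O[cobounded ℂ] fun z => z ^ N) {R : ℝ}
    (hR : ‖μ‖ < R) (p : ℂ) :
    bigM μ V p = ∑ i ∈ Finset.range (N + 1), p ^ i *
      contour R fun z => (z ^ (i + 1))⁻¹ * force V z * (ytilde μ z)⁻¹ := by
  set R' := max R ‖p‖ + 1
  have hRR' : R < R' := (le_max_left _ _).trans_lt (lt_add_one _)
  have hpR' : ‖p‖ < R' := (le_max_right _ _).trans_lt (lt_add_one _)
  have hR'0 : 0 ≤ R' := (norm_nonneg μ).trans (hR.trans hRR').le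
  have hs := sphere_off_cuts (hR.trans hRR')
  have hz0 : ∀ z : ℂ, ‖μ‖ < ‖z‖ → z ≠ 0 := fun z hz => norm_pos_iff.1 ((norm_nonneg μ).trans_lt hz)
  have hdiff : ∀ i z, ‖μ‖ < ‖z‖ →
      DifferentiableAt ℂ (fun z => (z ^ (i + 1))⁻¹ * force V z * (ytilde μ z)⁻¹) z := fun i z hz =>
    DifferentiableAt.fun_mul (DifferentiableAt.fun_mul (DifferentiableAt.fun_inv (by fun_prop)
      (pow_ne_zero _ (hz0 z hz))) (differentiable_force V z))
      (differentiableAt_inv_ytilde hμ (notMem_cuts_of_lt hz))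
  -- After expanding 1/(z - p) to order N + 1, the remainder decays like z⁻¹ · z^{-(N+1)} · z^N =
  -- z⁻².
  have hrem : contour R' (fun z => (z - p)⁻¹ * ((z ^ (N + 1))⁻¹ * force V z * (ytilde μ z)⁻¹)) = 0 := by
    refine contour_eq_zero_of_isBigO (ρ := max R ‖p‖)
      (le_max_of_le_right (norm_nonneg p)) (fun z hz => ?_) (lt_add_one _) ?_
    · refine DifferentiableAt.fun_mul (DifferentiableAt.fun_inv (by fun_prop) ?_)
        (hdiff N z (hR.trans ((le_max_left _ _).trans_lt hz)))
      intro h0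
      rw [sub_eq_zero.1 h0] at hz
      exact absurd hz (not_lt.2 (le_max_right _ _))
    · have h1 : (fun z => (ytilde μ z)⁻¹) =O[cobounded ℂ] fun _ => (1 : ℂ) := by
        simpa using (isBigO_inv_ytilde hμ).trans (isBigO_inv_pow_inv_pow (Nat.zero_le n))
      have h2 := (isBigO_inv_sub p).mul
        (((Asymptotics.isBigO_refl (fun z : ℂ => (z ^ (N + 1))⁻¹) (cobounded ℂ)).mul hN).mul h1)
      refine h2.congr' (EventuallyEq.refl _ _) ?_
      filter_upwards [(tendsto_norm_cobounded_atTop (E := ℂ)).eventually_gt_atTop 0] with z hz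
      have : z ≠ 0 := norm_pos_iff.1 hz
      field_simp
      ring
  rw [bigM_eq_contour hμ (hR.trans hRR') hpR']
  have hterm : ∀ i ∈ Finset.range (N + 1), ContinuousOn
      (fun z => p ^ i * ((z ^ (i + 1))⁻¹ * force V z * (ytilde μ z)⁻¹)) (sphere (0 : ℂ) R') :=
    fun i _ z hz => ((hdiff i z (by
      rw [mem_sphere_zero_iff_norm] at hz; rw [hz]; exact hR.trans hRR')).const_mul
        _).continuousAt.continuousWithinAt
  have hc : ContinuousOn (fun z => (z - p)⁻¹ * ((z ^ (N + 1))⁻¹ * force V z * (ytilde μ z)⁻¹))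
      (sphere (0 : ℂ) R') := by
    refine ContinuousOn.mul (ContinuousOn.inv₀ (by fun_prop) fun z hz h0 => ?_) fun z hz =>
      (hdiff N z (by
        rw [mem_sphere_zero_iff_norm] at hz; rw [hz]; exact hR.trans hRR')).continuousAt.continuousWithinAt
    rw [mem_sphere_zero_iff_norm, sub_eq_zero.1 h0] at hz
    exact hpR'.ne hz
  have h1 : contour R' (fun z => (z - p)⁻¹ * force V z * (ytilde μ z)⁻¹) =
      contour R' (fun z => (∑ i ∈ Finset.range (N + 1),
        p ^ i * ((z ^ (i + 1))⁻¹ * force V z * (ytilde μ z)⁻¹)) +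
        p ^ (N + 1) * ((z - p)⁻¹ * ((z ^ (N + 1))⁻¹ * force V z * (ytilde μ z)⁻¹))) := by
    refine contour_congr hR'0 fun z hz => ?_
    have hz0' : z ≠ 0 := hz0 z (by rw [hz]; exact hR.trans hRR')
    have hzp : z - p ≠ 0 := fun h0 => by
      rw [sub_eq_zero.1 h0] at hz
      exact hpR'.ne hz
    have hgeom : ∑ i ∈ Finset.range (N + 1), p ^ i * (z ^ (i + 1))⁻¹ =
        (z - p)⁻¹ * (1 - p ^ (N + 1) * (z ^ (N + 1))⁻¹) := by
      rw [eq_inv_mul_iff_mul_eq₀ hzp]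
      clear hterm hc hrem
      induction (N + 1) with
      | zero => simp
      | succ m ih =>
        rw [Finset.sum_range_succ, mul_add, ih]
        simp only [pow_succ]
        field_simp
        ring
    have h2 : ∑ i ∈ Finset.range (N + 1), p ^ i * ((z ^ (i + 1))⁻¹ * force V z * (ytilde μ z)⁻¹) =
        (∑ i ∈ Finset.range (N + 1), p ^ i * (z ^ (i + 1))⁻¹) * (force V z * (ytilde μ z)⁻¹) := by
      rw [Finset.sum_mul]
      exact Finset.sum_congr rfl fun i _ => by ring
    rw [h2, hgeom]
    ring
  rw [h1, contour_add hR'0 (continuousOn_finsetSum _ hterm) (continuousOn_const.fun_mul hc),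
    contour_const_mul, hrem, mul_zero, add_zero, contour_sum hR'0 _ hterm]
  refine Finset.sum_congr rfl fun i _ => ?_
  rw [contour_const_mul, contour_radius_eq (norm_nonneg μ) (hdiff i) (hR.trans hRR') hR]

end Radius

end

section

variable {n : ℕ}

/-! ### The derivatives of the branch points -/

/-- The numerator `φ_α^{(1)} + L_α φ^{(0)}` of `dμ_α/dV`. -/
def branchForm (μ : Fin (2 * n) → ℝ) (c r : Fin (n - 1) → ℝ) (α : Fin (2 * n)) (z : ℂ) : ℂ :=
  phi μ α 1 z + zeroModePoly (zeroModeCoeff μ c r) α z * phiZero μ z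

theorem contour_by_parts {R : ℝ} (hR : 0 ≤ R) {f g f' g' : ℂ → ℂ}
    (hf : ∀ z, ‖z‖ = R → HasDerivAt f (f' z) z) (hg : ∀ z, ‖z‖ = R → HasDerivAt g (g' z) z)
    (hf' : ContinuousOn f' (sphere 0 R)) (hg' : ContinuousOn g' (sphere 0 R)) :
    contour R (fun z => f z * g' z) = -contour R fun z => f' z * g z := by
  have hfc : ContinuousOn f (sphere (0 : ℂ) R) := fun z hz =>
    (hf z (by simpa using hz)).continuousAt.continuousWithinAt
  have hgc : ContinuousOn g (sphere (0 : ℂ) R) := fun z hz =>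
    (hg z (by simpa using hz)).continuousAt.continuousWithinAt
  have h := contour_deriv_eq_zero hR fun z hz => (hf z hz).fun_mul (hg z hz)
  rw [contour_add hR (hf'.fun_mul hgc) (hfc.fun_mul hg')] at h
  exact eq_neg_of_add_eq_zero_right h

theorem contour_sum_const_mul {ι : Type*} {R : ℝ} (hR : 0 ≤ R) (s : Finset ι) (a : ι → ℂ)
    {f : ι → ℂ → ℂ} (hf : ∀ i ∈ s, ContinuousOn (f i) (sphere 0 R)) :
    contour R (fun z => ∑ i ∈ s, a i * f i z) = ∑ i ∈ s, a i * contour R (f i) := by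
  rw [contour_sum hR s fun i hi => continuousOn_const.fun_mul (hf i hi)]
  exact Finset.sum_congr rfl fun i _ => contour_const_mul R (a i) (f i)

/-! ### The Laurent coefficients of φ_α^{(1)} + L_α φ^{(0)} and the equations they satisfy -/

section Fixed

variable {μ : Fin (2 * n) → ℝ} {c r : Fin (n - 1) → ℝ}

theorem differentiable_zeroModePoly (L : Fin (2 * n) → Fin (n - 1) → ℂ) (α : Fin (2 * n)) :
    Differentiable ℂ (zeroModePoly L α) := by
  unfold zeroModePoly
  fun_prop

variable (hμ : StrictMono μ)
include hμ

theorem analyticAt_phiZero {z : ℂ} (hz : z ∉ cuts μ) : AnalyticAt ℂ (phiZero μ) z :=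
  analyticAt_const.div (analyticAt_ytilde hμ hz) (ytilde_ne_zero hμ hz)

theorem analyticOnNhd_branchForm (α : Fin (2 * n)) :
    AnalyticOnNhd ℂ (branchForm μ c r α) (cuts μ)ᶜ := fun z hz =>
  (analyticAt_phi hμ hz α 1).fun_add
    (((differentiable_zeroModePoly _ α).analyticAt z).fun_mul (analyticAt_phiZero hμ hz))

theorem continuousOn_branchForm {s : Set ℂ} (hs : ∀ z ∈ s, z ∉ cuts μ) (α : Fin (2 * n)) :
    ContinuousOn (branchForm μ c r α) s := fun z hz =>
  (analyticOnNhd_branchForm hμ α z (hs z hz)).continuousAt.continuousWithinAt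

theorem isBigO_phi (α : Fin (2 * n)) (k : ℕ) :
    phi μ α k =O[cobounded ℂ] fun z => (z ^ (n + k))⁻¹ := by
  have h := ((isBigO_inv_sub (μ α : ℂ)).pow k).mul (isBigO_inv_ytilde hμ)
  refine (h.congr_left fun z => ?_).congr_right fun z => ?_
  · rw [phi, one_div, mul_inv, inv_pow]
  · rw [inv_pow, ← mul_inv, ← pow_add, add_comm]

theorem isBigO_pow_mul_phiZero {l : ℕ} (hl : l + 2 ≤ n) :
    (fun z => z ^ l * phiZero μ z) =O[cobounded ℂ] fun z => (z ^ 2)⁻¹ := by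
  have h := (Asymptotics.isBigO_refl (fun z : ℂ => z ^ l) (cobounded ℂ)).mul
    ((isBigO_inv_ytilde hμ).trans (isBigO_inv_pow_inv_pow hl))
  refine (h.congr' (Eventually.of_forall fun z => ?_) ?_)
  · simp [phiZero]
  · filter_upwards [(tendsto_norm_cobounded_atTop (E := ℂ)).eventually_gt_atTop 0] with z hz
    have : z ≠ 0 := norm_pos_iff.1 hz
    rw [pow_add]
    field_simp

theorem isBigO_branchForm (hn : 1 ≤ n) (α : Fin (2 * n)) :
    branchForm μ c r α =O[cobounded ℂ] fun z => (z ^ 2)⁻¹ := by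
  unfold branchForm
  refine ((isBigO_phi hμ α 1).trans (isBigO_inv_pow_inv_pow (by omega))).add ?_
  simp only [zeroModePoly, Finset.sum_mul, mul_assoc]
  exact Asymptotics.IsBigO.fun_sum fun l _ =>
    (isBigO_pow_mul_phiZero hμ (by omega)).const_mul_left _

/-- By the system for L_α, ∑ μ_α^k (φ_α^{(1)} + L_α φ^{(0)}) is -2 (z^k/ỹ)'; integrating by parts
against z^{j+1} cancels the factor j + 1. The outcome matches the t-derivatives of the asymptotic
conditions. -/
theorem sum_pow_mul_contour_branchForm (hE : ∀ j, Encircles μ (cycleCut j) (c j) (r j))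
    (hn : 1 ≤ n) {R : ℝ} (hR : ‖μ‖ < R) (j : ℕ) {k : ℕ} (hk : k ≤ n) :
    ∑ α, (μ α : ℂ) ^ k *
      (-(1 / (j + 1)) * contour R fun z => z ^ (j + 1) * branchForm μ c r α z) =
      -2 * contour R fun z => z ^ (j + k) * (ytilde μ z)⁻¹ := by
  have hR0 : 0 ≤ R := (norm_nonneg _).trans hR.le
  have hs := sphere_off_cuts hR
  have hj : (j + 1 : ℂ) ≠ 0 := by exact_mod_cast Nat.succ_ne_zero j
  have hcy := continuousOn_inv_ytilde hμ hs
  have hcX : ∀ α, ContinuousOn (fun z => z ^ (j + 1) * branchForm μ c r α z) (sphere (0 : ℂ) R) :=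
    fun α => ContinuousOn.mul (by fun_prop) (continuousOn_branchForm hμ hs α)
  have hparts := contour_by_parts (f := fun z => z ^ (j + 1)) (f' := fun z => (j + 1) * z ^ j) hR0
    (fun z _ => by simpa using hasDerivAt_pow (j + 1) z)
    (fun z hz => hasDerivAt_pow_div_ytilde hμ k (hs z (by simpa using hz))) (by fun_prop)
    (by
      have h := continuousOn_finsetSum Finset.univ fun α _ => continuousOn_inv_sub_branch hμ hs α
      simp only [← one_div] at h
      fun_prop)
  have h1 : ∑ α, (μ α : ℂ) ^ k *
      (-(1 / (j + 1)) * contour R fun z => z ^ (j + 1) * branchForm μ c r α z) =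
      -(1 / (j + 1)) * contour R fun z => -2 * (z ^ (j + 1) *
        (k * z ^ (k - 1) * (ytilde μ z)⁻¹ +
          z ^ k * (-(1 / 2) * (∑ α, 1 / (z - μ α)) * (ytilde μ z)⁻¹))) := by
    have h2 : ∀ z, ‖z‖ = R → -2 * (z ^ (j + 1) * (k * z ^ (k - 1) * (ytilde μ z)⁻¹ +
        z ^ k * (-(1 / 2) * (∑ α, 1 / (z - μ α)) * (ytilde μ z)⁻¹))) =
        ∑ α, (μ α : ℂ) ^ k * (z ^ (j + 1) * branchForm μ c r α z) := fun z hz => by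
      have h3 := pow_div_sub_branch_identity hμ (k := k) (hs z (by simpa using hz))
      have h4 := sum_pow_mul_zeroModeCoeff hμ hE hn hk z
      have h5 : ∑ α, (μ α : ℂ) ^ k * (z ^ (j + 1) * branchForm μ c r α z) =
          z ^ (j + 1) * ((∑ α, (μ α : ℂ) ^ k * phi μ α 1 z) +
            (∑ α, (μ α : ℂ) ^ k * zeroModePoly (zeroModeCoeff μ c r) α z) * (ytilde μ z)⁻¹) := by
        rw [Finset.sum_mul, ← Finset.sum_add_distrib, Finset.mul_sum]
        refine Finset.sum_congr rfl fun α _ => ?_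
        rw [branchForm, phiZero, one_div]
        ring
      rw [h5]
      linear_combination -z ^ (j + 1) * h3 - z ^ (j + 1) * (ytilde μ z)⁻¹ * h4
    rw [contour_congr hR0 h2, contour_sum_const_mul hR0 _ _ fun α _ => hcX α, Finset.mul_sum]
    exact Finset.sum_congr rfl fun α _ => by ring
  rw [h1, contour_const_mul, hparts]
  have h6 : contour R (fun z => (j + 1 : ℂ) * z ^ j * (z ^ k * (ytilde μ z)⁻¹)) =
      (j + 1) * contour R fun z => z ^ (j + k) * (ytilde μ z)⁻¹ := by
    rw [← contour_const_mul]
    exact contour_congr hR0 fun z _ => by ring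
  rw [h6]
  field_simp

/-- The counterpart for the occupation numbers: the L_α drop out against the K_{α,i}, the rest is an
exact differential, and integration by parts followed by exchanging the two circles leaves an
integral over the A-cycle. -/
theorem sum_contour_branchForm_mul_periodK (hE : ∀ j, Encircles μ (cycleCut j) (c j) (r j))
    (i : Fin (n - 1)) {R : ℝ} (hR : ‖μ‖ < R) (hRi : |c i| + r i < R) (j : ℕ) :
    ∑ α, (-(1 / (j + 1)) * contour R fun z => z ^ (j + 1) * branchForm μ c r α z) *
      periodK μ α (c i) (r i) =
      2 * ∮ w in C((c i : ℂ), r i), ytilde μ w *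
        contour R fun z => (z - w)⁻¹ * z ^ j * (ytilde μ z)⁻¹ := by
  have hR0 : 0 ≤ R := (norm_nonneg _).trans hR.le
  have hs := sphere_off_cuts hR
  have hj : (j + 1 : ℂ) ≠ 0 := by exact_mod_cast Nat.succ_ne_zero j
  have hri : 0 ≤ r i := (hE i).pos.le
  have hsi : ∀ w ∈ sphere (c i : ℂ) (r i), w ∉ cuts μ := fun w hw => (hE i).sphere_notMem_cuts hμ hw
  have hdisj : ∀ z ∈ sphere (0 : ℂ) R, ∀ w ∈ sphere (c i : ℂ) (r i), z ≠ w := fun z hz w hw h => by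
    rw [mem_sphere_zero_iff_norm] at hz
    rw [mem_sphere, dist_eq_norm] at hw
    have : ‖w‖ ≤ ‖w - c i‖ + ‖(c i : ℂ)‖ := by simpa using norm_add_le (w - c i) (c i : ℂ)
    rw [Complex.norm_real, Real.norm_eq_abs] at this
    rw [h] at hz
    linarith
  have hcp := fun α => continuousOn_phi hμ hs α 1
  have hcX : ∀ α, ContinuousOn (fun z => z ^ (j + 1) * branchForm μ c r α z) (sphere (0 : ℂ) R) :=
    fun α => ContinuousOn.mul (by fun_prop) (continuousOn_branchForm hμ hs α)
  have hparts := contour_by_parts (f := fun z => z ^ (j + 1)) (f' := fun z => (j + 1) * z ^ j) hR0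
    (fun z _ => by simpa using hasDerivAt_pow (j + 1) z)
    (fun z hz => (hE i).hasDerivAt_cauchyY_div hμ (hs z (by simpa using hz))
      fun h => hdisj z (by simpa using hz) z h rfl) (by fun_prop) (by fun_prop)
  have h1 : ∑ α, (-(1 / (j + 1)) * contour R fun z => z ^ (j + 1) * branchForm μ c r α z) *
      periodK μ α (c i) (r i) = -(1 / (j + 1)) * contour R fun z => 2 * (z ^ (j + 1) *
        (1 / 2 * ∑ α, periodK μ α (c i) (r i) * phi μ α 1 z)) := by
    have h2 : ∀ z, ‖z‖ = R → 2 * (z ^ (j + 1) *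
        (1 / 2 * ∑ α, periodK μ α (c i) (r i) * phi μ α 1 z)) =
        ∑ α, periodK μ α (c i) (r i) * (z ^ (j + 1) * branchForm μ c r α z) := fun z hz => by
      have h4 := sum_zeroModeCoeff_mul_periodK hμ hE i z
      have h5 : ∑ α, periodK μ α (c i) (r i) * (z ^ (j + 1) * branchForm μ c r α z) =
          z ^ (j + 1) * ((∑ α, periodK μ α (c i) (r i) * phi μ α 1 z) +
            (∑ α, zeroModePoly (zeroModeCoeff μ c r) α z * periodK μ α (c i) (r i)) *
              (ytilde μ z)⁻¹) := by
        rw [Finset.sum_mul, ← Finset.sum_add_distrib, Finset.mul_sum]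
        refine Finset.sum_congr rfl fun α _ => ?_
        rw [branchForm, phiZero, one_div]
        ring
      rw [h5, h4]
      ring
    rw [contour_congr hR0 h2, contour_sum_const_mul hR0 _ _ fun α _ => hcX α, Finset.mul_sum]
    exact Finset.sum_congr rfl fun α _ => by ring
  have hcy := continuousOn_inv_ytilde hμ hs
  have h6 : contour R (fun z => (j + 1 : ℂ) * z ^ j *
      (cauchyY μ (c i) (r i) z * (ytilde μ z)⁻¹)) =
      (j + 1) * ∮ w in C((c i : ℂ), r i), ytilde μ w *
        contour R fun z => (z - w)⁻¹ * z ^ j * (ytilde μ z)⁻¹ := by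
    have h7 : (∮ w in C((c i : ℂ), r i), ytilde μ w *
        contour R fun z => (z - w)⁻¹ * z ^ j * (ytilde μ z)⁻¹) = (2 * Real.pi * Complex.I)⁻¹ *
        ∮ w in C((c i : ℂ), r i), ∮ z in C(0, R),
          ytilde μ w * ((z - w)⁻¹ * z ^ j * (ytilde μ z)⁻¹) := by
      rw [← circleIntegral.integral_const_mul]
      refine circleIntegral.integral_congr hri fun w _ => ?_
      simp only [contour]
      rw [circleIntegral.integral_const_mul]
      ring
    rw [h7, circleIntegral_swap hri hR0]
    · unfold contour
      rw [mul_left_comm]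
      congr 1
      rw [← circleIntegral.integral_const_mul]
      refine circleIntegral.integral_congr hR0 fun z _ => ?_
      simp only [cauchyY]
      rw [mul_comm (∮ w in C((c i : ℂ), r i), ytilde μ w / (z - w)), ← mul_assoc,
        ← circleIntegral.integral_const_mul, ← circleIntegral.integral_const_mul]
      refine circleIntegral.integral_congr hri fun w _ => ?_
      simp only [div_eq_mul_inv]
      ring
    · have a1 : ContinuousOn (fun q : ℂ × ℂ => ytilde μ q.1)
          (sphere (c i : ℂ) (r i) ×ˢ sphere (0 : ℂ) R) :=
        (continuousOn_ytilde hμ hsi).comp continuousOn_fst fun q hq => hq.1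
      have a2 : ContinuousOn (fun q : ℂ × ℂ => (ytilde μ q.2)⁻¹)
          (sphere (c i : ℂ) (r i) ×ˢ sphere (0 : ℂ) R) :=
        hcy.comp continuousOn_snd fun q hq => hq.2
      have a3 : ContinuousOn (fun q : ℂ × ℂ => (q.2 - q.1)⁻¹)
          (sphere (c i : ℂ) (r i) ×ˢ sphere (0 : ℂ) R) :=
        ContinuousOn.fun_inv₀ (by fun_prop) fun q hq =>
          sub_ne_zero.2 (hdisj _ hq.2 _ hq.1)
      exact a1.mul ((a3.mul (by fun_prop)).mul a2)
  rw [h1, contour_const_mul, hparts, h6]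
  field_simp

end Fixed

end

/-! ### Differentiating the planar constraints determines the velocities of the branch points -/

section

variable {n : ℕ}

/-- The derivative of `μ_α` with respect to `t_{j+1}`. -/
def branchVelocity (μ : ℝ[X] → Fin (2 * n) → ℝ) (V : ℝ[X]) (j : ℕ) (α : Fin (2 * n)) : ℝ :=
  deriv (fun s : ℝ => μ (shift V j s) α) 0

namespace IsCutFamily

variable {U : Set ℝ[X]} {μ : ℝ[X] → Fin (2 * n) → ℝ} {c r : Fin (n - 1) → ℝ}
  (hU : IsCutFamily U μ c r) {V : ℝ[X]} (hV : V ∈ U)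
include hU hV

theorem hasDerivAt_curve (j : ℕ) :
    HasDerivAt (fun s : ℝ => μ (shift V j s)) (branchVelocity μ V j) 0 :=
  hasDerivAt_pi.2 fun α => (hU.differentiable V hV j α).hasDerivAt

theorem eventually_strictMono (j : ℕ) : ∀ᶠ s in 𝓝 (0 : ℝ), StrictMono (μ (shift V j s)) :=
  (hU.isOpen V hV j).mono fun _ => hU.strictMono _

theorem eventually_norm_lt (j : ℕ) {R : ℝ} (hR : ‖μ V‖ < R) :
    ∀ᶠ s in 𝓝 (0 : ℝ), ‖μ (shift V j s)‖ < R := by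
  refine (hU.hasDerivAt_curve hV j).continuousAt.norm.eventually_lt continuousAt_const ?_
  rwa [shift_zero]

theorem contour_pow_force {R : ℝ} (hR : ‖μ V‖ < R) {k : ℕ} (hk : k ≤ n) :
    contour R (fun z => z ^ k * force V z * (ytilde (μ V) z)⁻¹) = if k = n then 2 else 0 := by
  have hμ := hU.strictMono V hV
  have h := hU.asymptotic V hV k hk
  simp only [div_eq_mul_inv (_ * _)] at h
  rw [contour_radius_eq (norm_nonneg (μ V)) (fun z hz => DifferentiableAt.fun_mul
    (DifferentiableAt.fun_mul (by fun_prop) (differentiable_force V z))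
    (differentiableAt_inv_ytilde hμ (notMem_cuts_of_lt hz))) (lt_add_one _) hR] at h
  split_ifs at h ⊢ <;> linear_combination 2 * h

/-- Each factor z is written as (z - μ_β) + μ_β. The first part gives an asymptotic integral of
order below n, which is zero. -/
theorem contour_pow_phi {R : ℝ} (hR : ‖μ V‖ < R) {k : ℕ} (hk : k ≤ n) (β : Fin (2 * n)) :
    contour R (fun z => z ^ k * force V z * phi (μ V) β 1 z) =
      (μ V β : ℂ) ^ k * moment (μ V) V β 1 := by
  have hμ := hU.strictMono V hV
  have hR0 : 0 ≤ R := (norm_nonneg _).trans hR.le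
  have hs := sphere_off_cuts hR
  have hc := (continuous_force V).continuousOn (s := sphere (0 : ℂ) R)
  induction k with
  | zero => simp [moment_eq_contour hμ hR]
  | succ k ih =>
    have hfk : ContinuousOn (fun z => z ^ k * force V z) (sphere (0 : ℂ) R) := by fun_prop
    have h1 : contour R (fun z => z ^ (k + 1) * force V z * phi (μ V) β 1 z) =
        contour R fun z => z ^ k * force V z * (ytilde (μ V) z)⁻¹ +
          μ V β * (z ^ k * force V z * phi (μ V) β 1 z) := by
      refine contour_congr hR0 fun z hz => ?_
      have := sub_branch_ne_zero hμ (hs z (by simpa using hz)) β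
      rw [phi_succ, phi_zero]
      field_simp
      ring
    rw [h1, contour_add hR0 (hfk.fun_mul (continuousOn_inv_ytilde hμ hs))
      (continuousOn_const.fun_mul (hfk.fun_mul (continuousOn_phi hμ hs β 1))),
      contour_const_mul, hU.contour_pow_force hV hR (by omega), ih (by omega), if_neg (by omega)]
    ring

theorem hasDerivAt_contour_inv_ytilde (hn : 1 ≤ n) {R : ℝ} (hR : ‖μ V‖ < R) {q : ℂ → ℂ}
    (hq : ∀ z, ‖z‖ = R → ContDiffAt ℂ 1 q z) (j : ℕ) :
    HasDerivAt (fun s => contour R fun z => q z * force (shift V j s) z *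
        (ytilde (μ (shift V j s)) z)⁻¹)
      (contour R (fun z => q z * z ^ j * (ytilde (μ V) z)⁻¹) +
        1 / 2 * (∑ β, branchVelocity μ V j β *
          contour R fun z => q z * force V z * phi (μ V) β 1 z)) 0 := by
  -- With exponent 0 the choice of branch point is immaterial: φ_α^{(0)} is 1/ỹ for every α.
  have h := hasDerivAt_contour_phi (R := R) (hU.hasDerivAt_curve hV j) (hU.eventually_strictMono hV j)
    (by rwa [shift_zero]) hq V j ⟨0, by omega⟩ 0
  simp only [shift_zero, phi_zero] at h
  refine h.congr_deriv ?_
  simp [phi_succ, phi_zero]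

/-- The asymptotic integrals are constant on U. Their derivative splits into the explicit z^j from
V' and the motion of the branch points. -/
theorem sum_pow_mul_velocity (hn : 1 ≤ n) {R : ℝ} (hR : ‖μ V‖ < R) (j : ℕ) {k : ℕ} (hk : k ≤ n) :
    ∑ α, (μ V α : ℂ) ^ k * (moment (μ V) V α 1 * branchVelocity μ V j α) =
      -2 * contour R fun z => z ^ (j + k) * (ytilde (μ V) z)⁻¹ := by
  have h := hU.hasDerivAt_contour_inv_ytilde hV hn hR (q := fun z => z ^ k)
    (fun z _ => by fun_prop) j
  have h0 : HasDerivAt (fun s => contour R fun z => z ^ k * force (shift V j s) z *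
      (ytilde (μ (shift V j s)) z)⁻¹) 0 0 := by
    refine (hasDerivAt_const (0 : ℝ) (if k = n then (2 : ℂ) else 0)).congr_of_eventuallyEq ?_
    filter_upwards [hU.isOpen V hV j, hU.eventually_norm_lt hV j hR] with s hs hs'
    exact hU.contour_pow_force hs hs' hk
  have h1 := h.unique h0
  simp only [hU.contour_pow_phi hV hR hk] at h1
  have h2 : contour R (fun z => z ^ (j + k) * (ytilde (μ V) z)⁻¹) =
      contour R (fun z => z ^ k * z ^ j * (ytilde (μ V) z)⁻¹) := by
    congr 1
    ext z
    ring
  have h3 : ∑ α, (μ V α : ℂ) ^ k * (moment (μ V) V α 1 * branchVelocity μ V j α) =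
      ∑ α, branchVelocity μ V j α * ((μ V α : ℂ) ^ k * moment (μ V) V α 1) :=
    Finset.sum_congr rfl fun α _ => by ring
  rw [h2, h3]
  linear_combination 2 * h1

theorem hasDerivAt_bigM (hn : 1 ≤ n) {p : ℂ} (hp : p ∉ cuts (μ V)) {R : ℝ} (hR : ‖μ V‖ < R)
    (hpR : ‖p‖ < R) (j : ℕ) :
    HasDerivAt (fun s => bigM (μ (shift V j s)) (shift V j s) p)
      (contour R (fun z => (z - p)⁻¹ * z ^ j * (ytilde (μ V) z)⁻¹) +
        1 / 2 * (∑ β, branchVelocity μ V j β *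
          ((bigM (μ V) V p - moment (μ V) V β 1) / (p - μ V β)))) 0 := by
  have hμ := hU.strictMono V hV
  have hR0 : 0 ≤ R := (norm_nonneg _).trans hR.le
  have hs := sphere_off_cuts hR
  have hne : ∀ z : ℂ, ‖z‖ = R → z - p ≠ 0 := fun z hz h => by
    rw [sub_eq_zero.1 h] at hz
    exact hpR.ne hz
  have h := hU.hasDerivAt_contour_inv_ytilde hV hn hR (q := fun z => (z - p)⁻¹)
    (fun z hz => ContDiffAt.fun_inv (by fun_prop) (hne z hz)) j
  refine (h.congr_of_eventuallyEq ?_).congr_deriv ?_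
  · filter_upwards [hU.eventually_strictMono hV j, hU.eventually_norm_lt hV j hR] with s hs hs'
    exact bigM_eq_contour hs hs' hpR
  · congr 2
    refine Finset.sum_congr rfl fun β _ => ?_
    congr 1
    have hpb := sub_branch_ne_zero hμ hp β
    rw [eq_div_iff hpb, bigM_eq_contour hμ hR hpR, moment_eq_contour hμ hR, mul_comm,
      ← contour_const_mul]
    have hinv : ContinuousOn (fun z : ℂ => (z - p)⁻¹) (sphere 0 R) :=
      ContinuousOn.fun_inv₀ (by fun_prop) fun z hz => hne z (by simpa using hz)
    have hf := (continuous_force V).continuousOn (s := sphere (0 : ℂ) R)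
    rw [← contour_sub hR0 ((hinv.fun_mul hf).fun_mul (continuousOn_inv_ytilde hμ hs))
      (hf.fun_mul (continuousOn_phi hμ hs β 1))]
    refine contour_congr hR0 fun z hz => ?_
    have h1 := hne z hz
    have h2 := sub_branch_ne_zero hμ (hs z (by simpa using hz)) β
    rw [phi_succ, phi_zero]
    field_simp
    ring

/-- The terms proportional to M(p) from the variations of M and of ỹ cancel, so only the M_β^{(1)}
times the velocities remain. -/
theorem hasDerivAt_bigY (hn : 1 ≤ n) {p : ℂ} (hp : p ∉ cuts (μ V)) {R : ℝ} (hR : ‖μ V‖ < R)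
    (hpR : ‖p‖ < R) (j : ℕ) :
    HasDerivAt (fun s => bigY (μ (shift V j s)) (shift V j s) p)
      (ytilde (μ V) p * contour R (fun z => (z - p)⁻¹ * z ^ j * (ytilde (μ V) z)⁻¹) -
        1 / 2 * (∑ β, (moment (μ V) V β 1 * branchVelocity μ V j β) *
          (ytilde (μ V) p / (p - μ V β)))) 0 := by
  have hμ := hU.strictMono V hV
  have h1 := hU.hasDerivAt_bigM hV hn hp hR hpR j
  have h2 := hasDerivAt_ytilde_comp (hU.hasDerivAt_curve hV j) (hU.eventually_strictMono hV j)
    (z := p) (by rwa [shift_zero])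
  simp only [shift_zero] at h2
  have h3 := h1.fun_mul h2
  simp only [shift_zero] at h3
  refine h3.congr_deriv ?_
  have h4 : ∑ β, (branchVelocity μ V j β : ℂ) *
      ((bigM (μ V) V p - moment (μ V) V β 1) / (p - μ V β)) * ytilde (μ V) p =
      bigM (μ V) V p * ((∑ β, branchVelocity μ V j β / (p - μ V β)) * ytilde (μ V) p) -
      ∑ β, (moment (μ V) V β 1 * branchVelocity μ V j β) * (ytilde (μ V) p / (p - μ V β)) := by
    rw [Finset.sum_mul, Finset.mul_sum, ← Finset.sum_sub_distrib]
    exact Finset.sum_congr rfl fun β _ => by ring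
  rw [← Finset.sum_mul] at h4
  linear_combination (1 / 2) * h4

/-- Since M(p) is a polynomial in p of bounded degree, the period of y is a finite sum of
coefficients depending on s times periods of p^k ỹ. Both factors can be differentiated, and the
pointwise variation of y then identifies the result. -/
theorem hasDerivAt_circleIntegral_bigY (hn : 1 ≤ n) (i : Fin (n - 1)) {R : ℝ} (hR : ‖μ V‖ < R)
    (hRi : |c i| + r i < R) (j : ℕ) :
    HasDerivAt (fun s => ∮ p in C((c i : ℂ), r i), bigY (μ (shift V j s)) (shift V j s) p)
      (∮ p in C((c i : ℂ), r i), (ytilde (μ V) p *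
        contour R (fun z => (z - p)⁻¹ * z ^ j * (ytilde (μ V) z)⁻¹) -
        1 / 2 * (∑ β, (moment (μ V) V β 1 * branchVelocity μ V j β) *
          (ytilde (μ V) p / (p - μ V β))))) 0 := by
  have hμ := hU.strictMono V hV
  have hR0 : 0 < R := (norm_nonneg _).trans_lt hR
  have hE := hU.encircles hV i
  have hri := hE.pos.le
  have hsi : ∀ w ∈ sphere (c i : ℂ) (r i), w ∉ cuts (μ V) := fun w hw => hE.sphere_notMem_cuts hμ hw
  have hpR : ∀ w ∈ sphere (c i : ℂ) (r i), ‖w‖ < R := fun w hw => by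
    rw [mem_sphere, dist_eq_norm] at hw
    have : ‖w‖ ≤ ‖w - c i‖ + ‖(c i : ℂ)‖ := by simpa using norm_add_le (w - c i) (c i : ℂ)
    rw [Complex.norm_real, Real.norm_eq_abs] at this
    linarith
  set N := (Polynomial.derivative V).natDegree + j
  set C : ℕ → ℝ → ℂ := fun k s => contour R fun z => (z ^ (k + 1))⁻¹ * force (shift V j s) z *
    (ytilde (μ (shift V j s)) z)⁻¹ with hC
  have hCd : ∀ k, ∃ C', HasDerivAt (C k) C' 0 := fun k =>
    ⟨_, hU.hasDerivAt_contour_inv_ytilde hV hn hR (q := fun z => (z ^ (k + 1))⁻¹)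
      (fun z hz => ContDiffAt.fun_inv (by fun_prop) (pow_ne_zero _ (by
        rw [← norm_pos_iff, hz]; exact hR0))) j⟩
  choose C' hC' using hCd
  set Y' : ℂ → ℂ := fun p =>
    -(1 / 2) * (∑ β, branchVelocity μ V j β / (p - μ V β)) * ytilde (μ V) p with hY'
  have hyd : ∀ p ∉ cuts (μ V), HasDerivAt (fun s => ytilde (μ (shift V j s)) p) (Y' p) 0 :=
    fun p hp => by
    have := hasDerivAt_ytilde_comp (hU.hasDerivAt_curve hV j) (hU.eventually_strictMono hV j)
      (z := p) (by rwa [shift_zero])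
    simpa only [shift_zero] using this
  have hexp : ∀ᶠ s in 𝓝 (0 : ℝ), ∀ p, bigY (μ (shift V j s)) (shift V j s) p =
      ∑ k ∈ Finset.range (N + 1), C k s * (p ^ k * ytilde (μ (shift V j s)) p) := by
    filter_upwards [hU.eventually_strictMono hV j, hU.eventually_norm_lt hV j hR] with s hs hs' p
    rw [bigY, bigM_eq_sum hs (isBigO_force_shift V j s) hs', Finset.sum_mul]
    exact Finset.sum_congr rfl fun k _ => by ring
  have hpt : ∀ p ∈ sphere (c i : ℂ) (r i), (ytilde (μ V) p *
      contour R (fun z => (z - p)⁻¹ * z ^ j * (ytilde (μ V) z)⁻¹) -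
      1 / 2 * (∑ β, (moment (μ V) V β 1 * branchVelocity μ V j β) *
          (ytilde (μ V) p / (p - μ V β)))) =
      ∑ k ∈ Finset.range (N + 1), (C' k * (p ^ k * ytilde (μ V) p) + C k 0 * (p ^ k * Y' p)) :=
    fun p hp => by
    refine (hU.hasDerivAt_bigY hV hn (hsi p hp) hR (hpR p hp) j).unique ?_
    have h1 : HasDerivAt (fun s => ∑ k ∈ Finset.range (N + 1),
        C k s * (p ^ k * ytilde (μ (shift V j s)) p)) (∑ k ∈ Finset.range (N + 1),
        (C' k * (p ^ k * ytilde (μ V) p) + C k 0 * (p ^ k * Y' p))) 0 := by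
      refine HasDerivAt.fun_sum fun k _ => ?_
      have := (hC' k).fun_mul ((hyd p (hsi p hp)).const_mul (p ^ k))
      simpa only [shift_zero] using this
    exact h1.congr_of_eventuallyEq (hexp.mono fun s hs => hs p)
  have hcy := continuousOn_ytilde hμ hsi
  have hcY' : ContinuousOn Y' (sphere (c i : ℂ) (r i)) := by
    have h := continuousOn_finsetSum Finset.univ fun β _ =>
      (continuousOn_const (c := (branchVelocity μ V j β : ℂ))).fun_mul
        (continuousOn_inv_sub_branch hμ hsi β)
    simp only [← div_eq_mul_inv] at h
    exact (continuousOn_const.fun_mul h).fun_mul hcy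
  have t1 : ∀ k, ContinuousOn (fun p => p ^ k * ytilde (μ V) p) (sphere (c i : ℂ) (r i)) :=
    fun k => ContinuousOn.mul (by fun_prop) hcy
  have t2 : ∀ k, ContinuousOn (fun p => p ^ k * Y' p) (sphere (c i : ℂ) (r i)) :=
    fun k => ContinuousOn.mul (by fun_prop) hcY'
  have hDd : ∀ k, HasDerivAt (fun s => ∮ p in C((c i : ℂ), r i), p ^ k * ytilde (μ (shift V j s)) p)
      (∮ p in C((c i : ℂ), r i), p ^ k * Y' p) 0 := fun k => by
    refine hasDerivAt_circleIntegral_comp (𝕜 := ℝ)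
      (f := fun (m : Fin (2 * n) → ℝ) p => p ^ k * ytilde m p) hri (hU.hasDerivAt_curve hV j)
      (fun z hz => ?_) _ fun z hz => (hyd z (hsi z hz)).const_mul _
    rw [shift_zero]
    exact ContDiffAt.mul (contDiffAt_snd.pow k) (contDiffAt_ytilde hμ (hsi z hz))
  have hmain : HasDerivAt (fun s => ∑ k ∈ Finset.range (N + 1),
      C k s * ∮ p in C((c i : ℂ), r i), p ^ k * ytilde (μ (shift V j s)) p)
      (∑ k ∈ Finset.range (N + 1), ((C' k * ∮ p in C((c i : ℂ), r i), p ^ k * ytilde (μ V) p) +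
        C k 0 * ∮ p in C((c i : ℂ), r i), p ^ k * Y' p)) 0 := by
    refine HasDerivAt.fun_sum fun k _ => ?_
    simpa only [shift_zero] using (hC' k).fun_mul (hDd k)
  refine (hmain.congr_of_eventuallyEq ?_).congr_deriv ?_
  · filter_upwards [hexp, hU.isOpen V hV j] with s hs hsU
    have hc : ∀ k, ContinuousOn (fun p => C k s * (p ^ k * ytilde (μ (shift V j s)) p))
        (sphere (c i : ℂ) (r i)) := fun k => continuousOn_const.fun_mul (ContinuousOn.mul (by fun_prop)
      (continuousOn_ytilde (hU.strictMono _ hsU) fun w hw =>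
        (hU.encircles hsU i).sphere_notMem_cuts (hU.strictMono _ hsU) hw))
    simp only [hs]
    rw [circleIntegral.integral_fun_sum fun k _ => (hc k).circleIntegrable hri]
    exact Finset.sum_congr rfl fun k _ => circleIntegral.integral_const_mul _ _ _ _
  · rw [circleIntegral.integral_congr hri hpt, circleIntegral.integral_fun_sum fun k _ =>
      ((continuousOn_const.fun_mul (t1 k)).fun_add
        (continuousOn_const.fun_mul (t2 k))).circleIntegrable hri]
    refine Finset.sum_congr rfl fun k _ => ?_
    rw [circleIntegral.integral_add ((continuousOn_const.fun_mul (t1 k)).circleIntegrable hri)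
        ((continuousOn_const.fun_mul (t2 k)).circleIntegrable hri),
      circleIntegral.integral_const_mul, circleIntegral.integral_const_mul]

/-- Fixed occupation numbers mean that the A-period of the variation of y is zero; its two terms are
the two sides. -/
theorem sum_velocity_mul_periodK (hn : 1 ≤ n) (i : Fin (n - 1)) {R : ℝ} (hR : ‖μ V‖ < R)
    (hRi : |c i| + r i < R) (j : ℕ) :
    ∑ α, (moment (μ V) V α 1 * branchVelocity μ V j α) * periodK (μ V) α (c i) (r i) =
      2 * ∮ w in C((c i : ℂ), r i), ytilde (μ V) w *
        contour R fun z => (z - w)⁻¹ * z ^ j * (ytilde (μ V) z)⁻¹ := by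
  have hμ := hU.strictMono V hV
  have hR0 : 0 < R := (norm_nonneg _).trans_lt hR
  have hE := hU.encircles hV i
  have hri := hE.pos.le
  have hsi : ∀ w ∈ sphere (c i : ℂ) (r i), w ∉ cuts (μ V) := fun w hw => hE.sphere_notMem_cuts hμ hw
  have hs := sphere_off_cuts hR
  have h1 := hU.hasDerivAt_circleIntegral_bigY hV hn i hR hRi j
  have h2 : HasDerivAt (fun s => ∮ p in C((c i : ℂ), r i),
      bigY (μ (shift V j s)) (shift V j s) p) 0 0 := by
    have h3 := (hU.occupation_fixed V hV i j).const_mul (4 * Real.pi * Complex.I)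
    simp only [occupation, ← mul_assoc] at h3
    have h4 : (4 * Real.pi * Complex.I : ℂ) ≠ 0 := by simp [Real.pi_ne_zero]
    simpa only [mul_inv_cancel₀ h4, one_mul, mul_zero] using h3
  have h5 := h1.unique h2
  have hcy := continuousOn_ytilde hμ hsi
  have ht : ∀ β, ContinuousOn (fun p => ytilde (μ V) p / (p - μ V β)) (sphere (c i : ℂ) (r i)) :=
    fun β => by
      simp only [div_eq_mul_inv]
      exact hcy.fun_mul (continuousOn_inv_sub_branch hμ hsi β)
  have hsum : ContinuousOn (fun p => 1 / 2 * ∑ β, (moment (μ V) V β 1 * branchVelocity μ V j β) *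
      (ytilde (μ V) p / (p - μ V β))) (sphere (c i : ℂ) (r i)) :=
    continuousOn_const.fun_mul (continuousOn_finsetSum _ fun β _ =>
      continuousOn_const.fun_mul (ht β))
  have hT : ContinuousOn (fun w => contour R fun z => (z - w)⁻¹ * z ^ j * (ytilde (μ V) z)⁻¹)
      (sphere (c i : ℂ) (r i)) := by
    intro w hw
    have hwR : ‖w‖ < R := by
      rw [mem_sphere, dist_eq_norm] at hw
      have : ‖w‖ ≤ ‖w - c i‖ + ‖(c i : ℂ)‖ := by simpa using norm_add_le (w - c i) (c i : ℂ)
      rw [Complex.norm_real, Real.norm_eq_abs] at this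
      linarith
    have : HasFDerivAt (𝕜 := ℂ) _ _ _ := hasFDerivAt_circleIntegral (𝕜 := ℂ) (c := 0) (R := R)
      (f := fun w z => (z - w)⁻¹ * z ^ j * (ytilde (μ V) z)⁻¹) (x₀ := w) fun z hz => by
        rw [abs_of_pos hR0] at hz
        have hz' : z - w ≠ 0 := fun h => by
          rw [mem_sphere_zero_iff_norm, sub_eq_zero.1 h] at hz
          exact hwR.ne hz
        refine ContDiffAt.mul (ContDiffAt.mul (ContDiffAt.fun_inv (by fun_prop) hz') (by fun_prop)) ?_
        exact (((analyticAt_ytilde hμ (hs z hz)).inv (ytilde_ne_zero hμ (hs z hz))).contDiffAt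
          (n := 1)).comp (f := Prod.snd) (w, z) contDiffAt_snd
    exact (continuousAt_const.mul this.continuousAt).continuousWithinAt
  rw [circleIntegral.integral_sub ((hcy.fun_mul hT).circleIntegrable hri)
    (hsum.circleIntegrable hri), circleIntegral.integral_const_mul,
    circleIntegral.integral_fun_sum fun β _ =>
      (continuousOn_const.fun_mul (ht β)).circleIntegrable hri] at h5
  simp only [circleIntegral.integral_const_mul] at h5
  rw [sub_eq_zero] at h5
  rw [h5]
  simp only [periodK]
  ring

/-- The partial derivatives of the branch points are the Laurent coefficients of
`φ_α^{(1)} + L_α φ^{(0)}`. -/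
theorem moment_mul_velocity (hn : 1 ≤ n) {R : ℝ} (hR : ‖μ V‖ < R) (j : ℕ) (α : Fin (2 * n)) :
    moment (μ V) V α 1 * branchVelocity μ V j α =
      -(1 / (j + 1)) * contour R fun z => z ^ (j + 1) * branchForm (μ V) c r α z := by
  have hμ := hU.strictMono V hV
  have hE := hU.encircles hV
  -- The Laurent coefficients do not depend on the radius; the circle is enlarged so that it also
  -- surrounds every A-cycle, as the period equations require.
  obtain ⟨R', hR', hRi⟩ : ∃ R', ‖μ V‖ < R' ∧ ∀ i, |c i| + r i < R' := by
    have h : ∀ᶠ R' in atTop, ‖μ V‖ < R' ∧ ∀ i, |c i| + r i < R' :=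
      (eventually_gt_atTop _).and (eventually_all.2 fun i => eventually_gt_atTop _)
    exact h.exists
  rw [contour_radius_eq (norm_nonneg (μ V)) (fun z hz => DifferentiableAt.fun_mul (by fun_prop)
    (analyticOnNhd_branchForm hμ α z (notMem_cuts_of_lt hz)).differentiableAt) hR hR']
  rw [← sub_eq_zero]
  refine congrFun (eq_zero_of_moments_of_periodK hμ hE (x := fun α =>
    moment (μ V) V α 1 * branchVelocity μ V j α -
      -(1 / (j + 1)) * contour R' fun z => z ^ (j + 1) * branchForm (μ V) c r α z)
    (fun k hk => ?_) fun i => ?_) α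
  · simp only [mul_sub, Finset.sum_sub_distrib]
    rw [hU.sum_pow_mul_velocity hV hn hR' j hk, sum_pow_mul_contour_branchForm hμ hE hn hR' j hk,
      sub_self]
  · simp only [sub_mul, Finset.sum_sub_distrib]
    rw [hU.sum_velocity_mul_periodK hV hn i hR' (hRi i) j,
      sum_contour_branchForm_mul_periodK hμ hE i hR' (hRi i) j, sub_self]

/-- The loop insertion of the branch points. -/
theorem isLoopInsertion_fMu (hn : 1 ≤ n) (α : Fin (2 * n)) :
    IsLoopInsertion μ (fMu μ α) V fun p => branchForm (μ V) c r α p / moment (μ V) V α 1 := by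
  have hμ := hU.strictMono V hV
  have hM := hU.nonsingular V hV α
  refine ⟨fun p hp => (analyticOnNhd_branchForm hμ α p hp).div analyticAt_const hM, fun p hp => ?_⟩
  have hd : ∀ j, HasDerivAt (fun s => fMu μ α (shift V j s)) (branchVelocity μ V j α : ℂ) 0 :=
    fun j => (hasDerivAt_pi.1 (hU.hasDerivAt_curve hV j) α).ofReal_comp
  refine ⟨fun j => (hd j).differentiableAt, ?_⟩
  have hs := hasSum_laurent (norm_nonneg (μ V)) (fun z hz =>
    (analyticOnNhd_branchForm hμ α z (notMem_cuts_of_lt hz)).differentiableAt) (lt_add_one _) hp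
    (isBigO_branchForm (c := c) (r := r) hμ hn α)
  refine (hs.div_const (moment (μ V) V α 1)).congr_fun fun j => ?_
  rw [(hd j).deriv, ← hU.moment_mul_velocity hV hn (lt_add_one _)]
  field_simp

end IsCutFamily

end

section

variable {n : ℕ}

/-! ### The derivatives of the moments and of the logarithms -/

theorem hasLoopInsertionAt_add_sum {ι : Type*} {s : Finset ι} {G : ℝ[X] → ℂ} {g : ι → ℝ[X] → ℂ}
    {V : ℝ[X]} {a w : ι → ℂ} {p w₀ : ℂ} {e : ℕ → ℂ}
    (h : ∀ i ∈ s, HasLoopInsertionAt (g i) V p (w i))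
    (he : HasSum (fun j : ℕ => -((j + 1 : ℂ) / p ^ (j + 2)) * e j) w₀)
    (hG : ∀ j : ℕ, HasDerivAt (fun t : ℝ => G (shift V j t))
      (e j + ∑ i ∈ s, a i * deriv (fun t : ℝ => g i (shift V j t)) 0) 0) :
    HasLoopInsertionAt G V p (w₀ + ∑ i ∈ s, a i * w i) := by
  refine ⟨fun j => (hG j).differentiableAt, ?_⟩
  refine (he.add (hasSum_sum fun i hi => ((h i hi).2.mul_left (a i)))).congr_fun fun j => ?_
  rw [(hG j).deriv, mul_add, Finset.mul_sum]
  congr 1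
  exact Finset.sum_congr rfl fun i _ => by ring

theorem isLoopInsertion_sum {ι : Type*} {s : Finset ι} {μ : ℝ[X] → Fin (2 * n) → ℝ} {G : ℝ[X] → ℂ}
    {g : ι → ℝ[X] → ℂ} {V : ℝ[X]} {a : ι → ℂ} {f : ι → ℂ → ℂ}
    (h : ∀ i ∈ s, IsLoopInsertion μ (g i) V (f i))
    (hG : ∀ j : ℕ, HasDerivAt (fun t : ℝ => G (shift V j t))
      (∑ i ∈ s, a i * deriv (fun t : ℝ => g i (shift V j t)) 0) 0) :
    IsLoopInsertion μ G V fun p => ∑ i ∈ s, a i * f i p :=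
  ⟨fun p hp => s.analyticAt_fun_sum fun i hi => analyticAt_const.mul ((h i hi).1 p hp),
    fun p hp => hasLoopInsertionAt_sum (fun i hi => (h i hi).2 p hp) hG⟩

theorem IsLoopInsertion.const_mul {μ : ℝ[X] → Fin (2 * n) → ℝ} {G g : ℝ[X] → ℂ} {V : ℝ[X]} {a : ℂ}
    {f : ℂ → ℂ} (h : IsLoopInsertion μ g V f)
    (hG : ∀ j : ℕ, HasDerivAt (fun t : ℝ => G (shift V j t))
      (a * deriv (fun t : ℝ => g (shift V j t)) 0) 0) :
    IsLoopInsertion μ G V fun p => a * f p := by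
  simpa using isLoopInsertion_sum (s := Finset.univ (α := Unit)) (a := fun _ => a)
    (fun _ _ => h) (by simpa using hG)

theorem IsLoopInsertion.sub {μ : ℝ[X] → Fin (2 * n) → ℝ} {g₁ g₂ : ℝ[X] → ℂ} {V : ℝ[X]}
    {f₁ f₂ : ℂ → ℂ} (h₁ : IsLoopInsertion μ g₁ V f₁) (h₂ : IsLoopInsertion μ g₂ V f₂)
    (hd₁ : ∀ j : ℕ, DifferentiableAt ℝ (fun t : ℝ => g₁ (shift V j t)) 0)
    (hd₂ : ∀ j : ℕ, DifferentiableAt ℝ (fun t : ℝ => g₂ (shift V j t)) 0) :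
    IsLoopInsertion μ (fun V' => g₁ V' - g₂ V') V fun p => f₁ p - f₂ p := by
  have h := isLoopInsertion_sum (s := Finset.univ (α := Bool)) (a := fun b => bif b then 1 else -1)
    (g := fun b => bif b then g₁ else g₂) (f := fun b => bif b then f₁ else f₂) (μ := μ) (V := V)
    (G := fun V' => g₁ V' - g₂ V') (by rintro (_ | _) _ <;> assumption)
    (fun j => by simpa [sub_eq_add_neg] using (hd₁ j).hasDerivAt.fun_sub (hd₂ j).hasDerivAt)
  simpa [sub_eq_add_neg] using h

/-- When f(s)/f(0) is real, log|f| has the logarithmic derivative of f itself. Reality is asked of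
the quotient only, because the period determinant may be purely imaginary. -/
theorem hasDerivAt_log_norm {f : ℝ → ℂ} {D : ℂ} (hf : HasDerivAt f D 0) (h0 : f 0 ≠ 0)
    (hreal : ∀ᶠ s in 𝓝 0, star (f s / f 0) = f s / f 0) :
    HasDerivAt (fun s => (Real.log ‖f s‖ : ℂ)) (D / f 0) 0 := by
  have h1 : HasDerivAt (fun s => f s / f 0) (D / f 0) 0 := hf.div_const _
  have h2 : HasDerivAt (fun s => (f s / f 0).re) (D / f 0).re 0 :=
    Complex.reCLM.hasFDerivAt.comp_hasDerivAt 0 h1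
  have h3 : D / f 0 = ((D / f 0).re : ℂ) := by
    refine h1.unique (h2.ofReal_comp.congr_of_eventuallyEq ?_)
    filter_upwards [hreal] with s hs
    exact (Complex.conj_eq_iff_re.1 hs).symm
  have h4 : HasDerivAt (fun s => Real.log (f s / f 0).re + Real.log ‖f 0‖) (D / f 0).re 0 := by
    have := (h2.log (by simp [div_self h0])).add_const (Real.log ‖f 0‖)
    simpa [div_self h0] using this
  rw [h3]
  refine HasDerivAt.ofReal_comp (h4.congr_of_eventuallyEq ?_)
  have hne : ∀ᶠ s in 𝓝 0, f s ≠ 0 := hf.continuousAt.eventually_ne h0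
  filter_upwards [hreal, hne] with s hs hs'
  have h5 : ‖f s / f 0‖ = |(f s / f 0).re| := by
    conv_lhs => rw [← Complex.conj_eq_iff_re.1 hs]
    rw [Complex.norm_real, Real.norm_eq_abs]
  have h6 : ‖f s / f 0‖ ≠ 0 := by
    rw [norm_ne_zero_iff]
    exact div_ne_zero hs' h0
  rw [← Real.log_abs (f s / f 0).re, ← h5, ← Real.log_mul h6 (norm_ne_zero_iff.2 h0), norm_div,
    div_mul_cancel₀ _ (norm_ne_zero_iff.2 h0)]

/-! ### Derivatives and decay of the φ_α^{(k)} -/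

section Fixed

variable {μ : Fin (2 * n) → ℝ}

theorem force_star (V : ℝ[X]) (z : ℂ) : force V (star z) = star (force V z) := by
  rw [force, force, ← starRingEnd_apply, ← starRingEnd_apply]
  exact Polynomial.aeval_conj _ _

/-- The mixed moments `∮_{C_D} V'(ω) φ_α^{(k)}(ω) / (ω - μ_β) dω / (2 π i)`. -/
def mixedMoment (μ : Fin (2 * n) → ℝ) (V : ℝ[X]) (α β : Fin (2 * n)) (k : ℕ) : ℂ :=
  contour (‖μ‖ + 1) fun z => force V z * (phi μ α k z / (z - μ β))

variable (hμ : StrictMono μ)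
include hμ

theorem star_moment (V : ℝ[X]) (α : Fin (2 * n)) (k : ℕ) :
    star (moment μ V α k) = moment μ V α k := by
  refine star_contour (by positivity) fun z hz => ?_
  rw [force_star, phi_star hμ (notMem_cuts_of_lt (by linarith)), star_mul']

/-- The derivative of `φ_α^{(k)}`. -/
def phiDeriv (μ : Fin (2 * n) → ℝ) (α : Fin (2 * n)) (k : ℕ) (z : ℂ) : ℂ :=
  -(k * phi μ α (k + 1) z) - 1 / 2 * ∑ β, phi μ α k z / (z - μ β)

theorem hasDerivAt_phi {z : ℂ} (hz : z ∉ cuts μ) (α : Fin (2 * n)) (k : ℕ) :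
    HasDerivAt (phi μ α k) (phiDeriv μ α k z) z := by
  have h1 := sub_branch_ne_zero hμ hz α
  have h2 : HasDerivAt (fun z : ℂ => ((z - μ α) ^ k)⁻¹) (-(k * (((z - μ α) ^ k)⁻¹ / (z - μ α)))) z := by
    refine ((((hasDerivAt_id z).sub_const (μ α : ℂ)).fun_pow k).fun_inv
      (pow_ne_zero k h1)).congr_deriv ?_
    rcases k with _ | k
    · simp
    · simp only [Nat.add_sub_cancel, pow_succ, id]
      field_simp
  have h3 := h2.fun_mul (hasDerivAt_inv_ytilde hμ hz)
  have h4 : phi μ α k = fun z : ℂ => ((z - μ α) ^ k)⁻¹ * (ytilde μ z)⁻¹ := by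
    ext z
    rw [phi, one_div, mul_inv]
  rw [phiDeriv, phi_succ, h4]
  refine h3.congr_deriv ?_
  have h5 : ∑ β, ((z - μ α) ^ k)⁻¹ * (ytilde μ z)⁻¹ / (z - μ β) =
      ((z - μ α) ^ k)⁻¹ * (ytilde μ z)⁻¹ * ∑ β, 1 / (z - μ β) := by
    rw [Finset.mul_sum]
    exact Finset.sum_congr rfl fun β _ => by ring
  rw [h5]
  ring

theorem analyticAt_phi_div {z : ℂ} (hz : z ∉ cuts μ) (α β : Fin (2 * n)) (k : ℕ) :
    AnalyticAt ℂ (fun z => phi μ α k z / (z - μ β)) z :=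
  (analyticAt_phi hμ hz α k).div (by fun_prop) (sub_branch_ne_zero hμ hz β)

theorem analyticAt_phiDeriv {z : ℂ} (hz : z ∉ cuts μ) (α : Fin (2 * n)) (k : ℕ) :
    AnalyticAt ℂ (phiDeriv μ α k) z :=
  (analyticAt_const.mul (analyticAt_phi hμ hz α (k + 1))).neg.sub
    (analyticAt_const.mul (Finset.analyticAt_fun_sum _ fun β _ => analyticAt_phi_div hμ hz α β k))

theorem isBigO_phi_inv (hn : 1 ≤ n) (α : Fin (2 * n)) (k : ℕ) :
    phi μ α k =O[cobounded ℂ] fun z => z⁻¹ := by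
  simpa using (isBigO_phi hμ α k).trans (isBigO_inv_pow_inv_pow (i := 1) (by omega))

theorem isBigO_phi_div (hn : 1 ≤ n) (α β : Fin (2 * n)) (k : ℕ) :
    (fun z => phi μ α k z / (z - μ β)) =O[cobounded ℂ] fun z => z⁻¹ := by
  have h := (isBigO_phi hμ α k).mul (isBigO_inv_sub (μ β : ℂ))
  have h1 : (fun z : ℂ => (z ^ (n + k))⁻¹ * z⁻¹) = fun z => (z ^ (n + k + 1))⁻¹ := by
    ext z
    rw [pow_succ, mul_inv]
  simp only [← div_eq_mul_inv (phi _ _ _ _)] at h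
  rw [h1] at h
  simpa using h.trans (isBigO_inv_pow_inv_pow (i := 1) (by omega))

theorem isBigO_phiDeriv (hn : 1 ≤ n) (α : Fin (2 * n)) (k : ℕ) :
    phiDeriv μ α k =O[cobounded ℂ] fun z => z⁻¹ := by
  unfold phiDeriv
  exact ((isBigO_phi_inv hμ hn α (k + 1)).const_mul_left _).neg_left.sub
    ((Asymptotics.IsBigO.fun_sum fun β _ => isBigO_phi_div hμ hn α β k).const_mul_left _)

theorem continuousOn_phiDeriv {s : Set ℂ} (hs : ∀ z ∈ s, z ∉ cuts μ) (α : Fin (2 * n)) (k : ℕ) :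
    ContinuousOn (phiDeriv μ α k) s := fun z hz =>
  (analyticAt_phiDeriv hμ (hs z hz) α k).continuousAt.continuousWithinAt

/-- Integration by parts turns the double pole into a simple one, and Cauchy's formula in the
exterior evaluates it at p. -/
theorem contour_phi_div_sq (hn : 1 ≤ n) {R : ℝ} (hR : ‖μ‖ < R) {p : ℂ} (hp : R < ‖p‖)
    (α : Fin (2 * n)) (k : ℕ) :
    -contour R (fun z => phi μ α k z / (p - z) ^ 2) = phiDeriv μ α k p := by
  have hR0 : 0 ≤ R := (norm_nonneg _).trans hR.le
  have hs := sphere_off_cuts hR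
  have hne : ∀ z : ℂ, ‖z‖ = R → p - z ≠ 0 := fun z hz h => by
    rw [sub_eq_zero.1 h, hz] at hp
    exact lt_irrefl _ hp
  have hinv : ContinuousOn (fun z : ℂ => (p - z)⁻¹) (sphere 0 R) :=
    ContinuousOn.fun_inv₀ (by fun_prop) fun z hz => hne z (by simpa using hz)
  have h := contour_by_parts hR0 (fun z hz => hasDerivAt_phi hμ (hs z (by simpa using hz)) α k)
    (g := fun z => (p - z)⁻¹) (g' := fun z => (p - z)⁻¹ ^ 2) (fun z hz => by
      refine (((hasDerivAt_id z).const_sub p).fun_inv (hne z hz)).congr_deriv ?_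
      simp) (continuousOn_phiDeriv hμ hs α k) (hinv.fun_pow 2)
  rw [← contour_exterior_cauchy (norm_nonneg μ) (fun z hz =>
    (analyticAt_phiDeriv hμ (notMem_cuts_of_lt hz) α k).differentiableAt) hR hp
    (isBigO_phiDeriv hμ hn α k)]
  simp only [div_eq_mul_inv, ← inv_pow]
  rw [h, neg_neg]

/-- The explicit dependence of M_α^{(k)} on the couplings, through V', resums to the derivative of
φ_α^{(k)}. -/
theorem hasSum_contour_phi (hn : 1 ≤ n) {p : ℂ} (hp : ‖μ‖ < ‖p‖) {R : ℝ} (hR : ‖μ‖ < R)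
    (α : Fin (2 * n)) (k : ℕ) :
    HasSum (fun j : ℕ => -((j + 1 : ℂ) / p ^ (j + 2)) * contour R (fun z => z ^ j * phi μ α k z))
      (phiDeriv μ α k p) := by
  obtain ⟨R', hR', hpR'⟩ := exists_between hp
  have h := hasSum_contour_insertion ((norm_nonneg _).trans hR'.le)
    (continuousOn_phi hμ (sphere_off_cuts hR') α k) hpR'
  rw [contour_phi_div_sq hμ hn hR' hpR'] at h
  refine h.congr_fun fun j => ?_
  rw [contour_radius_eq (norm_nonneg μ) (fun z hz => DifferentiableAt.fun_mul (by fun_prop)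
    (differentiableAt_phi hμ hz α k)) hR hR']

end Fixed

/-- `dμ_α/dV(p)`. -/
def branchDeriv (μ : ℝ[X] → Fin (2 * n) → ℝ) (c r : Fin (n - 1) → ℝ) (V : ℝ[X]) (α : Fin (2 * n))
    (p : ℂ) : ℂ :=
  branchForm (μ V) c r α p / moment (μ V) V α 1

/-- `dM_α^{(k)}/dV(p)`. -/
def momentDeriv (μ : ℝ[X] → Fin (2 * n) → ℝ) (c r : Fin (n - 1) → ℝ) (V : ℝ[X]) (α : Fin (2 * n))
    (k : ℕ) (p : ℂ) : ℂ :=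
  phiDeriv (μ V) α k p + ∑ β, (1 / 2 * mixedMoment (μ V) V α β k +
    if β = α then k * moment (μ V) V α (k + 1) else 0) * branchDeriv μ c r V β p

/-! ### Loop insertion of the moments and of the logarithms -/

namespace IsCutFamily

variable {U : Set ℝ[X]} {μ : ℝ[X] → Fin (2 * n) → ℝ} {c r : Fin (n - 1) → ℝ}
  (hU : IsCutFamily U μ c r) {V : ℝ[X]} (hV : V ∈ U)
include hU hV

theorem hasDerivAt_fMu (j : ℕ) (α : Fin (2 * n)) :
    HasDerivAt (fun s => fMu μ α (shift V j s)) (branchVelocity μ V j α : ℂ) 0 :=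
  (hasDerivAt_pi.1 (hU.hasDerivAt_curve hV j) α).ofReal_comp

theorem deriv_fMu (j : ℕ) (α : Fin (2 * n)) :
    deriv (fun s => fMu μ α (shift V j s)) 0 = branchVelocity μ V j α :=
  (hU.hasDerivAt_fMu hV j α).deriv

theorem isLoopInsertion_branchDeriv (hn : 1 ≤ n) (α : Fin (2 * n)) :
    IsLoopInsertion μ (fMu μ α) V (branchDeriv μ c r V α) :=
  hU.isLoopInsertion_fMu hV hn α

theorem hasDerivAt_fMoment (α : Fin (2 * n)) (k j : ℕ) :
    HasDerivAt (fun s => fMoment μ α k (shift V j s))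
      (contour (‖μ V‖ + 1) (fun z => z ^ j * phi (μ V) α k z) +
        ∑ β, (1 / 2 * mixedMoment (μ V) V α β k +
          if β = α then k * moment (μ V) V α (k + 1) else 0) * branchVelocity μ V j β) 0 := by
  have h := hasDerivAt_contour_phi (R := ‖μ V‖ + 1) (hU.hasDerivAt_curve hV j)
    (hU.eventually_strictMono hV j) (by rw [shift_zero]; exact lt_add_one _) (q := fun _ => 1)
    (fun z _ => contDiffAt_const) V j α k
  simp only [shift_zero, one_mul] at h
  refine (h.congr_of_eventuallyEq ?_).congr_deriv ?_
  · filter_upwards [hU.eventually_strictMono hV j,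
      hU.eventually_norm_lt hV j (lt_add_one ‖μ V‖)] with s hs hs'
    exact moment_eq_contour hs hs'
  · simp only [add_mul, ite_mul, zero_mul, Finset.sum_add_distrib, Finset.sum_ite_eq',
      Finset.mem_univ, if_true]
    rw [Finset.mul_sum, ← add_assoc]
    simp only [mixedMoment, moment]
    congr 1
    · congr 1
      exact Finset.sum_congr rfl fun β _ => by ring
    · ring

/-- The chain rule: the explicit variation of V' gives the first term, and the motion of the branch
points enters with the partial derivatives of the moment as coefficients. -/
theorem isLoopInsertion_momentDeriv (hn : 1 ≤ n) (α : Fin (2 * n)) (k : ℕ) :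
    IsLoopInsertion μ (fMoment μ α k) V (momentDeriv μ c r V α k) := by
  have hμ := hU.strictMono V hV
  have hb := hU.isLoopInsertion_branchDeriv hV hn
  refine ⟨fun p hp => (analyticAt_phiDeriv hμ hp α k).add (Finset.analyticAt_fun_sum _ fun β _ =>
    analyticAt_const.mul ((hb β).1 p hp)), fun p hp => ?_⟩
  refine hasLoopInsertionAt_add_sum (g := fun β => fMu μ β) (fun β _ => (hb β).2 p hp)
    (hasSum_contour_phi hμ hn hp (lt_add_one _) α k) fun j => ?_
  simp only [hU.deriv_fMu hV]
  exact hU.hasDerivAt_fMoment hV α k j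

theorem isLoopInsertion_fLogM (hn : 1 ≤ n) (α : Fin (2 * n)) :
    IsLoopInsertion μ (fLogM μ α) V
      fun p => (moment (μ V) V α 1)⁻¹ * momentDeriv μ c r V α 1 p := by
  refine (hU.isLoopInsertion_momentDeriv hV hn α 1).const_mul fun j => ?_
  have h := hU.hasDerivAt_fMoment hV α 1 j
  have h0 : fMoment μ α 1 (shift V j 0) = moment (μ V) V α 1 := by rw [shift_zero, fMoment]
  have h1 := hasDerivAt_log_norm h.differentiableAt.hasDerivAt
    (by rw [h0]; exact hU.nonsingular V hV α) (by
      filter_upwards [hU.eventually_strictMono hV j] with s hs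
      rw [star_div₀, fMoment, star_moment hs, fMoment, shift_zero, star_moment (hU.strictMono V hV)])
  rw [h0, div_eq_inv_mul] at h1
  exact h1

theorem isLoopInsertion_fLogDiff (hn : 1 ≤ n) {α β : Fin (2 * n)} (hαβ : β ≠ α) :
    IsLoopInsertion μ (fLogDiff μ α β) V fun p => ((μ V α : ℂ) - μ V β)⁻¹ *
      (branchDeriv μ c r V α p - branchDeriv μ c r V β p) := by
  have hd := fun α j => (hU.hasDerivAt_fMu hV j α).differentiableAt
  refine ((hU.isLoopInsertion_branchDeriv hV hn α).sub (hU.isLoopInsertion_branchDeriv hV hn β)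
    (hd α) (hd β)).const_mul fun j => ?_
  have h := ((hd α j).sub (hd β j)).hasDerivAt
  have h0 : fMu μ α (shift V j 0) - fMu μ β (shift V j 0) = (μ V α : ℂ) - μ V β := by
    simp only [shift_zero, fMu]
  have hne : (μ V α : ℂ) - μ V β ≠ 0 := by
    rw [sub_ne_zero]
    exact_mod_cast fun h => hαβ ((hU.strictMono V hV).injective h).symm
  have h1 := hasDerivAt_log_norm h (by rw [Pi.sub_apply, h0]; exact hne) (by
      refine Eventually.of_forall fun s => ?_
      simp [fMu])
  simp only [Pi.sub_apply, h0, div_eq_inv_mul] at h1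
  refine h1.congr_of_eventuallyEq (Eventually.of_forall fun s => ?_)
  simp only [fLogDiff, fMu, ← Complex.ofReal_sub, Complex.norm_real, Real.norm_eq_abs]

end IsCutFamily

end

section

variable {n : ℕ}

/-! ### The operator `K̂ - 2 W₀` -/

section Fixed

variable {μ : Fin (2 * n) → ℝ}

theorem sphere_mid_off_cuts {p : ℂ} (hp : ‖μ‖ < ‖p‖) :
    ∀ z ∈ sphere (0 : ℂ) ((‖μ‖ + ‖p‖) / 2), z ∉ cuts μ := sphere_off_cuts (by linarith)

theorem continuousOn_force_div (V : ℝ[X]) {p : ℂ} (hp : ‖μ‖ < ‖p‖) :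
    ContinuousOn (fun z => force V z / (p - z)) (sphere (0 : ℂ) ((‖μ‖ + ‖p‖) / 2)) := by
  refine (continuous_force V).continuousOn.div (by fun_prop) fun z hz h => ?_
  rw [mem_sphere_zero_iff_norm, ← sub_eq_zero.1 h] at hz
  linarith

theorem loopOp_congr {V : ℝ[X]} {f g : ℂ → ℂ} (h : EqOn f g (cuts μ)ᶜ) {p : ℂ} (hp : ‖μ‖ < ‖p‖) :
    loopOp μ V f p = loopOp μ V g p := by
  unfold loopOp opK
  rw [h (notMem_cuts_of_lt hp), contour_congr (by positivity) fun z hz => ?_]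
  rw [h (sphere_mid_off_cuts hp z (by simpa using hz))]

theorem loopOp_add {V : ℝ[X]} {f g : ℂ → ℂ} (hf : AnalyticOnNhd ℂ f (cuts μ)ᶜ)
    (hg : AnalyticOnNhd ℂ g (cuts μ)ᶜ) {p : ℂ} (hp : ‖μ‖ < ‖p‖) :
    loopOp μ V (fun z => f z + g z) p = loopOp μ V f p + loopOp μ V g p := by
  have hs := sphere_mid_off_cuts hp
  have hc := continuousOn_force_div V hp
  simp only [loopOp, opK, mul_add]
  rw [contour_add (by positivity) (hc.fun_mul (hf.continuousOn.mono hs))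
    (hc.fun_mul (hg.continuousOn.mono hs))]
  ring

theorem loopOp_const_mul {V : ℝ[X]} (a : ℂ) (f : ℂ → ℂ) (p : ℂ) :
    loopOp μ V (fun z => a * f z) p = a * loopOp μ V f p := by
  simp only [loopOp, opK, mul_left_comm _ a]
  rw [contour_const_mul]
  ring

theorem loopOp_sum {V : ℝ[X]} {ι : Type*} (s : Finset ι) (a : ι → ℂ) {f : ι → ℂ → ℂ}
    (hf : ∀ i ∈ s, AnalyticOnNhd ℂ (f i) (cuts μ)ᶜ) {p : ℂ} (hp : ‖μ‖ < ‖p‖) :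
    loopOp μ V (fun z => ∑ i ∈ s, a i * f i z) p = ∑ i ∈ s, a i * loopOp μ V (f i) p := by
  classical
  induction s using Finset.induction_on with
  | empty => simpa using loopOp_const_mul (μ := μ) (V := V) 0 (fun _ => 0) p
  | insert i s hi ih =>
    simp only [Finset.sum_insert hi]
    rw [loopOp_add (fun z hz => analyticAt_const.fun_mul (hf i (Finset.mem_insert_self i s) z hz))
      (fun z hz => s.analyticAt_fun_sum fun k hk =>
        analyticAt_const.fun_mul (hf k (Finset.mem_insert_of_mem hk) z hz)) hp,
      loopOp_const_mul, ih fun k hk => hf k (Finset.mem_insert_of_mem hk)]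

/-- Blowing up the contour. -/
theorem loopOp_eq {V : ℝ[X]} {f : ℂ → ℂ} (hf : AnalyticOnNhd ℂ f (cuts μ)ᶜ) {p : ℂ}
    (hp : ‖μ‖ < ‖p‖) {R : ℝ} (hR : ‖p‖ < R) :
    loopOp μ V f p = bigY μ V p * f p - contour R fun z => force V z * f z / (z - p) := by
  have h := contour_annulus_cauchy (ρ := ‖μ‖) (norm_nonneg μ) (f := fun z => force V z * f z) (p := p)
    (R := (‖μ‖ + ‖p‖) / 2) (R' := R) (fun z hz => (differentiable_force V z).fun_mul
      (hf z (notMem_cuts_of_lt hz)).differentiableAt) (by linarith) (by linarith) hR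
  have h1 : opK μ V f p = -contour ((‖μ‖ + ‖p‖) / 2) fun z => force V z * f z / (z - p) := by
    unfold opK
    rw [← contour_neg]
    congr 1
    ext z
    rw [← neg_sub z p, div_neg]
    ring
  rw [loopOp, h1, planarW]
  linear_combination h

variable (hμ : StrictMono μ)
include hμ

/-- Division by z - μ_β commutes with K̂ - 2W₀ up to a constant, the generalised moment of f; this
is partial fractions for 1/((z - p)(z - μ_β)). -/
theorem loopOp_div_sub {V : ℝ[X]} {f : ℂ → ℂ} (hf : AnalyticOnNhd ℂ f (cuts μ)ᶜ) {p : ℂ}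
    (hp : ‖μ‖ < ‖p‖) (β : Fin (2 * n)) :
    loopOp μ V (fun z => f z / (z - μ β)) p =
      (loopOp μ V f p + contour (‖μ‖ + 1) fun z => force V z * (f z / (z - μ β))) / (p - μ β) := by
  set R := ‖p‖ + 1
  have hR : ‖p‖ < R := lt_add_one _
  have hR0 : 0 ≤ R := by positivity
  have hs := sphere_off_cuts (hp.trans hR)
  have hpb := sub_branch_ne_zero hμ (notMem_cuts_of_lt hp) β
  have hf' : AnalyticOnNhd ℂ (fun z => f z / (z - μ β)) (cuts μ)ᶜ := fun z hz =>
    (hf z hz).div (by fun_prop) (sub_branch_ne_zero hμ hz β)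
  have hne : ∀ z : ℂ, ‖z‖ = R → z - p ≠ 0 := fun z hz h => by
    rw [sub_eq_zero.1 h] at hz
    exact hR.ne hz
  rw [eq_div_iff hpb, loopOp_eq hf hp hR, loopOp_eq hf' hp hR,
    contour_radius_eq (R := ‖μ‖ + 1) (R' := R) (norm_nonneg μ) (fun z hz =>
      (differentiable_force V z).fun_mul (hf' z (notMem_cuts_of_lt hz)).differentiableAt)
      (lt_add_one _) (hp.trans hR)]
  have hfc := (continuous_force V).continuousOn (s := sphere (0 : ℂ) R)
  have hinv : ContinuousOn (fun z : ℂ => (z - p)⁻¹) (sphere 0 R) :=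
    ContinuousOn.fun_inv₀ (by fun_prop) fun z hz => hne z (by simpa using hz)
  have h1 : contour R (fun z => force V z * (f z / (z - μ β)) / (z - p)) * (p - μ β) =
      contour R (fun z => force V z * f z / (z - p)) -
        contour R fun z => force V z * (f z / (z - μ β)) := by
    rw [mul_comm, ← contour_const_mul, ← contour_sub hR0]
    · refine contour_congr hR0 fun z hz => ?_
      have h1 := hne z hz
      have h2 := sub_branch_ne_zero hμ (hs z (by simpa using hz)) β
      field_simp
      ring
    · simp only [div_eq_mul_inv]
      exact (hfc.fun_mul (hf.continuousOn.mono hs)).fun_mul hinv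
    · exact hfc.fun_mul (hf'.continuousOn.mono hs)
  rw [sub_mul, h1]
  field_simp
  ring

theorem analyticOnNhd_phi (α : Fin (2 * n)) (k : ℕ) : AnalyticOnNhd ℂ (phi μ α k) (cuts μ)ᶜ :=
  fun _ hz => analyticAt_phi hμ hz α k

theorem loopOp_phiZero {V : ℝ[X]} {p : ℂ} (hp : ‖μ‖ < ‖p‖) : loopOp μ V (phiZero μ) p = 0 := by
  rw [loopOp_eq (fun z hz => analyticAt_phiZero hμ hz) hp (lt_add_one _), bigY,
    bigM_eq_contour hμ (hp.trans (lt_add_one _)) (lt_add_one _), phiZero, mul_assoc,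
    mul_one_div_cancel (ytilde_ne_zero hμ (notMem_cuts_of_lt hp)), mul_one, sub_eq_zero]
  congr 1
  ext z
  rw [phiZero]
  ring

theorem loopOp_phi_zero {V : ℝ[X]} {p : ℂ} (hp : ‖μ‖ < ‖p‖) (α : Fin (2 * n)) :
    loopOp μ V (phi μ α 0) p = 0 := by
  have : phi μ α 0 = phiZero μ := by
    ext z
    rw [phi_zero, phiZero, one_div]
  rw [this, loopOp_phiZero hμ hp]

theorem loopOp_phi_succ {V : ℝ[X]} {p : ℂ} (hp : ‖μ‖ < ‖p‖) (α : Fin (2 * n)) (k : ℕ) :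
    loopOp μ V (phi μ α (k + 1)) p =
      (loopOp μ V (phi μ α k) p + moment μ V α (k + 1)) / (p - μ α) := by
  have h := loopOp_div_sub (V := V) hμ (analyticOnNhd_phi hμ α k) hp α
  simp only [← phi_succ] at h
  exact h

/-- These are the zero modes. For l = 0 the claim is the definition of M(p); each further power of z
costs an asymptotic integral of order below n, which vanishes. -/
theorem loopOp_pow_mul_phiZero {V : ℝ[X]}
    (hA : ∀ k < n, contour (‖μ‖ + 1) (fun z => z ^ k * force V z * (ytilde μ z)⁻¹) = 0)
    {p : ℂ} (hp : ‖μ‖ < ‖p‖) {l : ℕ} (hl : l ≤ n) :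
    loopOp μ V (fun z => z ^ l * phiZero μ z) p = 0 := by
  set R := ‖p‖ + 1
  have hR : ‖p‖ < R := lt_add_one _
  have hR0 : 0 ≤ R := by positivity
  have hs := sphere_off_cuts (hp.trans hR)
  have hf : ∀ l, AnalyticOnNhd ℂ (fun z => z ^ l * phiZero μ z) (cuts μ)ᶜ := fun l z hz =>
    AnalyticAt.mul (by fun_prop) (analyticAt_phiZero hμ hz)
  have hne : ∀ z : ℂ, ‖z‖ = R → z - p ≠ 0 := fun z hz h => by
    rw [sub_eq_zero.1 h] at hz
    exact hR.ne hz
  have hfc := (continuous_force V).continuousOn (s := sphere (0 : ℂ) R)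
  have hinv : ContinuousOn (fun z : ℂ => (z - p)⁻¹) (sphere 0 R) :=
    ContinuousOn.fun_inv₀ (by fun_prop) fun z hz => hne z (by simpa using hz)
  induction l with
  | zero => simpa using loopOp_phiZero (V := V) hμ hp
  | succ l ih =>
    have h0 := ih (by omega)
    rw [loopOp_eq (hf _) hp hR] at h0 ⊢
    have h1 := hA l (by omega)
    rw [contour_radius_eq (R' := R) (norm_nonneg μ) (fun z hz => DifferentiableAt.fun_mul
      (DifferentiableAt.fun_mul (by fun_prop) (differentiable_force V z))
      (differentiableAt_inv_ytilde hμ (notMem_cuts_of_lt hz))) (lt_add_one _) (hp.trans hR)] at h1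
    have h2 : contour R (fun z => force V z * (z ^ (l + 1) * phiZero μ z) / (z - p)) =
        contour R (fun z => z ^ l * force V z * (ytilde μ z)⁻¹) +
          p * contour R fun z => force V z * (z ^ l * phiZero μ z) / (z - p) := by
      rw [← contour_const_mul, ← contour_add hR0]
      · refine contour_congr hR0 fun z hz => ?_
        have h1 := hne z hz
        rw [phiZero]
        field_simp
        ring
      · have h3 : ContinuousOn (fun z => z ^ l * force V z) (sphere (0 : ℂ) R) := by fun_prop
        exact h3.fun_mul (continuousOn_inv_ytilde hμ hs)
      · simp only [div_eq_mul_inv]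
        exact continuousOn_const.fun_mul
          ((hfc.fun_mul ((hf l).continuousOn.mono hs)).fun_mul hinv)
    rw [h2, h1, pow_succ]
    linear_combination p * h0

theorem loopOp_branchForm {V : ℝ[X]} {c r : Fin (n - 1) → ℝ}
    (hA : ∀ k < n, contour (‖μ‖ + 1) (fun z => z ^ k * force V z * (ytilde μ z)⁻¹) = 0)
    {p : ℂ} (hp : ‖μ‖ < ‖p‖) (α : Fin (2 * n)) :
    loopOp μ V (branchForm μ c r α) p = moment μ V α 1 / (p - μ α) := by
  have h1 : branchForm μ c r α = fun z => phi μ α 1 z +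
      ∑ l, zeroModeCoeff μ c r α l * (z ^ (l : ℕ) * phiZero μ z) := by
    ext z
    rw [branchForm, zeroModePoly, Finset.sum_mul]
    simp only [mul_assoc]
  have hz : ∀ l : ℕ, AnalyticOnNhd ℂ (fun z => z ^ l * phiZero μ z) (cuts μ)ᶜ := fun l z hz =>
    AnalyticAt.mul (by fun_prop) (analyticAt_phiZero hμ hz)
  rw [h1, loopOp_add (analyticOnNhd_phi hμ α 1) (fun z hz' => Finset.analyticAt_fun_sum _ fun (l : Fin (n - 1)) _ =>
    analyticAt_const.fun_mul (hz l z hz')) hp, loopOp_sum _ _ (fun (l : Fin (n - 1)) _ => hz l) hp,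
    Finset.sum_eq_zero fun l _ => by
      rw [loopOp_pow_mul_phiZero hμ hA hp (by omega), mul_zero],
    loopOp_phi_succ hμ hp, loopOp_phi_zero hμ hp, zero_add, add_zero]

theorem loopOp_phiDeriv {V : ℝ[X]} {p : ℂ} (hp : ‖μ‖ < ‖p‖) (α : Fin (2 * n)) (k : ℕ) :
    loopOp μ V (phiDeriv μ α k) p = -(k * loopOp μ V (phi μ α (k + 1)) p) -
      1 / 2 * ∑ β, (loopOp μ V (phi μ α k) p + mixedMoment μ V α β k) / (p - μ β) := by
  have h1 : phiDeriv μ α k = fun z => (-k : ℂ) * phi μ α (k + 1) z +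
      ∑ β, (-(1 / 2) : ℂ) * (phi μ α k z / (z - μ β)) := by
    ext z
    rw [phiDeriv, ← Finset.mul_sum]
    ring
  rw [h1, loopOp_add (fun z hz => analyticAt_const.fun_mul (analyticAt_phi hμ hz α (k + 1)))
    (fun z hz => Finset.analyticAt_fun_sum _ fun β _ =>
      analyticAt_const.fun_mul (analyticAt_phi_div hμ hz α β k)) hp, loopOp_const_mul,
    loopOp_sum _ _ (fun β _ z hz => analyticAt_phi_div hμ hz α β k) hp]
  simp only [loopOp_div_sub hμ (analyticOnNhd_phi hμ α k) hp, mixedMoment]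
  rw [← Finset.mul_sum]
  ring

end Fixed

/-! ### Images of the loop insertions under K̂ - 2W₀ -/

namespace IsCutFamily

variable {U : Set ℝ[X]} {μ : ℝ[X] → Fin (2 * n) → ℝ} {c r : Fin (n - 1) → ℝ}
  (hU : IsCutFamily U μ c r) {V : ℝ[X]} (hV : V ∈ U)
include hU hV

theorem loopOp_branchDeriv {p : ℂ} (hp : ‖μ V‖ < ‖p‖) (α : Fin (2 * n)) :
    loopOp (μ V) V (branchDeriv μ c r V α) p = 1 / (p - μ V α) := by
  have hM := hU.nonsingular V hV α
  have h : branchDeriv μ c r V α =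
      fun z => (moment (μ V) V α 1)⁻¹ * branchForm (μ V) c r α z := by
    ext z
    rw [branchDeriv, div_eq_inv_mul]
  rw [h, loopOp_const_mul, loopOp_branchForm (hU.strictMono V hV) (fun k hk => by
    rw [hU.contour_pow_force hV (lt_add_one _) hk.le, if_neg hk.ne]) hp]
  field_simp

/-- The mixed moments and M_α^{(k+1)} produced by the derivative of φ_α^{(k)} cancel exactly against
the contributions of the dμ_β/dV. -/
theorem loopOp_momentDeriv (hn : 1 ≤ n) {p : ℂ} (hp : ‖μ V‖ < ‖p‖) (α : Fin (2 * n)) (k : ℕ) :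
    loopOp (μ V) V (momentDeriv μ c r V α k) p =
      -(loopOp (μ V) V (phi (μ V) α k) p *
        (k / (p - μ V α) + 1 / 2 * ∑ β, 1 / (p - μ V β))) := by
  have hμ := hU.strictMono V hV
  have hb := fun β => (hU.isLoopInsertion_branchDeriv hV hn β).1
  unfold momentDeriv
  rw [loopOp_add (fun z hz => analyticAt_phiDeriv hμ hz α k)
    (fun z hz => Finset.analyticAt_fun_sum _ fun β _ => analyticAt_const.fun_mul (hb β z hz)) hp,
    loopOp_sum _ _ (fun β _ => hb β) hp, loopOp_phiDeriv hμ hp, loopOp_phi_succ hμ hp]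
  simp only [hU.loopOp_branchDeriv hV hp, add_mul, ite_mul, zero_mul, Finset.sum_add_distrib,
    Finset.sum_ite_eq', Finset.mem_univ, if_true, add_div]
  have h1 : ∑ β, loopOp (μ V) V (phi (μ V) α k) p / (p - μ V β) =
      loopOp (μ V) V (phi (μ V) α k) p * ∑ β, 1 / (p - μ V β) := by
    rw [Finset.mul_sum]
    exact Finset.sum_congr rfl fun β _ => by ring
  have h2 : ∑ β, 1 / 2 * mixedMoment (μ V) V α β k * (1 / (p - μ V β)) =
      1 / 2 * ∑ β, mixedMoment (μ V) V α β k / (p - μ V β) := by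
    rw [Finset.mul_sum]
    exact Finset.sum_congr rfl fun β _ => by ring
  rw [h1, h2]
  ring

end IsCutFamily

end

section

variable {n : ℕ}

/-! ### Uniqueness of the basis functions -/

/-- The sum `∑_{i < k} M (k - i) (p - a)^{-1-i}`, defined by recursion on `k`. -/
def polarPart (a : ℂ) (M : ℕ → ℂ) : ℕ → ℂ → ℂ
  | 0, _ => 0
  | k + 1, p => (polarPart a M k p + M (k + 1)) / (p - a)

theorem loopOp_phi {μ : Fin (2 * n) → ℝ} (hμ : StrictMono μ) {V : ℝ[X]} {p : ℂ} (hp : ‖μ‖ < ‖p‖)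
    (α : Fin (2 * n)) (k : ℕ) :
    loopOp μ V (phi μ α k) p = polarPart (μ α) (moment μ V α) k p := by
  induction k with
  | zero => rw [loopOp_phi_zero hμ hp, polarPart]
  | succ k ih => rw [loopOp_phi_succ hμ hp, ih, polarPart]

theorem analyticAt_polarPart (a : ℂ) (M : ℕ → ℂ) (k : ℕ) {p : ℂ} (hp : p ≠ a) :
    AnalyticAt ℂ (polarPart a M k) p := by
  induction k with
  | zero => exact analyticAt_const
  | succ k ih => exact (ih.add analyticAt_const).div (by fun_prop) (sub_ne_zero.2 hp)

/-- The pole at `a` has order k + 1 with leading coefficient `M 1`, which for the moments is the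
nonzero M_α^{(1)}. -/
theorem tendsto_pow_mul_polarPart (a : ℂ) (M : ℕ → ℂ) (k : ℕ) :
    Tendsto (fun p => (p - a) ^ (k + 1) * polarPart a M (k + 1) p) (𝓝[≠] a) (𝓝 (M 1)) := by
  induction k with
  | zero =>
    refine tendsto_const_nhds.congr' ?_
    filter_upwards [self_mem_nhdsWithin] with p hp
    have : p - a ≠ 0 := sub_ne_zero.2 hp
    simp only [polarPart]
    field_simp
    ring
  | succ k ih =>
    have h0 : Tendsto (fun p : ℂ => (p - a) ^ (k + 1) * M (k + 2)) (𝓝[≠] a) (𝓝 0) := by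
      have : Continuous fun p : ℂ => (p - a) ^ (k + 1) * M (k + 2) := by fun_prop
      simpa using (this.tendsto a).mono_left nhdsWithin_le_nhds
    have h1 := ih.add h0
    rw [add_zero] at h1
    refine h1.congr' ?_
    filter_upwards [self_mem_nhdsWithin] with p hp
    have : p - a ≠ 0 := sub_ne_zero.2 hp
    rw [polarPart.eq_2 a M p (k + 1)]
    field_simp
    ring

/-! ### Linear independence by comparing poles -/

section Polar

variable {ι : Type*} {x : ι → ℂ}

theorem tendsto_sub_pow_mul (a : ℂ) {m : ℕ} {f : ℂ → ℂ} {l : ℂ} (hf : Tendsto f (𝓝[≠] a) (𝓝 l)) :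
    Tendsto (fun p => (p - a) ^ m * f p) (𝓝[≠] a) (𝓝 (if m = 0 then l else 0)) := by
  have h : Tendsto (fun p : ℂ => (p - a) ^ m) (𝓝[≠] a) (𝓝 (if m = 0 then 1 else 0)) := by
    have h1 : Continuous fun p : ℂ => (p - a) ^ m := by fun_prop
    have h2 := (h1.tendsto a).mono_left (nhdsWithin_le_nhds (s := {a}ᶜ))
    simpa [zero_pow_eq] using h2
  simpa using h.mul hf

open Classical in
theorem tendsto_sub_mul_inv (hx : Function.Injective x) (i j : ι) :
    Tendsto (fun p => (p - x i) * (1 / (p - x j))) (𝓝[≠] x i) (𝓝 (if j = i then 1 else 0)) := by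
  split_ifs with h
  · subst h
    refine tendsto_const_nhds.congr' ?_
    filter_upwards [self_mem_nhdsWithin] with p hp
    rw [mul_one_div_cancel (sub_ne_zero.2 hp)]
  · have h1 : x i - x j ≠ 0 := sub_ne_zero.2 fun h' => h (hx h').symm
    have h2 : ContinuousAt (fun p => (p - x i) * (1 / (p - x j))) (x i) :=
      ContinuousAt.mul (by fun_prop) (continuousAt_const.div (by fun_prop) h1)
    simpa using h2.tendsto.mono_left (nhdsWithin_le_nhds (s := {x i}ᶜ))

variable [Fintype ι]

open Classical in
theorem tendsto_sub_mul_weight (hx : Function.Injective x) (a : ℂ) (i j : ι) :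
    Tendsto (fun p => (p - x i) * (a / (p - x j) + 1 / 2 * ∑ m, 1 / (p - x m))) (𝓝[≠] x i)
      (𝓝 (a * (if j = i then 1 else 0) + 1 / 2)) := by
  have h1 := ((tendsto_sub_mul_inv hx i j).const_mul a).add
    ((tendsto_finsetSum Finset.univ fun m _ => tendsto_sub_mul_inv hx i m).const_mul (1 / 2))
  rw [Finset.sum_ite_eq' Finset.univ i, if_pos (Finset.mem_univ i), mul_one] at h1
  refine h1.congr fun p => ?_
  rw [mul_add, ← Finset.mul_sum]
  ring

/-- The functions `(p - x_i)⁻¹` and `polarPart_i (p) ((k + 1) / (p - x_i) + ½ ∑ (p - x_j)⁻¹)`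
are linearly independent. -/
theorem coeff_eq_zero_of_polar (hx : Function.Injective x) {M : ι → ℕ → ℂ} (hM : ∀ i, M i 1 ≠ 0)
    {K : ℕ} {a : ι → ℂ} {b : ι → ℕ → ℂ} {C : ℝ}
    (h : ∀ p : ℂ, C < ‖p‖ → ∑ i, a i * (1 / (p - x i)) + ∑ i, ∑ k ∈ Finset.range K, b i k *
      -(polarPart (x i) (M i) (k + 1) p *
        (((k + 1 : ℕ) : ℂ) / (p - x i) + 1 / 2 * ∑ j, 1 / (p - x j))) = 0) :
    (∀ i, a i = 0) ∧ ∀ i, ∀ k < K, b i k = 0 := by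
  classical
  set Φ : ℂ → ℂ := fun p => ∑ i, a i * (1 / (p - x i)) + ∑ i, ∑ k ∈ Finset.range K, b i k *
      -(polarPart (x i) (M i) (k + 1) p *
        (((k + 1 : ℕ) : ℂ) / (p - x i) + 1 / 2 * ∑ j, 1 / (p - x j))) with hΦ
  have hinv : ∀ p ∈ (range x)ᶜ, ∀ i (e : ℂ), AnalyticAt ℂ (fun p => e / (p - x i)) p := fun p hp i e =>
    analyticAt_const.div (by fun_prop) (sub_ne_zero.2 fun h => hp ⟨i, h.symm⟩)
  have han : AnalyticOnNhd ℂ Φ (range x)ᶜ := fun p hp => by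
    refine (Finset.analyticAt_fun_sum _ fun i _ => analyticAt_const.fun_mul (hinv p hp i 1)).fun_add
      (Finset.analyticAt_fun_sum _ fun i _ => Finset.analyticAt_fun_sum _ fun k _ =>
        analyticAt_const.fun_mul (AnalyticAt.fun_neg (AnalyticAt.fun_mul ?_ ((hinv p hp i _).fun_add
          (analyticAt_const.fun_mul (Finset.analyticAt_fun_sum _ fun j _ => hinv p hp j 1))))))
    exact analyticAt_polarPart _ _ _ fun h => hp ⟨i, h.symm⟩
  have hpre : IsPreconnected (range x)ᶜ :=
    ((finite_range x).countable.isPathConnected_compl_of_one_lt_rank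
      (by rw [Complex.rank_real_complex]; norm_num)).isConnected.isPreconnected
  -- The relation is given only far out; the identity theorem on the connected complement of the
  -- finitely many poles brings it near x_i.
  have hzero : ∀ i, ∀ᶠ p in 𝓝[≠] x i, Φ p = 0 := fun i => by
    obtain ⟨R, hR⟩ := (finite_range x).isBounded.exists_norm_le
    obtain ⟨p₀, hp₀⟩ := NormedSpace.exists_lt_norm ℝ ℂ (max C R)
    have h1 : EqOn Φ 0 (range x)ᶜ := by
      refine han.eqOn_zero_of_preconnected_of_eventuallyEq_zero hpre
        (z₀ := p₀) (fun hmem => ?_) ?_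
      · exact absurd (hR p₀ hmem) (not_le.2 ((le_max_right _ _).trans_lt hp₀))
      · filter_upwards [continuous_norm.continuousAt.eventually_const_lt
          ((le_max_left _ _).trans_lt hp₀)] with p hp
        exact h p hp
    have h2 : ∀ᶠ p in 𝓝[≠] x i, p ∈ (range x)ᶜ := by
      have h3 : ∀ᶠ p in 𝓝 (x i), p ∉ range x \ {x i} :=
        ((finite_range x).subset sdiff_subset).isClosed.isOpen_compl.mem_nhds (by simp)
      filter_upwards [nhdsWithin_le_nhds h3, self_mem_nhdsWithin] with p hp hp' hmem
      exact hp ⟨hmem, hp'⟩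
    exact h2.mono fun p hp => h1 hp
  have hA : ∀ i m, Tendsto (fun p => (p - x i) ^ m * ∑ j, a j * ((p - x i) * (1 / (p - x j))))
      (𝓝[≠] x i) (𝓝 (if m = 0 then a i else 0)) := fun i m => by
    refine tendsto_sub_pow_mul _ ?_
    have := tendsto_finsetSum Finset.univ fun j _ => (tendsto_sub_mul_inv hx i j).const_mul (a j)
    simpa using this
  have hB : ∀ i k, k < K → b i k = 0 := by
    intro i
    by_contra! hne
    obtain ⟨k₁, hk₁⟩ := hne
    -- For the largest index with a nonzero coefficient, multiply by (p - x_i)^{k₀+2}: every other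
    -- term tends to 0, and this one to -b M (k₀ + 1 + ½), which is nonzero.
    obtain ⟨k₀, hk₀, hmax⟩ := ((Finset.range K).filter fun k => b i k ≠ 0).exists_max_image id
      ⟨k₁, by simpa using hk₁⟩
    simp only [Finset.mem_filter, Finset.mem_range, id, ne_eq] at hk₀ hmax
    have hterm : ∀ j, ∀ k ∈ Finset.range K, Tendsto (fun p => b j k * -(((p - x i) ^ (k₀ + 1) *
        polarPart (x j) (M j) (k + 1) p) * ((p - x i) *
          (((k + 1 : ℕ) : ℂ) / (p - x j) + 1 / 2 * ∑ m, 1 / (p - x m))))) (𝓝[≠] x i)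
        (𝓝 (if j = i then if k = k₀ then b i k₀ * -(M i 1 * ((k₀ + 1 : ℕ) + 1 / 2)) else 0 else 0)) := by
      intro j k hk
      by_cases hji : j = i
      · subst hji
        rw [if_pos rfl]
        rcases lt_trichotomy k k₀ with hlt | heq | hgt
        · rw [if_neg hlt.ne]
          have h1 : Tendsto (fun p => (p - x j) ^ (k₀ + 1) * polarPart (x j) (M j) (k + 1) p)
              (𝓝[≠] x j) (𝓝 0) := by
            have := tendsto_sub_pow_mul (m := k₀ - k) _ (tendsto_pow_mul_polarPart (x j) (M j) k)
            rw [if_neg (by omega)] at this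
            refine this.congr fun p => ?_
            rw [← mul_assoc, ← pow_add, show k₀ - k + (k + 1) = k₀ + 1 by omega]
          have h2 := ((h1.mul (tendsto_sub_mul_weight hx ((k + 1 : ℕ) : ℂ) j j)).neg).const_mul (b j k)
          simpa using h2
        · subst heq
          rw [if_pos rfl]
          have h2 := (((tendsto_pow_mul_polarPart (x j) (M j) k).mul
            (tendsto_sub_mul_weight hx ((k + 1 : ℕ) : ℂ) j j)).neg).const_mul (b j k)
          simpa using h2
        · rw [if_neg hgt.ne']
          have hbk : b j k = 0 := by
            by_contra hb
            exact absurd (hmax k ⟨Finset.mem_range.1 hk, hb⟩) (not_le.2 hgt)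
          simp [hbk]
      · rw [if_neg hji]
        have h0 : Tendsto (polarPart (x j) (M j) (k + 1)) (𝓝[≠] x i)
            (𝓝 (polarPart (x j) (M j) (k + 1) (x i))) :=
          (analyticAt_polarPart _ _ _ fun h => hji (hx h).symm).continuousAt.tendsto.mono_left
            nhdsWithin_le_nhds
        have h1 := tendsto_sub_pow_mul (m := k₀ + 1) _ h0
        rw [if_neg (Nat.succ_ne_zero _)] at h1
        have h2 := ((h1.mul (tendsto_sub_mul_weight hx ((k + 1 : ℕ) : ℂ) i j)).neg).const_mul (b j k)
        simpa using h2
    have hlim := (hA i (k₀ + 1)).add (tendsto_finsetSum Finset.univ fun j _ =>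
      tendsto_finsetSum (Finset.range K) fun k hk => hterm j k hk)
    have hval : ∑ j, ∑ k ∈ Finset.range K, (if j = i then if k = k₀ then
        b i k₀ * -(M i 1 * ((k₀ + 1 : ℕ) + 1 / 2)) else 0 else 0) =
        b i k₀ * -(M i 1 * ((k₀ + 1 : ℕ) + 1 / 2)) := by
      rw [Finset.sum_eq_single i (fun j _ hj => by simp [hj]) (by simp)]
      simp [hk₀.1]
    rw [if_neg (Nat.succ_ne_zero _), zero_add, hval] at hlim
    have hlim0 : b i k₀ * -(M i 1 * ((k₀ + 1 : ℕ) + 1 / 2)) = 0 := by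
      refine tendsto_nhds_unique (hlim.congr' ?_) tendsto_const_nhds
      filter_upwards [hzero i] with p hp
      rw [← mul_zero ((p - x i) ^ (k₀ + 2)), ← hp, hΦ]
      simp only [mul_add, Finset.mul_sum]
      congr 1
      · exact Finset.sum_congr rfl fun j _ => by ring
      · refine Finset.sum_congr rfl fun j _ => Finset.sum_congr rfl fun k _ => ?_
        simp only [← Finset.mul_sum]
        ring
    have hpos : ((k₀ + 1 : ℕ) + 1 / 2 : ℂ) ≠ 0 := by
      have h : ((k₀ + 1 : ℕ) + 1 / 2 : ℂ) = (((k₀ + 1 : ℕ) + 1 / 2 : ℝ) : ℂ) := by push_cast; ring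
      rw [h]
      exact Complex.ofReal_ne_zero.2 (by positivity)
    exact (mul_ne_zero hk₀.2 (neg_ne_zero.2 (mul_ne_zero (hM i) hpos))) hlim0
  -- With all `b` gone, `a i` is the residue at x_i.
  refine ⟨fun i => ?_, hB⟩
  have hlim := hA i 0
  rw [if_pos rfl] at hlim
  refine tendsto_nhds_unique (hlim.congr' ?_) tendsto_const_nhds
  filter_upwards [hzero i] with p hp
  have h1 : Φ p = ∑ j, a j * (1 / (p - x j)) := by
    rw [hΦ]
    simp only
    rw [Finset.sum_eq_zero fun j _ => Finset.sum_eq_zero fun k hk => by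
      rw [hB j k (Finset.mem_range.1 hk), zero_mul], add_zero]
  rw [h1] at hp
  rw [pow_zero, one_mul, ← mul_zero (p - x i), ← hp, Finset.mul_sum]
  exact Finset.sum_congr rfl fun j _ => by ring

end Polar

/-! ### Injectivity of K̂ - 2W₀ on combinations of derivatives -/

namespace IsCutFamily

variable {U : Set ℝ[X]} {μ : ℝ[X] → Fin (2 * n) → ℝ} {c r : Fin (n - 1) → ℝ}
  (hU : IsCutFamily U μ c r) {V : ℝ[X]} (hV : V ∈ U)

/-- The combinations of derivatives, with the coefficients indexed by all natural numbers. -/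
def _root_.MultiCut.derivativeSum (μ : ℝ[X] → Fin (2 * n) → ℝ) (c r : Fin (n - 1) → ℝ) (V : ℝ[X])
    (K : ℕ) (a : Fin (2 * n) → ℂ) (b : Fin (2 * n) → ℕ → ℂ) (p : ℂ) : ℂ :=
  ∑ α, a α * branchDeriv μ c r V α p +
    ∑ α, ∑ k ∈ Finset.range K, b α k * momentDeriv μ c r V α (k + 1) p

include hU hV

/-- Coefficients extended by zero to all natural numbers let combinations with different numbers of
moments be added. -/
theorem isDerivativeCombination_iff (hn : 1 ≤ n) {f : ℂ → ℂ} :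
    IsDerivativeCombination μ V f ↔
      ∃ (K : ℕ) (a : Fin (2 * n) → ℂ) (b : Fin (2 * n) → ℕ → ℂ),
        (∀ α k, K ≤ k → b α k = 0) ∧ EqOn f (derivativeSum μ c r V K a b) (cuts (μ V))ᶜ := by
  have h1 : ∀ α, ∀ p ∉ cuts (μ V), dV μ (fMu μ α) V p = branchDeriv μ c r V α p := fun α p hp =>
    (hU.isLoopInsertion_branchDeriv hV hn α).dV_eq hp
  have h2 : ∀ α k, ∀ p ∉ cuts (μ V), dV μ (fMoment μ α k) V p = momentDeriv μ c r V α k p :=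
    fun α k p hp => (hU.isLoopInsertion_momentDeriv hV hn α k).dV_eq hp
  constructor
  · rintro ⟨K, a, b, h⟩
    refine ⟨K, a, fun α k => if hk : k < K then b α ⟨k, hk⟩ else 0, fun α k hk => ?_, fun p hp => ?_⟩
    · exact dif_neg (not_lt.2 hk)
    · rw [h p hp, derivativeSum]
      simp only [h1 _ p hp, h2 _ _ p hp]
      congr 1
      refine Finset.sum_congr rfl fun α _ => ?_
      rw [Finset.sum_range]
      exact Finset.sum_congr rfl fun k _ => by rw [dif_pos k.2]
  · rintro ⟨K, a, b, -, h⟩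
    refine ⟨K, a, fun α k => b α k, fun p hp => ?_⟩
    rw [h hp, derivativeSum]
    simp only [h1 _ p hp, h2 _ _ p hp]
    congr 1
    refine Finset.sum_congr rfl fun α _ => ?_
    rw [Finset.sum_range]

omit hU hV in
theorem _root_.MultiCut.derivativeSum_of_le {K K' : ℕ} (hK : K ≤ K') {a : Fin (2 * n) → ℂ}
    {b : Fin (2 * n) → ℕ → ℂ} (hb : ∀ α k, K ≤ k → b α k = 0) :
    derivativeSum μ c r V K' a b = derivativeSum μ c r V K a b := by
  ext p
  rw [derivativeSum, derivativeSum]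
  congr 1
  refine Finset.sum_congr rfl fun α _ => (Finset.sum_subset (Finset.range_subset_range.2 hK)
    fun k _ hk => ?_).symm
  rw [hb α k (by simpa using hk), zero_mul]

theorem isDerivativeCombination_sub (hn : 1 ≤ n) {f g : ℂ → ℂ} (hf : IsDerivativeCombination μ V f)
    (hg : IsDerivativeCombination μ V g) : IsDerivativeCombination μ V fun p => f p - g p := by
  rw [hU.isDerivativeCombination_iff hV hn] at *
  obtain ⟨K, a, b, hb, hf⟩ := hf
  obtain ⟨K', a', b', hb', hg⟩ := hg
  refine ⟨max K K', fun α => a α - a' α, fun α k => b α k - b' α k, fun α k hk => ?_, fun p hp => ?_⟩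
  · beta_reduce
    rw [hb α k (le_of_max_le_left hk), hb' α k (le_of_max_le_right hk), sub_zero]
  · beta_reduce
    rw [hf hp, hg hp, ← derivativeSum_of_le (le_max_left K K') hb,
      ← derivativeSum_of_le (le_max_right K K') hb']
    simp only [derivativeSum, sub_mul, Finset.sum_sub_distrib]
    ring

/-- A combination of derivatives in the kernel of `K̂ - 2 W₀` vanishes. -/
theorem eqOn_zero_of_loopOp_eq_zero (hn : 1 ≤ n) {f : ℂ → ℂ} (hf : IsDerivativeCombination μ V f)
    (h : ∀ p, ‖μ V‖ < ‖p‖ → loopOp (μ V) V f p = 0) : EqOn f 0 (cuts (μ V))ᶜ := by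
  have hμ := hU.strictMono V hV
  obtain ⟨K, a, b, -, hf⟩ := (hU.isDerivativeCombination_iff hV hn).1 hf
  have hb := fun α => (hU.isLoopInsertion_branchDeriv hV hn α).1
  have hm := fun α k => (hU.isLoopInsertion_momentDeriv hV hn α k).1
  have hx : Function.Injective fun α => (μ V α : ℂ) :=
    Complex.ofReal_injective.comp hμ.injective
  obtain ⟨ha0, hb0⟩ := coeff_eq_zero_of_polar hx (M := fun α => moment (μ V) V α)
    (hU.nonsingular V hV) (K := K) (a := a) (b := b) (C := ‖μ V‖) fun p hp => by
    rw [← h p hp, loopOp_congr hf hp]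
    unfold derivativeSum
    have hin : ∀ α, AnalyticOnNhd ℂ (fun z => ∑ k ∈ Finset.range K,
        b α k * momentDeriv μ c r V α (k + 1) z) (cuts (μ V))ᶜ := fun α z hz =>
      Finset.analyticAt_fun_sum _ fun k _ => analyticAt_const.fun_mul (hm α (k + 1) z hz)
    have hout := loopOp_sum (V := V) Finset.univ (fun _ => 1) (fun α _ => hin α) hp
    simp only [one_mul] at hout
    rw [loopOp_add (fun z hz => Finset.analyticAt_fun_sum _ fun α _ =>
        analyticAt_const.fun_mul (hb α z hz)) (fun z hz => Finset.analyticAt_fun_sum _ fun α _ =>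
        hin α z hz) hp, loopOp_sum _ _ (fun α _ => hb α) hp, hout]
    congr 1
    · simp only [hU.loopOp_branchDeriv hV hp]
    · refine Finset.sum_congr rfl fun α _ => ?_
      rw [loopOp_sum _ _ (fun k _ => hm α (k + 1)) hp]
      refine Finset.sum_congr rfl fun k _ => ?_
      rw [hU.loopOp_momentDeriv hV hn hp, loopOp_phi hμ hp]
  intro p hp
  rw [hf hp, derivativeSum, Finset.sum_eq_zero fun α _ => by rw [ha0, zero_mul],
    Finset.sum_eq_zero fun α _ => Finset.sum_eq_zero fun k hk => by
      rw [hb0 α k (Finset.mem_range.1 hk), zero_mul], add_zero, Pi.zero_apply]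

end IsCutFamily

end

section

variable {n : ℕ}

/-! ### The basis functions and the genus-one loop mean -/

/-- `d log |M_α^{(1)}| / dV(p)`. -/
def logMomentDeriv (μ : ℝ[X] → Fin (2 * n) → ℝ) (c r : Fin (n - 1) → ℝ) (V : ℝ[X])
    (α : Fin (2 * n)) (p : ℂ) : ℂ :=
  (moment (μ V) V α 1)⁻¹ * momentDeriv μ c r V α 1 p

/-- `d log |μ_α - μ_β| / dV(p)`. -/
def logDiffDeriv (μ : ℝ[X] → Fin (2 * n) → ℝ) (c r : Fin (n - 1) → ℝ) (V : ℝ[X])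
    (α β : Fin (2 * n)) (p : ℂ) : ℂ :=
  ((μ V α : ℂ) - μ V β)⁻¹ * (branchDeriv μ c r V α p - branchDeriv μ c r V β p)

/-- `χ_α^{(2)}`. -/
def basisTwo (μ : ℝ[X] → Fin (2 * n) → ℝ) (c r : Fin (n - 1) → ℝ) (V : ℝ[X]) (α : Fin (2 * n))
    (p : ℂ) : ℂ :=
  -(2 / 3) * logMomentDeriv μ c r V α p -
    1 / 3 * ∑ β ∈ Finset.univ.erase α, logDiffDeriv μ c r V α β p

/-- The genus-one loop mean. -/
def loopMeanOne (μ : ℝ[X] → Fin (2 * n) → ℝ) (c r : Fin (n - 1) → ℝ) (V : ℝ[X]) (p : ℂ) : ℂ :=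
  1 / 16 * ∑ α, basisTwo μ c r V α p
    - 1 / 8 * ∑ α, ∑ β ∈ Finset.Ioi α, logDiffDeriv μ c r V α β p
    + 1 / 4 * ∑ α, zeroModePoly (zeroModeCoeff (μ V) c r) α (μ V α) * branchDeriv μ c r V α p

namespace IsCutFamily

variable {U : Set ℝ[X]} {μ : ℝ[X] → Fin (2 * n) → ℝ} {c r : Fin (n - 1) → ℝ}
  (hU : IsCutFamily U μ c r) {V : ℝ[X]} (hV : V ∈ U) (hn : 1 ≤ n)
include hU hV hn

theorem isDerivativeCombination_congr {f g : ℂ → ℂ} (hf : IsDerivativeCombination μ V f)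
    (h : EqOn g f (cuts (μ V))ᶜ) : IsDerivativeCombination μ V g := by
  rw [hU.isDerivativeCombination_iff hV hn] at *
  obtain ⟨K, a, b, hb, hf⟩ := hf
  exact ⟨K, a, b, hb, h.trans hf⟩

theorem isDerivativeCombination_const_mul {f : ℂ → ℂ} (e : ℂ) (hf : IsDerivativeCombination μ V f) :
    IsDerivativeCombination μ V fun p => e * f p := by
  rw [hU.isDerivativeCombination_iff hV hn] at *
  obtain ⟨K, a, b, hb, hf⟩ := hf
  refine ⟨K, fun α => e * a α, fun α k => e * b α k, fun α k hk => ?_, fun p hp => ?_⟩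
  · beta_reduce
    rw [hb α k hk, mul_zero]
  · beta_reduce
    rw [hf hp]
    simp only [derivativeSum, mul_assoc, ← Finset.mul_sum]
    ring

theorem isDerivativeCombination_add {f g : ℂ → ℂ} (hf : IsDerivativeCombination μ V f)
    (hg : IsDerivativeCombination μ V g) : IsDerivativeCombination μ V fun p => f p + g p := by
  simpa using hU.isDerivativeCombination_sub hV hn hf
    (hU.isDerivativeCombination_const_mul hV hn (-1) hg)

theorem isDerivativeCombination_sum {ι : Type*} (s : Finset ι) {f : ι → ℂ → ℂ}
    (hf : ∀ i ∈ s, IsDerivativeCombination μ V (f i)) :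
    IsDerivativeCombination μ V fun p => ∑ i ∈ s, f i p := by
  classical
  induction s using Finset.induction_on with
  | empty =>
    rw [hU.isDerivativeCombination_iff hV hn]
    exact ⟨0, 0, 0, fun _ _ _ => rfl, fun p _ => by simp [derivativeSum]⟩
  | insert i s hi ih =>
    simp only [Finset.sum_insert hi]
    exact hU.isDerivativeCombination_add hV hn (hf i (Finset.mem_insert_self i s))
      (ih fun k hk => hf k (Finset.mem_insert_of_mem hk))

theorem isDerivativeCombination_branchDeriv (α : Fin (2 * n)) :
    IsDerivativeCombination μ V (branchDeriv μ c r V α) := by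
  rw [hU.isDerivativeCombination_iff hV hn]
  refine ⟨0, Pi.single α 1, 0, fun _ _ _ => rfl, fun p _ => ?_⟩
  simp [derivativeSum, Pi.single_apply]

theorem isDerivativeCombination_momentDeriv (α : Fin (2 * n)) (k : ℕ) :
    IsDerivativeCombination μ V (momentDeriv μ c r V α (k + 1)) := by
  rw [hU.isDerivativeCombination_iff hV hn]
  refine ⟨k + 1, 0, Pi.single α (Pi.single k 1), fun β m hm => ?_, fun p _ => ?_⟩
  · rcases eq_or_ne β α with rfl | h
    · rw [Pi.single_eq_same, Pi.single_eq_of_ne (by omega)]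
    · rw [Pi.single_eq_of_ne h, Pi.zero_apply]
  · rw [derivativeSum, Finset.sum_eq_single α (fun β _ h => ?_) (by simp)]
    · rw [Finset.sum_eq_single α (fun β _ h => ?_) (by simp)]
      · rw [Finset.sum_eq_single k (fun m _ h => ?_) (by simp)]
        · simp
        · simp [h]
      · simp [h]
    · simp

theorem isDerivativeCombination_logMomentDeriv (α : Fin (2 * n)) :
    IsDerivativeCombination μ V (logMomentDeriv μ c r V α) :=
  hU.isDerivativeCombination_const_mul hV hn _ (hU.isDerivativeCombination_momentDeriv hV hn α 0)

theorem isDerivativeCombination_logDiffDeriv (α β : Fin (2 * n)) :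
    IsDerivativeCombination μ V (logDiffDeriv μ c r V α β) :=
  hU.isDerivativeCombination_const_mul hV hn _ (hU.isDerivativeCombination_sub hV hn
    (hU.isDerivativeCombination_branchDeriv hV hn α) (hU.isDerivativeCombination_branchDeriv hV hn β))

theorem isDerivativeCombination_basisTwo (α : Fin (2 * n)) :
    IsDerivativeCombination μ V (basisTwo μ c r V α) :=
  hU.isDerivativeCombination_sub hV hn
    (hU.isDerivativeCombination_const_mul hV hn _ (hU.isDerivativeCombination_logMomentDeriv hV hn α))
    (hU.isDerivativeCombination_const_mul hV hn _ (hU.isDerivativeCombination_sum hV hn _ fun β _ =>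
      hU.isDerivativeCombination_logDiffDeriv hV hn α β))

theorem isDerivativeCombination_loopMeanOne :
    IsDerivativeCombination μ V (loopMeanOne μ c r V) :=
  hU.isDerivativeCombination_add hV hn (hU.isDerivativeCombination_sub hV hn
    (hU.isDerivativeCombination_const_mul hV hn _ (hU.isDerivativeCombination_sum hV hn _ fun α _ =>
      hU.isDerivativeCombination_basisTwo hV hn α))
    (hU.isDerivativeCombination_const_mul hV hn _ (hU.isDerivativeCombination_sum hV hn _ fun α _ =>
      hU.isDerivativeCombination_sum hV hn _ fun β _ =>
        hU.isDerivativeCombination_logDiffDeriv hV hn α β)))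
    (hU.isDerivativeCombination_const_mul hV hn _ (hU.isDerivativeCombination_sum hV hn _ fun α _ =>
      hU.isDerivativeCombination_const_mul hV hn _ (hU.isDerivativeCombination_branchDeriv hV hn α)))

theorem analyticOnNhd_of_isDerivativeCombination {f : ℂ → ℂ} (hf : IsDerivativeCombination μ V f) :
    AnalyticOnNhd ℂ f (cuts (μ V))ᶜ := by
  obtain ⟨K, a, b, -, hf⟩ := (hU.isDerivativeCombination_iff hV hn).1 hf
  have h : AnalyticOnNhd ℂ (derivativeSum μ c r V K a b) (cuts (μ V))ᶜ := fun p hp =>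
    (Finset.analyticAt_fun_sum _ fun α _ => analyticAt_const.fun_mul
      ((hU.isLoopInsertion_branchDeriv hV hn α).1 p hp)).fun_add
    (Finset.analyticAt_fun_sum _ fun α _ => Finset.analyticAt_fun_sum _ fun k _ =>
      analyticAt_const.fun_mul ((hU.isLoopInsertion_momentDeriv hV hn α (k + 1)).1 p hp))
  exact h.congr (isOpen_compl_cuts _) hf.symm

theorem loopOp_sub_of_combination {f g : ℂ → ℂ} (hf : IsDerivativeCombination μ V f)
    (hg : IsDerivativeCombination μ V g) {p : ℂ} (hp : ‖μ V‖ < ‖p‖) :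
    loopOp (μ V) V (fun z => f z - g z) p = loopOp (μ V) V f p - loopOp (μ V) V g p := by
  have h := loopOp_add (V := V) (hU.analyticOnNhd_of_isDerivativeCombination hV hn hf)
    (hU.analyticOnNhd_of_isDerivativeCombination hV hn
      (hU.isDerivativeCombination_const_mul hV hn (-1) hg)) hp
  rw [loopOp_const_mul] at h
  simpa [← sub_eq_add_neg] using h

theorem loopOp_sum_of_combination {ι : Type*} (s : Finset ι) {f : ι → ℂ → ℂ}
    (hf : ∀ i ∈ s, IsDerivativeCombination μ V (f i)) {p : ℂ} (hp : ‖μ V‖ < ‖p‖) :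
    loopOp (μ V) V (fun z => ∑ i ∈ s, f i z) p = ∑ i ∈ s, loopOp (μ V) V (f i) p := by
  simpa using loopOp_sum (V := V) s (fun _ => 1)
    (fun i hi => hU.analyticOnNhd_of_isDerivativeCombination hV hn (hf i hi)) hp

/-- A combination of derivatives is determined by its image under `K̂ - 2 W₀`. -/
theorem eqOn_of_loopOp_eq {f g : ℂ → ℂ} (hf : IsDerivativeCombination μ V f)
    (hg : IsDerivativeCombination μ V g)
    (h : ∀ p, ‖μ V‖ < ‖p‖ → loopOp (μ V) V f p = loopOp (μ V) V g p) : EqOn f g (cuts (μ V))ᶜ :=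
  fun _ hp => sub_eq_zero.1 (hU.eqOn_zero_of_loopOp_eq_zero hV hn
    (hU.isDerivativeCombination_sub hV hn hf hg) (fun p hp => by
      rw [hU.loopOp_sub_of_combination hV hn hf hg hp, h p hp, sub_self]) hp)

theorem loopOp_logDiffDeriv {p : ℂ} (hp : ‖μ V‖ < ‖p‖) {α β : Fin (2 * n)} (hαβ : α ≠ β) :
    loopOp (μ V) V (logDiffDeriv μ c r V α β) p = 1 / ((p - μ V α) * (p - μ V β)) := by
  have hμ := hU.strictMono V hV
  have hne : (μ V α : ℂ) - μ V β ≠ 0 := by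
    rw [sub_ne_zero]
    exact_mod_cast fun h => hαβ (hμ.injective h)
  have h1 := sub_branch_ne_zero hμ (notMem_cuts_of_lt hp) α
  have h2 := sub_branch_ne_zero hμ (notMem_cuts_of_lt hp) β
  unfold logDiffDeriv
  rw [loopOp_const_mul, hU.loopOp_sub_of_combination hV hn
    (hU.isDerivativeCombination_branchDeriv hV hn α) (hU.isDerivativeCombination_branchDeriv hV hn β)
    hp, hU.loopOp_branchDeriv hV hp, hU.loopOp_branchDeriv hV hp]
  field_simp
  ring

theorem loopOp_logMomentDeriv {p : ℂ} (hp : ‖μ V‖ < ‖p‖) (α : Fin (2 * n)) :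
    loopOp (μ V) V (logMomentDeriv μ c r V α) p =
      -(1 / (p - μ V α) * (1 / (p - μ V α) + 1 / 2 * ∑ β, 1 / (p - μ V β))) := by
  have hM := hU.nonsingular V hV α
  unfold logMomentDeriv
  rw [loopOp_const_mul, hU.loopOp_momentDeriv hV hn hp, loopOp_phi_succ (hU.strictMono V hV) hp,
    loopOp_phi_zero (hU.strictMono V hV) hp]
  simp only [zero_add, Nat.cast_one]
  field_simp

/-- The image of d log|M_α^{(1)}|/dV is -(3/2)(p - μ_α)⁻² - ½ ∑_{β≠α} 1/((p - μ_α)(p - μ_β)). The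
factor -2/3 normalises the double pole, and -1/3 times the logarithms of the differences removes the
rest. -/
theorem loopOp_basisTwo {p : ℂ} (hp : ‖μ V‖ < ‖p‖) (α : Fin (2 * n)) :
    loopOp (μ V) V (basisTwo μ c r V α) p = 1 / (p - μ V α) ^ 2 := by
  have h1 := sub_branch_ne_zero (hU.strictMono V hV) (notMem_cuts_of_lt hp) α
  have hL := fun β => hU.isDerivativeCombination_logDiffDeriv hV hn α β
  unfold basisTwo
  rw [hU.loopOp_sub_of_combination hV hn
    (hU.isDerivativeCombination_const_mul hV hn _ (hU.isDerivativeCombination_logMomentDeriv hV hn α))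
    (hU.isDerivativeCombination_const_mul hV hn _ (hU.isDerivativeCombination_sum hV hn _ fun β _ =>
      hL β)) hp, loopOp_const_mul, loopOp_const_mul,
    hU.loopOp_sum_of_combination hV hn _ (fun β _ => hL β) hp, hU.loopOp_logMomentDeriv hV hn hp,
    Finset.sum_congr rfl fun β hβ =>
      hU.loopOp_logDiffDeriv hV hn hp (Finset.ne_of_mem_erase hβ).symm,
    ← Finset.add_sum_erase _ _ (Finset.mem_univ α)]
  have h2 : ∑ β ∈ Finset.univ.erase α, 1 / ((p - μ V α) * (p - μ V β)) =
      1 / (p - μ V α) * ∑ β ∈ Finset.univ.erase α, 1 / (p - μ V β) := by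
    rw [Finset.mul_sum]
    exact Finset.sum_congr rfl fun β _ => by rw [one_div_mul_one_div]
  rw [h2]
  field_simp
  ring

theorem loopOp_loopMeanOne {p : ℂ} (hp : ‖μ V‖ < ‖p‖) :
    loopOp (μ V) V (loopMeanOne μ c r V) p =
      1 / 16 * ∑ α, 1 / (p - μ V α) ^ 2
        - 1 / 8 * ∑ α, ∑ β ∈ Finset.Ioi α, 1 / ((p - μ V α) * (p - μ V β))
        + 1 / 4 * ∑ α, zeroModePoly (zeroModeCoeff (μ V) c r) α (μ V α) * (1 / (p - μ V α)) := by
  have hb := hU.isDerivativeCombination_branchDeriv hV hn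
  have hL := hU.isDerivativeCombination_logDiffDeriv hV hn
  have hX := hU.isDerivativeCombination_basisTwo hV hn
  have hm := fun (e : ℂ) {f : ℂ → ℂ} (h : IsDerivativeCombination μ V f) =>
    hU.isDerivativeCombination_const_mul hV hn e h
  have hs := hU.isDerivativeCombination_sum hV hn (ι := Fin (2 * n))
  have c1 := hm (1 / 16) (hs Finset.univ fun α _ => hX α)
  have c2 := hm (1 / 8) (hs Finset.univ fun α _ => hs (Finset.Ioi α) fun β _ => hL α β)
  have c3 := hm (1 / 4) (hs Finset.univ fun α _ =>
    hm (zeroModePoly (zeroModeCoeff (μ V) c r) α (μ V α)) (hb α))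
  unfold loopMeanOne
  rw [loopOp_add (hU.analyticOnNhd_of_isDerivativeCombination hV hn
      (hU.isDerivativeCombination_sub hV hn c1 c2))
    (hU.analyticOnNhd_of_isDerivativeCombination hV hn c3) hp,
    hU.loopOp_sub_of_combination hV hn c1 c2 hp, loopOp_const_mul, loopOp_const_mul,
    loopOp_const_mul, hU.loopOp_sum_of_combination hV hn _ (fun α _ => hX α) hp,
    hU.loopOp_sum_of_combination hV hn _ (fun α _ => hs (Finset.Ioi α) fun β _ => hL α β) hp,
    hU.loopOp_sum_of_combination hV hn _ (fun α _ => hm _ (hb α)) hp]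
  simp only [hU.loopOp_basisTwo hV hn hp, loopOp_const_mul, hU.loopOp_branchDeriv hV hp]
  congr 3
  refine Finset.sum_congr rfl fun α _ => ?_
  rw [hU.loopOp_sum_of_combination hV hn _ (fun β _ => hL α β) hp]
  exact Finset.sum_congr rfl fun β hβ =>
    hU.loopOp_logDiffDeriv hV hn hp (Finset.mem_Ioi.1 hβ).ne

/-- The basis functions are characterised by their image under `K̂ - 2 W₀`. -/
theorem isBasisFunction_iff {g : ℂ → ℂ} (hg : IsDerivativeCombination μ V g) {α : Fin (2 * n)} {k : ℕ}
    (h : ∀ p, ‖μ V‖ < ‖p‖ → loopOp (μ V) V g p = 1 / (p - μ V α) ^ k) {f : ℂ → ℂ} :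
    IsBasisFunction μ V α k f ↔ EqOn f g (cuts (μ V))ᶜ :=
  ⟨fun hf => hU.eqOn_of_loopOp_eq hV hn hf.1 hg fun p hp => by rw [hf.2 p hp, h p hp],
    fun hfg => ⟨hU.isDerivativeCombination_congr hV hn hg hfg, fun p hp => by
      rw [loopOp_congr hfg hp, h p hp]⟩⟩

end IsCutFamily

end

section

variable {n : ℕ}

/-! ### The genus-one loop equation -/

theorem sum_sq_eq_add_sum_Ioi {m : ℕ} (u : Fin m → ℂ) :
    (∑ α, u α) ^ 2 = ∑ α, u α ^ 2 + 2 * ∑ α, ∑ β ∈ Finset.Ioi α, u α * u β := by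
  have h1 : ∀ α, ∑ β, u α * u β =
      u α ^ 2 + ∑ β ∈ Finset.Ioi α, u α * u β + ∑ β ∈ Finset.Iio α, u α * u β := fun α => by
    have h2 : (Finset.univ : Finset (Fin m)) =
        insert α (Finset.Ioi α ∪ Finset.Iio α) := by
      ext β
      rcases lt_trichotomy β α with h | h | h <;> simp [h]
    rw [h2, Finset.sum_insert (by simp), Finset.sum_union, ← add_assoc, sq]
    rw [Finset.disjoint_left]
    intro β hβ hβ'
    exact lt_asymm (Finset.mem_Ioi.1 hβ) (Finset.mem_Iio.1 hβ')
  have h3 : ∑ α, ∑ β ∈ Finset.Iio α, u α * u β = ∑ α, ∑ β ∈ Finset.Ioi α, u α * u β := by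
    rw [Finset.sum_comm' (t' := Finset.univ) (s' := fun β => Finset.Ioi β) (by simp)]
    exact Finset.sum_congr rfl fun α _ => Finset.sum_congr rfl fun β _ => mul_comm _ _
  rw [sq, Finset.sum_mul_sum, Finset.sum_congr rfl fun α _ => h1 α, Finset.sum_add_distrib,
    Finset.sum_add_distrib, h3]
  ring

section Fixed

variable {μ : Fin (2 * n) → ℝ} {c r : Fin (n - 1) → ℝ} (hμ : StrictMono μ)
include hμ

/-- In the i-th equation of the system for L the inhomogeneous part has degree below i in p, so the
coefficients of p^l with l > i must vanish. -/
theorem sum_pow_mul_zeroModeCoeff_eq_zero (hE : ∀ j, Encircles μ (cycleCut j) (c j) (r j))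
    (hn : 1 ≤ n) {i : ℕ} {l : Fin (n - 1)} (hi : i < l) :
    ∑ α, (μ α : ℂ) ^ i * zeroModeCoeff μ c r α l = 0 := by
  set P : ℂ[X] := ∑ m : Fin (n - 1),
    Polynomial.C (∑ α, (μ α : ℂ) ^ i * zeroModeCoeff μ c r α m) * Polynomial.X ^ (m : ℕ) with hP
  set Q : ℂ[X] := (∑ m ∈ Finset.range i,
    Polynomial.C (∑ α, (μ α : ℂ) ^ (i - m - 1)) * Polynomial.X ^ m) -
      Polynomial.C (2 * i : ℂ) * Polynomial.X ^ (i - 1) with hQ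
  have hPQ : P = Q := by
    refine Polynomial.funext fun p => ?_
    have h := sum_pow_mul_zeroModeCoeff hμ hE hn (k := i) (by omega) p
    simp only [hP, hQ, Polynomial.eval_finsetSum, Polynomial.eval_mul, Polynomial.eval_C,
      Polynomial.eval_pow, Polynomial.eval_X, Polynomial.eval_sub]
    simp only [zeroModePoly, Finset.mul_sum] at h
    rw [Finset.sum_comm, Finset.sum_comm (t := Finset.range i)] at h
    simp only [Finset.sum_mul]
    simp only [mul_assoc] at h ⊢
    linear_combination h
  have hc := congrArg (fun R => Polynomial.coeff R (l : ℕ)) hPQ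
  simp only [hP, hQ, Polynomial.finsetSum_coeff, Polynomial.coeff_sub,
    Polynomial.coeff_C_mul_X_pow] at hc
  rw [Finset.sum_eq_single l (fun m _ hm => if_neg fun h => hm (Fin.ext h.symm)) (by simp),
    if_pos rfl, Finset.sum_eq_zero fun m hm => if_neg (by
      rw [Finset.mem_range] at hm; omega), if_neg (by omega), sub_zero] at hc
  exact hc

/-- The difference is a polynomial, since (p^l - μ_α^l)/(p - μ_α) expands in μ_α^{l-1-i} p^i; its
coefficients are the vanishing sums just found. This makes dW₀/dV a combination of poles with
constant coefficients. -/
theorem sum_zeroModePoly_div (hE : ∀ j, Encircles μ (cycleCut j) (c j) (r j))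
    (hn : 1 ≤ n) {p : ℂ} (hp : p ∉ cuts μ) :
    ∑ α, zeroModePoly (zeroModeCoeff μ c r) α p * (1 / (p - μ α)) =
      ∑ α, zeroModePoly (zeroModeCoeff μ c r) α (μ α) * (1 / (p - μ α)) := by
  rw [← sub_eq_zero, ← Finset.sum_sub_distrib]
  have h1 : ∀ α, zeroModePoly (zeroModeCoeff μ c r) α p * (1 / (p - μ α)) -
      zeroModePoly (zeroModeCoeff μ c r) α (μ α) * (1 / (p - μ α)) =
      ∑ l : Fin (n - 1), ∑ i ∈ Finset.range l,
        p ^ i * ((μ α : ℂ) ^ ((l : ℕ) - 1 - i) * zeroModeCoeff μ c r α l) := fun α => by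
    have hne := sub_branch_ne_zero hμ hp α
    rw [← sub_mul, mul_one_div, div_eq_iff hne, zeroModePoly, zeroModePoly,
      ← Finset.sum_sub_distrib, Finset.sum_mul]
    refine Finset.sum_congr rfl fun l _ => ?_
    rw [← mul_sub, ← (Commute.all p (μ α : ℂ)).geom_sum₂_mul, ← mul_assoc, Finset.mul_sum]
    congr 1
    exact Finset.sum_congr rfl fun i _ => by ring
  rw [Finset.sum_congr rfl fun α _ => h1 α, Finset.sum_comm]
  refine Finset.sum_eq_zero fun l _ => ?_
  rw [Finset.sum_comm]
  refine Finset.sum_eq_zero fun i hi => ?_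
  rw [← Finset.mul_sum, sum_pow_mul_zeroModeCoeff_eq_zero hμ hE hn (by
    rw [Finset.mem_range] at hi; omega), mul_zero]

/-- The triple pole is the derivative of ½ (p - z)⁻²; integrating by parts brings out the
logarithmic derivative of 1/ỹ, that is -½ ∑ φ_β^{(1)}. -/
theorem contour_inv_ytilde_div_cube (hn : 1 ≤ n) {R : ℝ} (hR : ‖μ‖ < R) {p : ℂ} (hp : R < ‖p‖) :
    -contour R (fun z => (ytilde μ z)⁻¹ / (p - z) / (p - z) ^ 2) =
      1 / 4 * ∑ β, phiDeriv μ β 1 p := by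
  have hR0 : 0 ≤ R := (norm_nonneg _).trans hR.le
  have hs := sphere_off_cuts hR
  have hne : ∀ z : ℂ, ‖z‖ = R → p - z ≠ 0 := fun z hz h => by
    rw [sub_eq_zero.1 h, hz] at hp
    exact lt_irrefl _ hp
  have hinv : ContinuousOn (fun z : ℂ => (p - z)⁻¹) (sphere 0 R) :=
    ContinuousOn.fun_inv₀ (by fun_prop) fun z hz => hne z (by simpa using hz)
  have hb := continuousOn_finsetSum Finset.univ fun α _ => continuousOn_inv_sub_branch hμ hs α
  simp only [← one_div] at hb
  have h := contour_by_parts hR0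
    (fun z hz => hasDerivAt_inv_ytilde hμ (hs z (by simpa using hz)))
    (g := fun z => 1 / 2 * (p - z)⁻¹ ^ 2) (g' := fun z => (p - z)⁻¹ ^ 3) (fun z hz => by
      refine ((((hasDerivAt_id z).const_sub p).fun_inv (hne z hz)).fun_pow 2 |>.const_mul
        (1 / 2 : ℂ)).congr_deriv ?_
      have := hne z hz
      norm_num
      field_simp) ((continuousOn_const.fun_mul hb).fun_mul (continuousOn_inv_ytilde hμ hs))
      (hinv.fun_pow 3)
  have h1 : contour R (fun z => (ytilde μ z)⁻¹ / (p - z) / (p - z) ^ 2) =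
      contour R fun z => (ytilde μ z)⁻¹ * (p - z)⁻¹ ^ 3 := by
    refine contour_congr hR0 fun z hz => ?_
    have := hne z hz
    field_simp
  have h2 : contour R (fun z => -(1 / 2) * (∑ α, 1 / (z - μ α)) * (ytilde μ z)⁻¹ *
      (1 / 2 * (p - z)⁻¹ ^ 2)) =
      contour R fun z => ∑ β, (-(1 / 4) : ℂ) * (phi μ β 1 z / (p - z) ^ 2) := by
    refine contour_congr hR0 fun z hz => ?_
    rw [← Finset.mul_sum]
    have h3 : ∑ β, phi μ β 1 z / (p - z) ^ 2 =
        (∑ α, 1 / (z - μ α)) * ((ytilde μ z)⁻¹ * (p - z)⁻¹ ^ 2) := by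
      rw [Finset.sum_mul]
      refine Finset.sum_congr rfl fun β _ => ?_
      rw [phi_succ, phi_zero, inv_pow]
      ring
    rw [h3]
    ring
  rw [h1, h, neg_neg, h2, contour_sum_const_mul hR0]
  · rw [Finset.mul_sum]
    refine Finset.sum_congr rfl fun β _ => ?_
    rw [← contour_phi_div_sq hμ hn hR hp]
    ring
  · intro β _
    simp only [div_eq_mul_inv, ← inv_pow]
    exact (continuousOn_phi hμ hs β 1).fun_mul (hinv.fun_pow 2)

end Fixed

/-! ### The derivative dW₀/dV -/

namespace IsCutFamily

variable {U : Set ℝ[X]} {μ : ℝ[X] → Fin (2 * n) → ℝ} {c r : Fin (n - 1) → ℝ}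
  (hU : IsCutFamily U μ c r) {V : ℝ[X]} (hV : V ∈ U) (hn : 1 ≤ n)
include hU hV hn

/-- The term p^j from V' is the residue at p, so it moves the contour from outside |p| to inside. -/
theorem hasDerivAt_planarW {p : ℂ} (hp : ‖μ V‖ < ‖p‖) {R : ℝ} (hR : ‖μ V‖ < R) (hRp : R < ‖p‖)
    (j : ℕ) :
    HasDerivAt (fun s => planarW (μ (shift V j s)) (shift V j s) p)
      (1 / 2 * ytilde (μ V) p * contour R (fun z => z ^ j * ((ytilde (μ V) z)⁻¹ / (p - z))) +
        ∑ β, 1 / 4 * (moment (μ V) V β 1 * (ytilde (μ V) p / (p - μ V β))) *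
          branchVelocity μ V j β) 0 := by
  have hμ := hU.strictMono V hV
  have hpc := notMem_cuts_of_lt hp
  have hy := ytilde_ne_zero hμ hpc
  have h1 := hU.hasDerivAt_bigY hV hn hpc (hp.trans (lt_add_one _)) (lt_add_one _) j
  have h2 : HasDerivAt (fun s : ℝ => force (shift V j s) p) (p ^ j) 0 := by
    have := (((hasDerivAt_id (0 : ℝ)).ofReal_comp).mul_const (p ^ j)).const_add (force V p)
    simp only [force_shift]
    simpa using this
  refine ((h2.fun_sub h1).div_const 2).congr_deriv ?_
  have h3 := contour_annulus_cauchy (norm_nonneg (μ V)) (f := fun z => z ^ j * (ytilde (μ V) z)⁻¹)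
    (fun z hz => DifferentiableAt.fun_mul (by fun_prop)
      (differentiableAt_inv_ytilde hμ (notMem_cuts_of_lt hz))) hR hRp (lt_add_one _)
  have h4 : contour R (fun z => z ^ j * ((ytilde (μ V) z)⁻¹ / (p - z))) =
      -contour R fun z => z ^ j * (ytilde (μ V) z)⁻¹ / (z - p) := by
    rw [← contour_neg]
    congr 1
    ext z
    rw [← neg_sub z p, div_neg]
    ring
  have h5 : contour (‖p‖ + 1) (fun z => (z - p)⁻¹ * z ^ j * (ytilde (μ V) z)⁻¹) =
      contour (‖p‖ + 1) fun z => z ^ j * (ytilde (μ V) z)⁻¹ / (z - p) := by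
    congr 1
    ext z
    ring
  have h6 : ∑ β, 1 / 4 * (moment (μ V) V β 1 * (ytilde (μ V) p / (p - μ V β))) *
      branchVelocity μ V j β = 1 / 4 * ∑ β, (moment (μ V) V β 1 * branchVelocity μ V j β) *
          (ytilde (μ V) p / (p - μ V β)) := by
    rw [Finset.mul_sum]
    exact Finset.sum_congr rfl fun β _ => by ring
  rw [h4, h5, h6, sub_eq_iff_eq_add.1 h3, mul_add, mul_left_comm, mul_inv_cancel₀ hy]
  ring

/-- Summing the variation of W₀ over the couplings leaves a rational function of p, since the
factors ỹ(p) cancel; it equals the image of the claimed loop mean. -/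
theorem hasLoopInsertionAt_planarW {p : ℂ} (hp : ‖μ V‖ < ‖p‖) :
    HasLoopInsertionAt (fun V' => planarW (μ V') V' p) V p
      (loopOp (μ V) V (loopMeanOne μ c r V) p) := by
  have hμ := hU.strictMono V hV
  have hpc := notMem_cuts_of_lt hp
  have hy := ytilde_ne_zero hμ hpc
  obtain ⟨R, hR, hRp⟩ := exists_between hp
  have hR0 : 0 ≤ R := (norm_nonneg _).trans hR.le
  have hs := sphere_off_cuts hR
  have hc : ContinuousOn (fun z => (ytilde (μ V) z)⁻¹ / (p - z)) (sphere (0 : ℂ) R) := by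
    refine (continuousOn_inv_ytilde hμ hs).div (by fun_prop) fun z hz h => ?_
    rw [mem_sphere_zero_iff_norm, ← sub_eq_zero.1 h] at hz
    exact hRp.ne' hz
  have he := (hasSum_contour_insertion hR0 hc hRp).mul_left (1 / 2 * ytilde (μ V) p)
  rw [contour_inv_ytilde_div_cube hμ hn hR hRp] at he
  have h := hasLoopInsertionAt_add_sum (G := fun V' => planarW (μ V') V' p) (p := p)
    (g := fun β => fMu μ β) (s := Finset.univ)
    (a := fun β => 1 / 4 * (moment (μ V) V β 1 * (ytilde (μ V) p / (p - μ V β))))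
    (e := fun j => 1 / 2 * ytilde (μ V) p *
      contour R fun z => z ^ j * ((ytilde (μ V) z)⁻¹ / (p - z)))
    (fun β _ => (hU.isLoopInsertion_branchDeriv hV hn β).2 p hp)
    (he.congr_fun fun j => by ring) fun j => by
      simp only [hU.deriv_fMu hV]
      exact hU.hasDerivAt_planarW hV hn hp hR hRp j
  refine (congrArg _ ?_).mp h
  rw [hU.loopOp_loopMeanOne hV hn hp, ← sum_zeroModePoly_div hμ (hU.encircles hV) hn hpc]
  -- The explicit part contributes -(3/16) ∑ (p - μ_α)⁻² - (1/8) ∑_{α<β}, and the motion of the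
  -- branch points adds (1/4) ∑ (p - μ_α)⁻², leaving 1/16 and -1/8.
  have hsq := sum_sq_eq_add_sum_Ioi fun α => 1 / (p - μ V α)
  simp only [one_div_mul_one_div, one_div_pow] at hsq
  have h1 : ∑ β, 1 / 4 * (moment (μ V) V β 1 * (ytilde (μ V) p / (p - μ V β))) *
      branchDeriv μ c r V β p = 1 / 4 * (∑ β, 1 / (p - μ V β) ^ 2 +
        ∑ β, zeroModePoly (zeroModeCoeff (μ V) c r) β p * (1 / (p - μ V β))) := by
    rw [← Finset.sum_add_distrib, Finset.mul_sum]
    refine Finset.sum_congr rfl fun β _ => ?_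
    have hM := hU.nonsingular V hV β
    have hb := sub_branch_ne_zero hμ hpc β
    rw [branchDeriv, branchForm, phi, phiZero]
    field_simp
  have h2 : ytilde (μ V) p * ∑ β, phiDeriv (μ V) β 1 p =
      -∑ β, 1 / (p - μ V β) ^ 2 - 1 / 2 * (∑ β, 1 / (p - μ V β)) ^ 2 := by
    rw [sq (∑ β, _), Finset.sum_mul, Finset.mul_sum, Finset.mul_sum, ← Finset.sum_neg_distrib,
      ← Finset.sum_sub_distrib]
    refine Finset.sum_congr rfl fun β _ => ?_
    have hb := sub_branch_ne_zero hμ hpc β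
    have h3 : ∑ γ, phi (μ V) β 1 p / (p - μ V γ) = phi (μ V) β 1 p * ∑ γ, 1 / (p - μ V γ) := by
      rw [Finset.mul_sum]
      exact Finset.sum_congr rfl fun γ _ => by ring
    rw [phiDeriv, h3, phi, phi]
    field_simp
    ring
  rw [h1]
  linear_combination (1 / 8) * h2 - (1 / 16) * hsq

end IsCutFamily

end

section

variable {n : ℕ}

/-! ### The variation of the determinant of the periods -/

section Det

variable {m : Type*} [Fintype m] [DecidableEq m]

/-- A nontrivial permutation moves at least two indices, so after differentiating one factor an
off-diagonal entry of the identity remains. Only the diagonal term contributes. -/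
theorem hasDerivAt_det_of_eq_one {N : ℝ → Matrix m m ℂ} {B : Matrix m m ℂ} (h0 : N 0 = 1)
    (hN : ∀ i j, HasDerivAt (fun s => N s i j) (B i j) 0) :
    HasDerivAt (fun s => (N s).det) B.trace 0 := by
  have h1 : HasDerivAt (fun s => ∑ σ : Equiv.Perm m, ((Equiv.Perm.sign σ : ℤ) : ℂ) *
      ∏ i, N s (σ i) i) (∑ σ : Equiv.Perm m, ((Equiv.Perm.sign σ : ℤ) : ℂ) *
      ∑ i, (∏ j ∈ Finset.univ.erase i, N 0 (σ j) j) • B (σ i) i) 0 :=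
    HasDerivAt.fun_sum fun σ _ => (HasDerivAt.fun_finsetProd fun i _ => hN (σ i) i).const_mul _
  simp only [← Matrix.det_apply'] at h1
  refine h1.congr_deriv ?_
  rw [Finset.sum_eq_single 1 (fun σ _ hσ => ?_) (by simp)]
  · rw [Equiv.Perm.sign_one]
    simp [h0, Matrix.trace]
  · rw [Finset.sum_eq_zero fun i _ => ?_, mul_zero]
    obtain ⟨j, hji, hj⟩ : ∃ j, j ≠ i ∧ σ j ≠ j := by
      by_contra! hall
      refine hσ (Equiv.ext fun j => ?_)
      by_cases hj : j = i
      · subst hj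
        by_contra hne
        have h2 := hall (σ j) hne
        exact hne (σ.injective h2)
      · exact hall j hj
    rw [Finset.prod_eq_zero (Finset.mem_erase.2 ⟨hji, Finset.mem_univ j⟩)
      (by rw [h0, Matrix.one_apply_ne hj]), zero_smul]

theorem hasDerivAt_det {A : ℝ → Matrix m m ℂ} {B : Matrix m m ℂ} (h0 : (A 0).det ≠ 0)
    (hA : ∀ i j, HasDerivAt (fun s => A s i j) ((B * A 0) i j) 0) :
    HasDerivAt (fun s => (A s).det) (B.trace * (A 0).det) 0 := by
  have hu : IsUnit (A 0).det := h0.isUnit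
  have h1 : HasDerivAt (fun s => (A s * (A 0)⁻¹).det) B.trace 0 := by
    refine hasDerivAt_det_of_eq_one (Matrix.mul_nonsing_inv _ hu) fun i j => ?_
    have h2 : B i j = ∑ k, (B * A 0) i k * (A 0)⁻¹ k j := by
      rw [← Matrix.mul_apply, Matrix.mul_assoc, Matrix.mul_nonsing_inv _ hu, Matrix.mul_one]
    rw [h2]
    exact (HasDerivAt.fun_sum fun k _ => (hA i k).mul_const _).congr_of_eventuallyEq
      (Eventually.of_forall fun s => Matrix.mul_apply)
  refine (h1.mul_const (A 0).det).congr_of_eventuallyEq (Eventually.of_forall fun s => ?_)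
  simp only [← Matrix.det_mul, Matrix.mul_assoc, Matrix.nonsing_inv_mul _ hu, Matrix.mul_one]

end Det

/-! ### The variation matrix of the periods and its trace -/

section Fixed

variable {μ : Fin (2 * n) → ℝ} {c r : Fin (n - 1) → ℝ}

/-- The matrix `B` with `2 ∂K/∂μ_β = B K`, where `K` is the matrix of the periods. -/
def periodVariation (μ : Fin (2 * n) → ℝ) (c r : Fin (n - 1) → ℝ) (β : Fin (2 * n))
    (l m : Fin (n - 1)) : ℂ :=
  (if m < l then (μ β : ℂ) ^ ((l : ℕ) - 1 - m) else 0) -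
    (μ β : ℂ) ^ (l : ℕ) * zeroModeCoeff μ c r β m

theorem sum_periodVariation_diag (β : Fin (2 * n)) :
    ∑ l, periodVariation μ c r β l l = -zeroModePoly (zeroModeCoeff μ c r) β (μ β) := by
  rw [zeroModePoly, ← Finset.sum_neg_distrib]
  refine Finset.sum_congr rfl fun l _ => ?_
  rw [periodVariation, if_neg (lt_irrefl l)]
  ring

variable (hμ : StrictMono μ) (hE : ∀ j, Encircles μ (cycleCut j) (c j) (r j))
include hμ hE

/-- Dividing z^l by z - μ_β leaves a polynomial, hence known periods, plus μ_β^l φ_β^{(1)}, whose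
periods are by definition minus those of L_β φ^{(0)}. -/
theorem circleIntegral_pow_mul_phi (β : Fin (2 * n)) (l j : Fin (n - 1)) :
    ∮ z in C((c j : ℂ), r j), z ^ (l : ℕ) * phi μ β 1 z =
      ∑ m, periodVariation μ c r β l m * period μ c r m j := by
  have hr := (hE j).pos.le
  have hs : ∀ z ∈ sphere (c j : ℂ) (r j), z ∉ cuts μ := fun z hz => (hE j).sphere_notMem_cuts hμ hz
  have h1 : ∀ z ∈ sphere (c j : ℂ) (r j), z ^ (l : ℕ) * phi μ β 1 z =
      (∑ m : Fin (n - 1), (if m < l then (μ β : ℂ) ^ ((l : ℕ) - 1 - m) else 0) * z ^ (m : ℕ)) /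
        ytilde μ z + (μ β : ℂ) ^ (l : ℕ) * phi μ β 1 z := fun z hz => by
    have hne := sub_branch_ne_zero hμ (hs z hz) β
    have hy := ytilde_ne_zero hμ (hs z hz)
    have h2 : ∑ m : Fin (n - 1), (if m < l then (μ β : ℂ) ^ ((l : ℕ) - 1 - m) else 0) * z ^ (m : ℕ) =
        ∑ m ∈ Finset.range l, z ^ m * (μ β : ℂ) ^ ((l : ℕ) - 1 - m) := by
      have h3 : ∑ m : Fin (n - 1), (if m < l then (μ β : ℂ) ^ ((l : ℕ) - 1 - m) else 0) *
          z ^ (m : ℕ) = ∑ m ∈ Finset.range (n - 1),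
            (if m < (l : ℕ) then z ^ m * (μ β : ℂ) ^ ((l : ℕ) - 1 - m) else 0) := by
        rw [Finset.sum_range]
        refine Finset.sum_congr rfl fun m _ => ?_
        simp only [Fin.lt_def]
        split_ifs <;> ring
      rw [h3, ← Finset.sum_filter]
      congr 1
      ext m
      simp only [Finset.mem_filter, Finset.mem_range]
      omega
    have h4 := (Commute.all z (μ β : ℂ)).geom_sum₂_mul (l : ℕ)
    rw [h2, phi, pow_one]
    field_simp
    linear_combination -h4
  rw [circleIntegral.integral_congr hr h1, circleIntegral.integral_add, circleIntegral.integral_const_mul,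
    circleIntegral_sum_div_ytilde hμ hE]
  · have h5 := sum_zeroModeCoeff_mul_period hμ hE β j
    rw [phiPeriod] at h5
    simp only [periodVariation, sub_mul, Finset.sum_sub_distrib, mul_assoc]
    rw [← Finset.mul_sum, h5]
    ring
  · refine ContinuousOn.circleIntegrable hr ?_
    simp only [div_eq_mul_inv]
    exact ContinuousOn.mul (by fun_prop) (continuousOn_inv_ytilde hμ hs)
  · exact (continuousOn_const.fun_mul (continuousOn_phi hμ hs β 1)).circleIntegrable hr

theorem star_period (l j : Fin (n - 1)) : star (period μ c r l j) = -period μ c r l j := by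
  refine conj_circleIntegral (hE j).pos.le fun z hz => ?_
  rw [ytilde_star hμ ((hE j).sphere_notMem_cuts hμ hz), star_div₀, star_pow]

/-- The periods are purely imaginary, so the determinant is real or imaginary according to the
parity of n - 1. -/
theorem star_det_periodMatrix :
    star (periodMatrix μ c r).det = (-1) ^ (n - 1) * (periodMatrix μ c r).det := by
  have h1 : (periodMatrix μ c r).map (starRingEnd ℂ) = -periodMatrix μ c r := by
    ext l j
    exact star_period hμ hE l j
  rw [← starRingEnd_apply, RingHom.map_det, RingHom.mapMatrix_apply, h1, Matrix.det_neg,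
    Fintype.card_fin]

end Fixed

theorem hasDerivAt_period {γ : ℝ → Fin (2 * n) → ℝ} {v : Fin (2 * n) → ℝ} {c r : Fin (n - 1) → ℝ}
    (hγ : HasDerivAt γ v 0) (hm : ∀ᶠ s in 𝓝 0, StrictMono (γ s))
    (hE : ∀ j, Encircles (γ 0) (cycleCut j) (c j) (r j)) (l j : Fin (n - 1)) :
    HasDerivAt (fun s => period (γ s) c r l j)
      (∑ β, 1 / 2 * v β * ∑ m, periodVariation (γ 0) c r β l m * period (γ 0) c r m j) 0 := by
  have hμ := hm.self_of_nhds
  have hr := (hE j).pos.le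
  have hs : ∀ z ∈ sphere (c j : ℂ) (r j), z ∉ cuts (γ 0) := fun z hz =>
    (hE j).sphere_notMem_cuts hμ hz
  -- Some branch point is needed only to write 1/ỹ as a φ_α^{(0)}.
  have hpos : 0 < 2 * n := by have := l.2; omega
  have hc : ∀ β, ContinuousOn (fun z => z ^ (l : ℕ) * phi (γ 0) β 1 z) (sphere (c j : ℂ) (r j)) :=
    fun β => ContinuousOn.mul (by fun_prop) (continuousOn_phi hμ hs β 1)
  have h1 := hasDerivAt_circleIntegral_comp (𝕜 := ℝ) (c := c j) (R := r j)
    (f := fun (m : Fin (2 * n) → ℝ) z => z ^ (l : ℕ) * phi m ⟨0, hpos⟩ 0 z) hr hγ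
    (fun z hz => ContDiffAt.mul (contDiffAt_snd.pow (l : ℕ)) (contDiffAt_phi hμ (hs z hz) _ 0))
    (fun z => ∑ β, 1 / 2 * v β * (z ^ (l : ℕ) * phi (γ 0) β 1 z)) fun z hz => by
      refine ((hasDerivAt_phi_comp hγ hm (hs z hz) ⟨0, hpos⟩ 0).const_mul _).congr_deriv ?_
      simp only [phi_succ, phi_zero, Finset.mul_sum, Nat.cast_zero, zero_mul, add_zero]
      exact Finset.sum_congr rfl fun β _ => by ring
  rw [circleIntegral.integral_fun_sum fun β _ =>
    (continuousOn_const.fun_mul (hc β)).circleIntegrable hr] at h1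
  simp only [circleIntegral.integral_const_mul, circleIntegral_pow_mul_phi hμ hE] at h1
  refine h1.congr_of_eventuallyEq (Eventually.of_forall fun s => ?_)
  simp only [period, phi_zero, div_eq_mul_inv]

/-- `log |det K|`, where `K` is the matrix of the periods. -/
def logDet (c r : Fin (n - 1) → ℝ) (m : Fin (2 * n) → ℝ) : ℂ :=
  (Real.log ‖(periodMatrix m c r).det‖ : ℂ)

namespace IsCutFamily

variable {U : Set ℝ[X]} {μ : ℝ[X] → Fin (2 * n) → ℝ} {c r : Fin (n - 1) → ℝ}
  (hU : IsCutFamily U μ c r) {V : ℝ[X]} (hV : V ∈ U) (hn : 1 ≤ n)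
include hU hV hn

/-- Jacobi's formula: the logarithmic derivative of the determinant is the trace of the variation
matrix, and only the L_β part meets the diagonal, which gives -½ L_β(μ_β) per branch point. -/
theorem isLoopInsertion_logDet :
    IsLoopInsertion μ (fun V' => logDet c r (μ V')) V fun p =>
      ∑ β, -(1 / 2) * zeroModePoly (zeroModeCoeff (μ V) c r) β (μ V β) * branchDeriv μ c r V β p := by
  have hμ := hU.strictMono V hV
  have hE := hU.encircles hV
  refine isLoopInsertion_sum (g := fun β => fMu μ β)
    (fun β _ => hU.isLoopInsertion_branchDeriv hV hn β) fun j => ?_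
  simp only [hU.deriv_fMu hV]
  have hdet := det_periodMatrix_ne_zero hμ hE
  set B : Matrix (Fin (n - 1)) (Fin (n - 1)) ℂ := Matrix.of fun l m =>
    ∑ β, 1 / 2 * branchVelocity μ V j β * periodVariation (μ V) c r β l m with hB
  have h1 : HasDerivAt (fun s => (periodMatrix (μ (shift V j s)) c r).det)
      (B.trace * (periodMatrix (μ (shift V j 0)) c r).det) 0 := by
    refine hasDerivAt_det (A := fun s => periodMatrix (μ (shift V j s)) c r)
      (by simpa only [shift_zero] using hdet) fun l i => ?_
    have h2 := hasDerivAt_period (hU.hasDerivAt_curve hV j) (hU.eventually_strictMono hV j)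
      (by simpa only [shift_zero] using hE) l i
    simp only [shift_zero] at h2 ⊢
    refine h2.congr_deriv ?_
    simp only [Matrix.mul_apply, hB, Matrix.of_apply, periodMatrix, Finset.mul_sum, Finset.sum_mul]
    rw [Finset.sum_comm]
    exact Finset.sum_congr rfl fun _ _ => Finset.sum_congr rfl fun _ _ => by ring
  have h3 := hasDerivAt_log_norm h1 (by simpa only [shift_zero] using hdet) (by
    filter_upwards [hU.isOpen V hV j] with s hs
    have hsgn : ((-1 : ℂ) ^ (n - 1)) ≠ 0 := pow_ne_zero _ (by norm_num)
    rw [star_div₀, star_det_periodMatrix (hU.strictMono _ hs) (hU.encircles hs), shift_zero,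
      star_det_periodMatrix hμ hE, mul_div_mul_left _ _ hsgn])
  refine h3.congr_deriv ?_
  rw [shift_zero, mul_div_cancel_right₀ _ hdet, Matrix.trace]
  simp only [Matrix.diag_apply, hB, Matrix.of_apply]
  rw [Finset.sum_comm]
  refine Finset.sum_congr rfl fun β _ => ?_
  rw [← Finset.mul_sum, sum_periodVariation_diag]
  ring

end IsCutFamily

end

section

variable {n : ℕ}

/-! ### The free energy and the characterisation of the loop mean -/

section Closure

variable {μ : ℝ[X] → Fin (2 * n) → ℝ} {V : ℝ[X]}

theorem IsLoopInsertion.differentiableAt {G : ℝ[X] → ℂ} {f : ℂ → ℂ} (h : IsLoopInsertion μ G V f)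
    (j : ℕ) : DifferentiableAt ℝ (fun s : ℝ => G (shift V j s)) 0 := by
  obtain ⟨p, hp⟩ := NormedSpace.exists_lt_norm ℝ ℂ ‖μ V‖
  exact (h.2 p hp).1 j

theorem IsLoopInsertion.fun_const_mul {G : ℝ[X] → ℂ} {f : ℂ → ℂ} (h : IsLoopInsertion μ G V f)
    (a : ℂ) : IsLoopInsertion μ (fun V' => a * G V') V fun p => a * f p :=
  h.const_mul fun j => (h.differentiableAt j).hasDerivAt.const_mul a

theorem isLoopInsertion_fun_sum {ι : Type*} (s : Finset ι) {G : ι → ℝ[X] → ℂ} {f : ι → ℂ → ℂ}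
    (h : ∀ i ∈ s, IsLoopInsertion μ (G i) V (f i)) :
    IsLoopInsertion μ (fun V' => ∑ i ∈ s, G i V') V fun p => ∑ i ∈ s, f i p := by
  have h1 := isLoopInsertion_sum (G := fun V' => ∑ i ∈ s, G i V') (a := fun _ => 1) h fun j => by
    simpa using HasDerivAt.fun_sum fun i hi => ((h i hi).differentiableAt j).hasDerivAt
  simpa using h1

theorem IsLoopInsertion.fun_sub {G₁ G₂ : ℝ[X] → ℂ} {f₁ f₂ : ℂ → ℂ} (h₁ : IsLoopInsertion μ G₁ V f₁)
    (h₂ : IsLoopInsertion μ G₂ V f₂) :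
    IsLoopInsertion μ (fun V' => G₁ V' - G₂ V') V fun p => f₁ p - f₂ p :=
  h₁.sub h₂ h₁.differentiableAt h₂.differentiableAt

end Closure

/-- The genus-one free energy as a function of the branch points and the first moments. -/
def freeEnergyOne (c r : Fin (n - 1) → ℝ)
    (q : (Fin (2 * n) → ℝ) × (Fin (2 * n) → Fin 1 → ℂ)) : ℂ :=
  -(1 / 24) * ∑ α, (Real.log ‖q.2 α 0‖ : ℂ)
    - 1 / 6 * ∑ α, ∑ β ∈ Finset.Ioi α, (Real.log |q.1 α - q.1 β| : ℂ) - 1 / 2 * logDet c r q.1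

theorem differentiableAt_logDet {μ : Fin (2 * n) → ℝ} {c r : Fin (n - 1) → ℝ} (hμ : StrictMono μ)
    (hE : ∀ j, Encircles μ (cycleCut j) (c j) (r j)) : DifferentiableAt ℝ (logDet c r) μ := by
  have hp : ∀ l j, DifferentiableAt ℝ (fun m : Fin (2 * n) → ℝ => periodMatrix m c r l j) μ := by
    intro l j
    have h := hasFDerivAt_circleIntegral (𝕜 := ℝ) (c := c j) (R := r j) (x₀ := μ)
      (f := fun (m : Fin (2 * n) → ℝ) z => z ^ (l : ℕ) * (ytilde m z)⁻¹) fun z hz =>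
        ContDiffAt.mul (contDiffAt_snd.pow (l : ℕ)) (contDiffAt_inv_ytilde hμ (by
          rw [abs_of_pos (hE j).pos] at hz
          exact (hE j).sphere_notMem_cuts hμ hz))
    exact h.differentiableAt
  have hdet : DifferentiableAt ℝ (fun m : Fin (2 * n) → ℝ => (periodMatrix m c r).det) μ := by
    simp only [Matrix.det_apply']
    exact DifferentiableAt.fun_sum fun σ _ => DifferentiableAt.const_mul
      (HasFDerivAt.finsetProd (u := Finset.univ) (g := fun i (m : Fin (2 * n) → ℝ) =>
        periodMatrix m c r (σ i) i) fun i _ => (hp (σ i) i).hasFDerivAt).differentiableAt _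
  have h0 := det_periodMatrix_ne_zero hμ hE
  exact Complex.ofRealCLM.differentiableAt.comp μ
    ((hdet.norm ℂ h0).log (norm_ne_zero_iff.2 h0))

theorem differentiableAt_freeEnergyOne {μ : Fin (2 * n) → ℝ} {c r : Fin (n - 1) → ℝ}
    (hμ : StrictMono μ) (hE : ∀ j, Encircles μ (cycleCut j) (c j) (r j))
    {M : Fin (2 * n) → Fin 1 → ℂ} (hM : ∀ α, M α 0 ≠ 0) :
    DifferentiableAt ℝ (freeEnergyOne c r) (μ, M) := by
  have h1 : ∀ α, DifferentiableAt ℝ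
      (fun q : (Fin (2 * n) → ℝ) × (Fin (2 * n) → Fin 1 → ℂ) => (Real.log ‖q.2 α 0‖ : ℂ)) (μ, M) :=
    fun α => by
    have h : DifferentiableAt ℝ
        (fun q : (Fin (2 * n) → ℝ) × (Fin (2 * n) → Fin 1 → ℂ) => q.2 α 0) (μ, M) := by fun_prop
    exact Complex.ofRealCLM.differentiableAt.comp (μ, M)
      ((h.norm ℂ (hM α)).log (norm_ne_zero_iff.2 (hM α)))
  have h2 : ∀ α, ∀ β ∈ Finset.Ioi α, DifferentiableAt ℝ
      (fun q : (Fin (2 * n) → ℝ) × (Fin (2 * n) → Fin 1 → ℂ) =>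
        (Real.log |q.1 α - q.1 β| : ℂ)) (μ, M) := fun α β hβ => by
    have hne : μ α - μ β ≠ 0 := sub_ne_zero.2 (hμ (Finset.mem_Ioi.1 hβ)).ne
    simp only [Real.log_abs]
    have h : DifferentiableAt ℝ
        (fun q : (Fin (2 * n) → ℝ) × (Fin (2 * n) → Fin 1 → ℂ) => q.1 α - q.1 β) (μ, M) := by fun_prop
    exact Complex.ofRealCLM.differentiableAt.comp (μ, M) (h.log hne)
  have h3 : DifferentiableAt ℝ
      (fun q : (Fin (2 * n) → ℝ) × (Fin (2 * n) → Fin 1 → ℂ) => logDet c r q.1) (μ, M) :=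
    DifferentiableAt.comp (g := logDet c r) (f := Prod.fst) (μ, M) (differentiableAt_logDet hμ hE)
      differentiableAt_fst
  exact (((DifferentiableAt.fun_sum fun α _ => h1 α).const_mul _).sub
    ((DifferentiableAt.fun_sum fun α _ => DifferentiableAt.fun_sum (h2 α)).const_mul _)).sub
    (h3.const_mul _)

namespace IsCutFamily

variable {U : Set ℝ[X]} {μ : ℝ[X] → Fin (2 * n) → ℝ} {c r : Fin (n - 1) → ℝ}
  (hU : IsCutFamily U μ c r)
include hU

section

variable {V : ℝ[X]} (hV : V ∈ U) (hn : 1 ≤ n)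
include hV hn

/-- The three parts of F₁ reproduce the three sums in the loop mean; in particular the terms with
L_α(μ_α) integrate to -½ log|det K|. -/
theorem isLoopInsertion_freeEnergyOne :
    IsLoopInsertion μ (fun V' => freeEnergyOne c r (μ V', fun α k => moment (μ V') V' α (k + 1))) V
      (loopMeanOne μ c r V) := by
  have h1 : ∀ α, IsLoopInsertion μ (fLogM μ α) V (logMomentDeriv μ c r V α) := fun α =>
    hU.isLoopInsertion_fLogM hV hn α
  have h2 : ∀ α, ∀ β ∈ Finset.Ioi α, IsLoopInsertion μ (fLogDiff μ α β) V (logDiffDeriv μ c r V α β) :=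
    fun α β hβ => hU.isLoopInsertion_fLogDiff hV hn (Finset.mem_Ioi.1 hβ).ne'
  have h3 := hU.isLoopInsertion_logDet hV hn
  have h := (((isLoopInsertion_fun_sum Finset.univ fun α _ => h1 α).fun_const_mul (-(1 / 24))).fun_sub
    ((isLoopInsertion_fun_sum Finset.univ fun α _ =>
      isLoopInsertion_fun_sum (Finset.Ioi α) (h2 α)).fun_const_mul (1 / 6))).fun_sub
    (h3.fun_const_mul (1 / 2))
  refine IsLoopInsertion.congr (f := _) h fun p _ => ?_
  have hsym : ∀ α β, logDiffDeriv μ c r V α β p = logDiffDeriv μ c r V β α p := fun α β => by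
    rw [logDiffDeriv, logDiffDeriv, ← neg_sub (μ V β : ℂ), inv_neg]
    ring
  -- The sum inside χ^{(2)} counts each unordered pair twice, so the total weight of log|μ_α - μ_β|
  -- is -2/48 - 1/8 = -1/6.
  have h4 : ∑ α, ∑ β ∈ Finset.univ.erase α, logDiffDeriv μ c r V α β p =
      2 * ∑ α, ∑ β ∈ Finset.Ioi α, logDiffDeriv μ c r V α β p := by
    have h5 : ∀ α, ∑ β ∈ Finset.univ.erase α, logDiffDeriv μ c r V α β p =
        ∑ β ∈ Finset.Ioi α, logDiffDeriv μ c r V α β p +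
          ∑ β ∈ Finset.Iio α, logDiffDeriv μ c r V α β p := fun α => by
      rw [← Finset.sum_union]
      · congr 1
        ext β
        rcases lt_trichotomy β α with h | h | h
        · simp [h, h.ne]
        · simp [h]
        · simp [h, h.ne']
      · rw [Finset.disjoint_left]
        intro β hβ hβ'
        exact lt_asymm (Finset.mem_Ioi.1 hβ) (Finset.mem_Iio.1 hβ')
    have h6 : ∑ α, ∑ β ∈ Finset.Iio α, logDiffDeriv μ c r V α β p =
        ∑ α, ∑ β ∈ Finset.Ioi α, logDiffDeriv μ c r V α β p := by
      rw [Finset.sum_comm' (t' := Finset.univ) (s' := fun β => Finset.Ioi β) (by simp)]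
      exact Finset.sum_congr rfl fun α _ => Finset.sum_congr rfl fun β _ => hsym _ _
    rw [Finset.sum_congr rfl fun α _ => h5 α, Finset.sum_add_distrib, h6]
    ring
  have h7 : ∑ β, -(1 / 2) * zeroModePoly (zeroModeCoeff (μ V) c r) β (μ V β) *
      branchDeriv μ c r V β p = -(1 / 2) *
        ∑ β, zeroModePoly (zeroModeCoeff (μ V) c r) β (μ V β) * branchDeriv μ c r V β p := by
    rw [Finset.mul_sum]
    exact Finset.sum_congr rfl fun β _ => by ring
  simp only [h7, loopMeanOne, basisTwo, Finset.sum_sub_distrib, ← Finset.mul_sum, h4]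
  ring

/-- The chain rule. F is only real-differentiable in the complex moment variables, but the moments
stay real along U, so just the derivative of F in real directions enters and gives complex
coefficients. -/
theorem isDerivativeCombination_of_total {K : ℕ}
    {F : (Fin (2 * n) → ℝ) × (Fin (2 * n) → Fin K → ℂ) → ℂ} {f : ℂ → ℂ}
    (hF : DifferentiableAt ℝ F (μ V, fun α k => moment (μ V) V α (k + 1)))
    (hf : IsLoopInsertion μ (fun V' => F (μ V', fun α k => moment (μ V') V' α (k + 1))) V f) :
    IsDerivativeCombination μ V f := by
  obtain ⟨F', hF'⟩ := hF
  have hμd := fun j => hU.hasDerivAt_curve hV j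
  -- The moments are fixed by conjugation, so their partial derivatives are real numbers; this is
  -- needed to pull them out of the real-linear map `F'`.
  have hmd : ∀ j α k, ∃ d : ℝ, HasDerivAt (fun s => fMoment μ α k (shift V j s)) (d : ℂ) 0 :=
    fun j α k => by
    have h1 := (hU.hasDerivAt_fMoment hV α k j).differentiableAt.hasDerivAt
    refine ⟨_, (((Complex.reCLM.hasFDerivAt.comp_hasDerivAt (0 : ℝ) h1).ofReal_comp
      ).congr_of_eventuallyEq ?_)⟩
    filter_upwards [hU.eventually_strictMono hV j] with s hs
    exact (Complex.conj_eq_iff_re.1 (star_moment hs _ α k)).symm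
  choose d hd using hmd
  set a : Fin (2 * n) → ℂ := fun α => F' (Pi.single α 1, 0)
  set b : Fin (2 * n) → Fin K → ℂ := fun α k => F' (0, Pi.single α (Pi.single k 1))
  have hlin : ∀ (v : Fin (2 * n) → ℝ) (e : Fin (2 * n) → Fin K → ℝ),
      F' (v, fun α k => (e α k : ℂ)) = ∑ α, a α * v α + ∑ α, ∑ k, b α k * e α k := fun v e => by
    have h1 : (v, fun α k => (e α k : ℂ)) = ∑ α, v α • ((Pi.single α 1, 0) :
        (Fin (2 * n) → ℝ) × (Fin (2 * n) → Fin K → ℂ)) +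
        ∑ α, ∑ k, e α k • ((0, Pi.single α (Pi.single k 1)) :
        (Fin (2 * n) → ℝ) × (Fin (2 * n) → Fin K → ℂ)) := by
      ext i
      · simp [Prod.fst_sum, Finset.sum_apply, Pi.single_apply]
      · rename_i k
        simp only [Prod.snd_add, Prod.snd_sum, Prod.smul_mk, smul_zero, Finset.sum_const_zero, zero_add,
          Finset.sum_apply, Pi.smul_apply]
        rw [Finset.sum_eq_single i (fun α _ h => Finset.sum_eq_zero fun m _ => by
          rw [Pi.single_eq_of_ne h.symm]; simp) (by simp),
          Finset.sum_eq_single k (fun m _ h => by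
            rw [Pi.single_eq_same, Pi.single_eq_of_ne h.symm, smul_zero]) (by simp)]
        simp
    rw [h1, map_add, map_sum, map_sum]
    simp only [map_sum, map_smul, Complex.real_smul]
    congr 1
    · exact Finset.sum_congr rfl fun α _ => mul_comm _ _
    · exact Finset.sum_congr rfl fun α _ => Finset.sum_congr rfl fun k _ => mul_comm _ _
  have hG : ∀ j, HasDerivAt (fun s : ℝ => F (μ (shift V j s),
      fun α k => moment (μ (shift V j s)) (shift V j s) α (k + 1)))
      (∑ α, a α * branchVelocity μ V j α + ∑ α, ∑ k : Fin K, b α k * d j α (k + 1)) 0 := fun j => by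
    rw [← hlin]
    have h1 : HasDerivAt (fun s : ℝ => (μ (shift V j s),
        fun (α : Fin (2 * n)) (k : Fin K) => moment (μ (shift V j s)) (shift V j s) α (k + 1)))
        (branchVelocity μ V j, fun α k => (d j α (k + 1) : ℂ)) 0 :=
      (hμd j).prodMk (hasDerivAt_pi.2 fun α => hasDerivAt_pi.2 fun k => hd j α (k + 1))
    refine HasFDerivAt.comp_hasDerivAt (0 : ℝ) (l := F) ?_ h1
    simpa only [shift_zero] using hF'
  set g : Fin (2 * n) ⊕ Fin (2 * n) × Fin K → ℝ[X] → ℂ :=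
    Sum.elim (fun α => fMu μ α) fun q => fMoment μ q.1 (q.2 + 1)
  set w : Fin (2 * n) ⊕ Fin (2 * n) × Fin K → ℂ → ℂ :=
    Sum.elim (fun α => branchDeriv μ c r V α) fun q => momentDeriv μ c r V q.1 (q.2 + 1)
  have hgw : ∀ i ∈ Finset.univ, IsLoopInsertion μ (g i) V (w i) := by
    rintro (α | q) _
    · exact hU.isLoopInsertion_branchDeriv hV hn α
    · exact hU.isLoopInsertion_momentDeriv hV hn q.1 _
  have hsum := isLoopInsertion_sum (G := fun V' => F (μ V', fun α k => moment (μ V') V' α (k + 1)))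
    (a := Sum.elim a fun q => b q.1 q.2) hgw fun j => by
      refine (hG j).congr_deriv ?_
      rw [Fintype.sum_sum_type, Fintype.sum_prod_type]
      simp only [g, Sum.elim_inl, Sum.elim_inr, hU.deriv_fMu hV, (hd j _ _).deriv]
  refine hU.isDerivativeCombination_congr hV hn (hU.isDerivativeCombination_sum hV hn _ ?_)
    (hf.eqOn hsum)
  rintro (α | q) _
  · exact hU.isDerivativeCombination_const_mul hV hn _
      (hU.isDerivativeCombination_branchDeriv hV hn α)
  · exact hU.isDerivativeCombination_const_mul hV hn _
      (hU.isDerivativeCombination_momentDeriv hV hn q.1 q.2)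

end

/-- Uniqueness: a total derivative is a combination of derivatives, the loop equation prescribes its
image under K̂ - 2W₀, and that map is injective there. Existence: F₁ provides the primitive, and
analyticity and decay follow from being a loop insertion. -/
theorem isGenusOneLoopMean_iff (hn : 1 ≤ n) {W : ℝ[X] → ℂ → ℂ} :
    IsGenusOneLoopMean U μ W ↔ ∀ V ∈ U, EqOn (W V) (loopMeanOne μ c r V) (cuts (μ V))ᶜ := by
  constructor
  · intro hW V hV
    obtain ⟨K, F, hF⟩ := hW.total
    refine hU.eqOn_of_loopOp_eq hV hn
      (hU.isDerivativeCombination_of_total hV hn (hF V hV).1 (hF V hV).2)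
      (hU.isDerivativeCombination_loopMeanOne hV hn) fun p hp => ?_
    exact (hW.loop V hV p hp).unique (hU.hasLoopInsertionAt_planarW hV hn hp)
  · intro h
    have hins : ∀ V ∈ U, IsLoopInsertion μ
        (fun V' => freeEnergyOne c r (μ V', fun α k => moment (μ V') V' α (k + 1))) V (W V) :=
      fun V hV => (hU.isLoopInsertion_freeEnergyOne hV hn).congr (h V hV).symm
    exact
      { analytic := fun V hV => (hins V hV).1
        decay := fun V hV => (hins V hV).isBigO
        loop := fun V hV p hp => by
          rw [loopOp_congr (h V hV) hp]
          exact hU.hasLoopInsertionAt_planarW hV hn hp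
        total := ⟨1, freeEnergyOne c r, fun V hV =>
          ⟨differentiableAt_freeEnergyOne (hU.strictMono V hV) (hU.encircles hV)
            fun α => hU.nonsingular V hV α, hins V hV⟩⟩ }

end IsCutFamily

end

end MultiCut

end

/-! ### The main theorem, assembled -/

theorem mainTheorem3 (n : ℕ) (hn : 1 ≤ n) (U : Set (Polynomial ℝ))
    (μ : Polynomial ℝ → Fin (2 * n) → ℝ) (c r : Fin (n - 1) → ℝ)
    (hU : MultiCut.IsCutFamily U μ c r) :
    -- the loop insertion operator is defined on all the quantities involved
    (∀ V ∈ U, ∀ α : Fin (2 * n),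
      MultiCut.IsLoopInsertion μ (MultiCut.fMu μ α) V (MultiCut.dV μ (MultiCut.fMu μ α) V) ∧
      (∀ k ≥ 1, MultiCut.IsLoopInsertion μ (MultiCut.fMoment μ α k) V
        (MultiCut.dV μ (MultiCut.fMoment μ α k) V)) ∧
      MultiCut.IsLoopInsertion μ (MultiCut.fLogM μ α) V (MultiCut.dV μ (MultiCut.fLogM μ α) V) ∧
      (∀ β ≠ α, MultiCut.IsLoopInsertion μ (MultiCut.fLogDiff μ α β) V
        (MultiCut.dV μ (MultiCut.fLogDiff μ α β) V))) ∧
    ∃ (L : Polynomial ℝ → Fin (2 * n) → Fin (n - 1) → ℂ)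
      (χ : Polynomial ℝ → Fin (2 * n) → ℕ → ℂ → ℂ),
      -- the coefficients of the zero modes
      (∀ V ∈ U, ∀ L' : Fin (2 * n) → Fin (n - 1) → ℂ,
        MultiCut.SolvesZeroModeSystem (μ V) c r L' ↔ L' = L V) ∧
      (∀ V ∈ U, ∀ α, ∀ p ∉ MultiCut.cuts (μ V),
        MultiCut.moment (μ V) V α 1 * MultiCut.dV μ (MultiCut.fMu μ α) V p =
          MultiCut.phi (μ V) α 1 p
            + MultiCut.zeroModePoly (L V) α p * MultiCut.phiZero (μ V) p) ∧
      -- the basis functions for `k = 1, 2`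
      (∀ V ∈ U, ∀ α, ∀ k ∈ ({1, 2} : Set ℕ), ∀ f : ℂ → ℂ,
        MultiCut.IsBasisFunction μ V α k f ↔ Set.EqOn f (χ V α k) (MultiCut.cuts (μ V))ᶜ) ∧
      (∀ V ∈ U, ∀ α, ∀ p ∉ MultiCut.cuts (μ V),
        χ V α 1 p = MultiCut.dV μ (MultiCut.fMu μ α) V p ∧
        χ V α 2 p = -(2 / 3) * MultiCut.dV μ (MultiCut.fLogM μ α) V p
          - 1 / 3 * ∑ β ∈ Finset.univ.erase α, MultiCut.dV μ (MultiCut.fLogDiff μ α β) V p) ∧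
      -- the genus-one loop mean: it exists, is unique, and is given by the formula
      (∀ W : Polynomial ℝ → ℂ → ℂ, MultiCut.IsGenusOneLoopMean U μ W ↔
        ∀ V ∈ U, ∀ p ∉ MultiCut.cuts (μ V),
          W V p = 1 / 16 * ∑ α, χ V α 2 p
            - 1 / 8 * ∑ α, ∑ β ∈ Finset.Ioi α,
                1 / ((μ V α : ℂ) - μ V β) * (χ V α 1 p - χ V β 1 p)
            + 1 / 4 * ∑ α, MultiCut.zeroModePoly (L V) α (μ V α) * χ V α 1 p) ∧
      -- the same, written out through the loop insertion operator
      (∀ W : Polynomial ℝ → ℂ → ℂ, MultiCut.IsGenusOneLoopMean U μ W ↔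
        ∀ V ∈ U, ∀ p ∉ MultiCut.cuts (μ V),
          W V p = 1 / 16 * ∑ α, (-(2 / 3) * MultiCut.dV μ (MultiCut.fLogM μ α) V p
              - 1 / 3 * ∑ β ∈ Finset.univ.erase α, MultiCut.dV μ (MultiCut.fLogDiff μ α β) V p)
            - 1 / 8 * ∑ α, ∑ β ∈ Finset.Ioi α, 1 / ((μ V α : ℂ) - μ V β) *
                (MultiCut.dV μ (MultiCut.fMu μ α) V p - MultiCut.dV μ (MultiCut.fMu μ β) V p)
            + 1 / 4 * ∑ α, MultiCut.zeroModePoly (L V) α (μ V α) *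
                MultiCut.dV μ (MultiCut.fMu μ α) V p) := by
  refine ⟨fun V hV α => ⟨(hU.isLoopInsertion_branchDeriv hV hn α).isLoopInsertion_dV,
    fun k _ => (hU.isLoopInsertion_momentDeriv hV hn α k).isLoopInsertion_dV,
    (hU.isLoopInsertion_fLogM hV hn α).isLoopInsertion_dV,
    fun β hβ => (hU.isLoopInsertion_fLogDiff hV hn hβ).isLoopInsertion_dV⟩, ?_⟩
  have hd : ∀ V ∈ U, ∀ α, ∀ p ∉ MultiCut.cuts (μ V),
      MultiCut.dV μ (MultiCut.fMu μ α) V p = MultiCut.branchDeriv μ c r V α p := fun V hV α p hp =>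
    (hU.isLoopInsertion_branchDeriv hV hn α).dV_eq hp
  have hM : ∀ V ∈ U, ∀ α, ∀ p ∉ MultiCut.cuts (μ V),
      MultiCut.dV μ (MultiCut.fLogM μ α) V p = MultiCut.logMomentDeriv μ c r V α p :=
    fun V hV α p hp => (hU.isLoopInsertion_fLogM hV hn α).dV_eq hp
  have hD : ∀ V ∈ U, ∀ α β, β ≠ α → ∀ p ∉ MultiCut.cuts (μ V),
      MultiCut.dV μ (MultiCut.fLogDiff μ α β) V p = MultiCut.logDiffDeriv μ c r V α β p :=
    fun V hV α β hβ p hp => (hU.isLoopInsertion_fLogDiff hV hn hβ).dV_eq hp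
  have hX : ∀ V ∈ U, ∀ α, ∀ p ∉ MultiCut.cuts (μ V), MultiCut.basisTwo μ c r V α p =
      -(2 / 3) * MultiCut.dV μ (MultiCut.fLogM μ α) V p
        - 1 / 3 * ∑ β ∈ Finset.univ.erase α, MultiCut.dV μ (MultiCut.fLogDiff μ α β) V p :=
    fun V hV α p hp => by
    rw [hM V hV α p hp, Finset.sum_congr rfl fun β hβ =>
      hD V hV α β (Finset.ne_of_mem_erase hβ) p hp, MultiCut.basisTwo]
  -- Only k = 1 and k = 2 matter for χ; the value at any other k is arbitrary.
  refine ⟨fun V => MultiCut.zeroModeCoeff (μ V) c r, fun V α k =>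
    if k = 1 then MultiCut.branchDeriv μ c r V α else MultiCut.basisTwo μ c r V α,
    fun V hV => MultiCut.solvesZeroModeSystem_iff (hU.strictMono V hV) (hU.encircles hV) hn,
    fun V hV α p hp => ?_, fun V hV α k hk f => ?_, fun V hV α p hp => ?_, fun W => ?_, fun W => ?_⟩
  · rw [hd V hV α p hp, MultiCut.branchDeriv, mul_div_cancel₀ _ (hU.nonsingular V hV α),
      MultiCut.branchForm]
  · rcases hk with rfl | hk
    · exact hU.isBasisFunction_iff hV hn (hU.isDerivativeCombination_branchDeriv hV hn α)
        fun p hp => by rw [hU.loopOp_branchDeriv hV hp, pow_one]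
    · rw [Set.mem_singleton_iff] at hk
      subst hk
      exact hU.isBasisFunction_iff hV hn (hU.isDerivativeCombination_basisTwo hV hn α)
        fun p hp => hU.loopOp_basisTwo hV hn hp α
  · exact ⟨(hd V hV α p hp).symm, hX V hV α p hp⟩
  · rw [hU.isGenusOneLoopMean_iff hn]
    refine forall₂_congr fun V hV => forall₂_congr fun p hp => ?_
    simp only [MultiCut.loopMeanOne, MultiCut.logDiffDeriv, one_div, if_true, OfNat.ofNat_ne_one, if_false]
  · rw [hU.isGenusOneLoopMean_iff hn]
    refine forall₂_congr fun V hV => forall₂_congr fun p hp => ?_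
    simp only [MultiCut.loopMeanOne, MultiCut.logDiffDeriv, hX V hV _ p hp, hd V hV _ p hp, one_div]
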